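/- **Theorem (Complexity of the Static Verification Problem).** Fix a TBox $\mathcal T$, a set $\mathcal S$ of core specifications, an action $\gamma$ and a \textsc{Must}/\textsc{May} query $q$. There is a deterministic Turing machine (with several stacks) which, given as input the data of a well-formed DL-Lite$^{\mathcal F}$ core-closed knowledge base $\mathcal K=(\mathcal T,\mathcal A,\mathcal S,\mathcal M)$, i.e. lists of its open individuals $\mathbf I^{\mathcal K}$, its model individuals $\mathbf I^{\mathcal M}$, its ABox $\mathcal A$ and its core $\mathcal M=\{\mathcal M_i\}$, decides in time polynomial in the length of that input whether $\gamma$ preserves $q$ over $\mathcal K$. (So static verification is in polynomial time in data complexity.) The notions are the following. *Knowledge bases.* Individuals, concept names and role names are finite bit strings (each predicate name also carries its kind: open or core). Concept and role names are partitioned into open ones (subscript $\mathcal K$) and core-closed ones (subscript $\mathcal S$). $\mathbf I^{\mathcal K}$ and $\mathbf I^{\mathcal M}$ are disjoint finite sets of individuals; the other individuals are inactive. Basic concepts are $B::=\bot\mid A\mid\exists p$ with $p$ a role name or its inverse. Then $\mathcal S$ is a finite set of statements $B^1_{\mathcal S}\sqsubseteq B^2_{\mathcal S}$, $B^1_{\mathcal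 S}\sqsubseteq\neg B^2_{\mathcal S}$, $\mathsf{Func}(P_{\mathcal S})$; $\mathcal T$ is a finite set of statements $B^1\sqsubseteq B^2_{\mathcal K}$, $B^1\sqsubseteq\neg B^2_{\mathcal K}$, $\mathsf{Func}(P_{\mathcal K})$; $\mathcal A$ is a finite set of assertions $A(a)$, $R(a,b)$ over open individuals (with open or core-closed predicates); $\mathcal M$ is a finite set of *core assertions* over $\mathbf I^{\mathcal K}\cup\mathbf I^{\mathcal M}$, i.e. assertions $A_{\mathcal S}(a)$ with $a\in\mathbf I^{\mathcal M}$, or $R_{\mathcal S}(a,b)$ with $a\in\mathbf I^{\mathcal M}$ or $b\in\mathbf I^{\mathcal M}$; it is partitioned into blocks $\mathcal M_i$ with $i\in\mathbf I^{\mathcal M}$. For all other $i$ put $\mathcal M_i=\emptyset$. *Semantics.* Interpretations $\mathcal I$ satisfy the unique name assumption on all individuals. $\mathcal I$ is a model of $\mathcal K$ if it satisfies $\mathcal T$, $\mathcal S$ and $\mathcal A$ in the usual sense and models $\mathcal M$ under the closed-world assumption: a core assertion $f$ (one that mentions a model individual as above) holds in $\mathcal I$ if and only if $f\in\mathcal M$;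 and if a core-closed role or its inverse relates $a^{\mathcal I}$, $a\in\mathbf I^{\mathcal M}$, to some $d$, then $d=b^{\mathcal I}$ for some individual $b$. *Queries.* A \textsc{Must}/\textsc{May} query is $\psi::=\neg\psi\mid\psi\wedge\psi\mid\psi\vee\psi\mid\textsc{Must}\,\varphi\mid\textsc{May}\,\varphi_{\not\approx}$, where $\varphi$ is a union of conjunctive queries and $\varphi_{\not\approx}$ is a union of conjunctive queries possibly with inequalities. A tuple $\vec c$ satisfies $\textsc{Must}\,\varphi$ over $\mathcal K$ if $\mathcal I\models\varphi[\vec c]$ for all models $\mathcal I$ of $\mathcal K$, and $\textsc{May}\,\varphi_{\not\approx}$ if $\mathcal I\models\varphi_{\not\approx}[\vec c]$ for some model $\mathcal I$ of $\mathcal K$; Boolean connectives are read as usual. $\mathsf{ANS}(\psi,\mathcal K)$ is the set of tuples over $\mathbf I^{\mathcal K}\cup\mathbf I^{\mathcal M}$ that satisfy $\psi$ over $\mathcal K$. *Actions.* $\gamma::=\epsilon\mid\beta\cdot\gamma\mid[\varphi\rightsquigarrow\beta]\cdot\gamma$ and $\beta::=\oplus_xS\mid\ominus_xS\mid\odot_xS\mid\ominus_x$,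 where $S$ is a finite set of atoms and $\varphi$ a Boolean combination of atoms, with individuals, input variables of $\gamma$ and, in a conditional, answer variables of $\varphi$ as arguments. A grounding $\vec\theta$ maps the input variables to arbitrary individuals. Execution starts with $\vec\rho=\vec\theta$, leaves $\mathcal T,\mathcal A,\mathcal S,\mathbf I^{\mathcal K}$ unchanged and updates $(\mathcal M,\mathbf I^{\mathcal M})$ as follows, where $ind(\cdot)$ is the set of individuals occurring in a set of assertions, and $\mathcal M'$ is the new core: - $\oplus_xS$ and $\odot_xS$ replace $\mathcal M_{\vec\rho(x)}$ by $\mathcal M_{\vec\rho(x)}\cup S_{\vec\rho}$, and $\mathbf I^{\mathcal M}$ by $\mathbf I^{\mathcal M}\cup(ind(S_{\vec\rho})\setminus\mathbf I^{\mathcal K})$; - $\ominus_xS$ replaces $\mathcal M_{\vec\rho(x)}$ by $\mathcal M_{\vec\rho(x)}\setminus S_{\vec\rho}$, and $\mathbf I^{\mathcal M}$ by $\mathbf I^{\mathcal M}\setminus(ind(S_{\vec\rho})\setminus ind(\mathcal M'))$; - $\ominus_x$ removes the block $\mathcal M_{\vec\rho(x)}$, and replaces $\mathbf I^{\mathcal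 M}$ by $\mathbf I^{\mathcal M}\setminus(ind(\mathcal M_{\vec\rho(x)})\setminus ind(\mathcal M'))$. A basic effect can be executed only if $\vec\rho(x)\notin\mathbf I^{\mathcal K}$, all elements of $S_{\vec\rho}$ are core assertions (individuals outside $\mathbf I^{\mathcal K}$ being allowed as model individuals) and, for $\odot_x$, the block is fresh ($\mathcal M_{\vec\rho(x)}=\emptyset$). In $\beta\cdot\gamma$ first $\beta$, then $\gamma$ is executed. In $[\varphi\rightsquigarrow\beta]\cdot\gamma$ first $\beta$ is executed with $\vec\rho\,\vec t$ once for every answer $\vec t$ of $\varphi$ in the current $\mathcal M$, one after the other, and then $\gamma$ is executed with $\vec\rho$; the answers are the tuples $\vec t$ over $\mathbf I^{\mathcal M}\cup ind(\mathcal M)$ for which all atoms of $\varphi_{\vec\rho\vec t}$ are core assertions (in the same sense) and $\varphi_{\vec\rho\vec t}$ is true in $\mathcal M$ (an atom being true iff it belongs to $\mathcal M$). The result is $\mathcal K^{\gamma\vec\theta}$. *Preservation.* $\gamma$ preserves $q$ over $\mathcal K$ if $\mathsf{ANS}(q,\mathcal K)=\mathsf{ANS}(q,\mathcal K^{\gamma\vec\theta})$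 for every grounding $\vec\theta$ for which $\gamma\vec\theta$ can be executed over $\mathcal K$. -/

import Mathlib

namespace CoreClosed

/-! ## Alphabets, axioms and assertions -/

/-- All names (of individuals, concepts and roles) are finite bit strings. -/
abbrev Word : Type := List Bool

/-- The two sorts of predicates: open ones and core-closed (specification) ones. -/
inductive Mode : Type
  | opn
  | core
  deriving DecidableEq

/-- Concept names; the alphabet is partitioned by `mode`. -/
structure ConceptName : Type where
  mode : Mode
  word : Word
  deriving DecidableEq

/-- Role names; the alphabet is partitioned by `mode`. -/
structure RoleName : Type where
  mode : Mode
  word : Word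
  deriving DecidableEq

/-- Roles `p`: a role name `r` or its inverse. -/
inductive Role : Type
  | dir (r : RoleName)
  | inv (r : RoleName)
  deriving DecidableEq

/-- The mode of the underlying role name. -/
def Role.mode : Role → Mode
  | .dir r => r.mode
  | .inv r => r.mode

/-- Basic concepts `B ::= ⊥ | A | ∃p`. -/
inductive Basic : Type
  | bot
  | atom (A : ConceptName)
  | ex (p : Role)
  deriving DecidableEq

/-- `B` is built from predicates of mode `m` only. -/
def Basic.Over (m : Mode) : Basic → Prop
  | .bot => True
  | .atom A => A.mode = m
  | .ex p => p.mode = m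

/-- The terminological statements of DL-Lite_F: positive inclusions `B₁ ⊑ B₂`, negative inclusions
`B₁ ⊑ ¬B₂` and functionality statements `(funct p)`. -/
inductive Constraint : Type
  | pos (B₁ B₂ : Basic)
  | neg (B₁ B₂ : Basic)
  | func (p : Role)
  deriving DecidableEq

/-- `S ⊆ { B¹_S ⊑ B²_S, B¹_S ⊑ ¬B²_S, Func(P_S) }`. -/
def Constraint.IsSpec : Constraint → Prop
  | .pos B₁ B₂ => B₁.Over .core ∧ B₂.Over .core
  | .neg B₁ B₂ => B₁.Over .core ∧ B₂.Over .core
  | .func p => p.mode = .core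

/-- `T ⊆ { B¹ ⊑ B²_K, B¹ ⊑ ¬B²_K, Func(P_K) }`. -/
def Constraint.IsTerm : Constraint → Prop
  | .pos _ B₂ => B₂.Over .opn
  | .neg _ B₂ => B₂.Over .opn
  | .func p => p.mode = .opn

/-- Atoms `A(t)` and `R(t₁,t₂)` over arguments of type `τ`. -/
inductive Atom (τ : Type) : Type
  | concept (A : ConceptName) (t : τ)
  | role (R : RoleName) (t₁ t₂ : τ)
  deriving DecidableEq

/-- Replace the arguments of an atom. -/
def Atom.map {τ τ' : Type} (g : τ → τ') : Atom τ → Atom τ'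
  | .concept A t => .concept A (g t)
  | .role R t₁ t₂ => .role R (g t₁) (g t₂)

/-- Assertions are atoms over individuals. -/
abbrev Assertion : Type := Atom Word

/-- The individuals occurring in an assertion. -/
def Assertion.ind : Assertion → Finset Word
  | .concept _ a => {a}
  | .role _ a b => {a, b}

/-- The individuals occurring in a set of assertions. -/
def ind (S : Finset Assertion) : Finset Word := S.biUnion Assertion.ind

/-- `f` is of one of the forms `A_S(a_M)`, `R_S(a_M,a)`, `R_S(a,a_M)`, where `a_M` ranges over
the set `N`. -/
def Assertion.IsCore (N : Set Word) : Assertion → Prop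
  | .concept A a => A.mode = .core ∧ a ∈ N
  | .role R a b => R.mode = .core ∧ (a ∈ N ∨ b ∈ N)

/-- `f` is of one of the forms `A_K(a_K)`, `R_K(a_K,b_K)`, `A_S(a_K)`, `R_S(a_K,b_K)`, where
`a_K`, `b_K` range over the set `N`. -/
def Assertion.IsOpen (N : Set Word) : Assertion → Prop
  | .concept _ a => a ∈ N
  | .role _ a b => a ∈ N ∧ b ∈ N

/-! ## Core-closed knowledge bases -/

/-- A core-closed knowledge base `(T, A, S, M)`, together with its sets of open individuals and of
model individuals; the remaining words form the pool of inactive individuals.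
`M` is divided into blocks: `(i, f) ∈ mbox` means that the assertion `f` is in the block `M_i`
(so nodes without a block are the ones with empty `M_i`). -/
structure CCKB : Type where
  tbox : Finset Constraint
  sbox : Finset Constraint
  openInd : Finset Word
  modelInd : Finset Word
  abox : Finset Assertion
  mbox : Finset (Word × Assertion)

namespace CCKB

/-- The set `M`, the union of all blocks. -/
def core (K : CCKB) : Finset Assertion := K.mbox.image Prod.snd

/-- The block `M_i`. -/
def block (K : CCKB) (i : Word) : Finset Assertion :=
  (K.mbox.filter fun p => p.1 = i).image Prod.snd

/-- The known individuals (constants) of the knowledge base. -/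
def constants (K : CCKB) : Finset Word := K.openInd ∪ K.modelInd

/-- The syntactic conditions on a core-closed knowledge base whose core is partitioned into blocks
that are rooted at model nodes. -/
structure WellFormed (K : CCKB) : Prop where
  tbox : ∀ c ∈ K.tbox, c.IsTerm
  sbox : ∀ c ∈ K.sbox, c.IsSpec
  disjoint : Disjoint K.openInd K.modelInd
  abox : ∀ f ∈ K.abox, f.IsOpen ↑K.openInd
  mbox : ∀ f ∈ K.core, f.IsCore ↑K.modelInd
  ind_mbox : ind K.core ⊆ K.constants
  root : ∀ i f, (i, f) ∈ K.mbox → i ∈ K.modelInd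
  partition : ∀ i j f, (i, f) ∈ K.mbox → (j, f) ∈ K.mbox → i = j

end CCKB

/-! ## Semantics -/

/-- Interpretations with domain `Δ`, under the unique name assumption. -/
structure Interp (Δ : Type) : Type where
  ind : Word → Δ
  concept : ConceptName → Set Δ
  role : RoleName → Set (Δ × Δ)
  unique_names : Function.Injective ind

namespace Interp

variable {Δ : Type} (I : Interp Δ)

/-- The extension of a role. -/
def roleExt : Role → Set (Δ × Δ)
  | .dir r => I.role r
  | .inv r => {x | (x.2, x.1) ∈ I.role r}

/-- The extension of a basic concept. -/
def basicExt : Basic → Set Δ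
  | .bot => ∅
  | .atom A => I.concept A
  | .ex p => {d | ∃ e, (d, e) ∈ I.roleExt p}

/-- `I` is a model of a terminological statement. -/
def SatConstraint : Constraint → Prop
  | .pos B₁ B₂ => I.basicExt B₁ ⊆ I.basicExt B₂
  | .neg B₁ B₂ => I.basicExt B₁ ⊆ (I.basicExt B₂)ᶜ
  | .func p => ∀ d e e', (d, e) ∈ I.roleExt p → (d, e') ∈ I.roleExt p → e = e'

/-- An atom over domain elements is true in `I`. -/
def SatAtom : Atom Δ → Prop
  | .concept A d => d ∈ I.concept A
  | .role R d e => (d, e) ∈ I.role R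

/-- `I` is a model of an assertion. -/
def SatAssertion (f : Assertion) : Prop := I.SatAtom (f.map I.ind)

/-- `I` models the core of `K` under the closed-world assumption: an assertion about a model node
over core-closed predicates holds iff it is in the core, and the only elements that a model node is
related to by a core-closed role are named ones (so that missing role assertions of a model node
cannot be completed with anonymous elements). -/
def SatCore (K : CCKB) : Prop :=
  (∀ f : Assertion, f.IsCore ↑K.modelInd → (I.SatAssertion f ↔ f ∈ K.core)) ∧
  (∀ a ∈ K.modelInd, ∀ p : Role, p.mode = .core →
    ∀ d, (I.ind a, d) ∈ I.roleExt p → ∃ b, I.ind b = d)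

/-- `I` is a model of `K`. -/
def IsModel (K : CCKB) : Prop :=
  (∀ c ∈ K.tbox, I.SatConstraint c) ∧ (∀ c ∈ K.sbox, I.SatConstraint c) ∧
  (∀ f ∈ K.abox, I.SatAssertion f) ∧ I.SatCore K

end Interp

/-! ## Queries -/

/-- Terms: individuals or variables from `V`. -/
inductive Tm (V : Type) : Type
  | const (a : Word)
  | var (v : V)
  deriving DecidableEq

/-- The value of a term, given values of the individuals and of the variables. -/
def Tm.eval {V D : Type} (c : Word → D) (ρ : V → D) : Tm V → D
  | .const a => c a
  | .var v => ρ v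

/-- Conjunctive queries, possibly with inequalities, with answer variables `Fin k` and
existentially quantified variables `Fin e`. -/
structure CQ (k : ℕ) : Type where
  e : ℕ
  atoms : List (Atom (Tm (Fin k ⊕ Fin e)))
  ineqs : List (Tm (Fin k ⊕ Fin e) × Tm (Fin k ⊕ Fin e))

/-- `I ⊨ q[c]`. -/
def CQ.Holds {k : ℕ} {Δ : Type} (I : Interp Δ) (q : CQ k) (c : Fin k → Word) : Prop :=
  ∃ y : Fin q.e → Δ,
    let val : Tm (Fin k ⊕ Fin q.e) → Δ := Tm.eval I.ind (Sum.elim (fun i => I.ind (c i)) y)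
    (∀ f ∈ q.atoms, I.SatAtom (f.map val)) ∧ (∀ p ∈ q.ineqs, val p.1 ≠ val p.2)

/-- Unions of conjunctive queries, possibly with inequalities. -/
abbrev UCQNeq (k : ℕ) : Type := List (CQ k)

/-- Unions of conjunctive queries (without inequalities). -/
abbrev UCQ (k : ℕ) : Type := {φ : UCQNeq k // ∀ q ∈ φ, q.ineqs = []}

/-- `I ⊨ φ[c]`. -/
def UCQNeq.Holds {k : ℕ} {Δ : Type} (I : Interp Δ) (φ : UCQNeq k) (c : Fin k → Word) : Prop :=
  ∃ q ∈ φ, q.Holds I c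

/-- Must/May queries with answer variables `Fin k`. -/
inductive MustMay (k : ℕ) : Type
  | not (ψ : MustMay k)
  | and (ψ₁ ψ₂ : MustMay k)
  | or (ψ₁ ψ₂ : MustMay k)
  | must (φ : UCQ k)
  | may (φ : UCQNeq k)

/-- The tuple `c` satisfies `ψ` over `K`: `Must φ` is query entailment, `May φ` is query
satisfiability. -/
def MustMay.Holds {k : ℕ} (K : CCKB) (c : Fin k → Word) : MustMay k → Prop
  | .not ψ => ¬ ψ.Holds K c
  | .and ψ₁ ψ₂ => ψ₁.Holds K c ∧ ψ₂.Holds K c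
  | .or ψ₁ ψ₂ => ψ₁.Holds K c ∨ ψ₂.Holds K c
  | .must φ => ∀ (Δ : Type) (I : Interp Δ), I.IsModel K → UCQNeq.Holds I φ.1 c
  | .may φ => ∃ (Δ : Type) (I : Interp Δ), I.IsModel K ∧ UCQNeq.Holds I φ c

/-- `ANS(ψ, K)`, a set of tuples of constants of `K`. -/
def MustMay.ANS {k : ℕ} (ψ : MustMay k) (K : CCKB) : Set (Fin k → Word) :=
  {c | (∀ i, c i ∈ K.constants) ∧ ψ.Holds K c}

/-! ## Actions -/

/-- Action queries: Boolean combinations of atoms. -/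
inductive ActQuery (V : Type) : Type
  | atom (f : Atom (Tm V))
  | and (φ₁ φ₂ : ActQuery V)
  | or (φ₁ φ₂ : ActQuery V)
  | not (φ : ActQuery V)

namespace ActQuery

variable {V : Type} (ρ : V → Word)

/-- Truth of a grounded action query in the set `M` of assertions. -/
def Holds (M : Finset Assertion) : ActQuery V → Prop
  | .atom f => f.map (Tm.eval id ρ) ∈ M
  | .and φ₁ φ₂ => φ₁.Holds M ∧ φ₂.Holds M
  | .or φ₁ φ₂ => φ₁.Holds M ∨ φ₂.Holds M
  | .not φ => ¬ φ.Holds M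

/-- All atoms of the grounded action query are core assertions, for the set `N` of individuals that
may serve as model nodes. -/
def IsCore (N : Set Word) : ActQuery V → Prop
  | .atom f => Assertion.IsCore N (f.map (Tm.eval id ρ))
  | .and φ₁ φ₂ => φ₁.IsCore N ∧ φ₂.IsCore N
  | .or φ₁ φ₂ => φ₁.IsCore N ∧ φ₂.IsCore N
  | .not φ => φ.IsCore N

open Classical in
/-- The answers to `φ` in the core of `K`, for a given grounding `θ` of the input variables: tuples
of model and boundary nodes. For `m = 0` the answer "true" is the set containing the empty tuple,
and "false" is the empty set. -/
noncomputable def ANS {n m : ℕ} (φ : ActQuery (Fin n ⊕ Fin m)) (θ : Fin n → Word) (K : CCKB) :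
    Finset (Fin m → Word) :=
  (Fintype.piFinset fun _ : Fin m => K.modelInd ∪ ind K.core).filter fun t =>
    φ.IsCore (Sum.elim θ t) (↑K.openInd)ᶜ ∧ φ.Holds (Sum.elim θ t) K.core

end ActQuery

/-- Basic effects, with variables from `V`: `⊕_x S`, `⊖_x S`, `⊙_x S`, `⊖_x`. -/
inductive BasicEffect (V : Type) : Type
  | add (x : Tm V) (S : Finset (Atom (Tm V)))
  | remove (x : Tm V) (S : Finset (Atom (Tm V)))
  | create (x : Tm V) (S : Finset (Atom (Tm V)))
  | delete (x : Tm V)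

namespace BasicEffect

variable {V : Type} (ρ : V → Word)

/-- The grounded set `S_ρ`. -/
def ground (S : Finset (Atom (Tm V))) : Finset Assertion := S.image (Atom.map (Tm.eval id ρ))

/-- The grounded effect can be executed over `K`: the affected block is not the one of an open
individual, the grounded set consists of core assertions (individuals that are not open may serve as
model nodes), and the block introduced by `⊙` is fresh. -/
def Applicable (K : CCKB) : BasicEffect V → Prop
  | .add x S => x.eval id ρ ∉ K.openInd ∧ ∀ f ∈ ground ρ S, f.IsCore (↑K.openInd)ᶜ
  | .remove x S => x.eval id ρ ∉ K.openInd ∧ ∀ f ∈ ground ρ S, f.IsCore (↑K.openInd)ᶜ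
  | .create x S => x.eval id ρ ∉ K.openInd ∧ (∀ f ∈ ground ρ S, f.IsCore (↑K.openInd)ᶜ) ∧
      K.block (x.eval id ρ) = ∅
  | .delete x => x.eval id ρ ∉ K.openInd

end BasicEffect

/-- Put the assertions of `S` into the block `M_i`; their individuals that are not open become model
nodes. -/
def CCKB.insertBlock (K : CCKB) (i : Word) (S : Finset Assertion) : CCKB :=
  { K with
    mbox := K.mbox ∪ S.image fun f => (i, f)
    modelInd := K.modelInd ∪ (CoreClosed.ind S \ K.openInd) }

/-- Remove the assertions of `S` from the block `M_i`; the individuals of `S` that do not occur in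
the new core any more cease to be model nodes. -/
def CCKB.removeBlock (K : CCKB) (i : Word) (S : Finset Assertion) : CCKB :=
  let mbox' := K.mbox \ S.image fun f => (i, f)
  { K with
    mbox := mbox'
    modelInd := K.modelInd \ (CoreClosed.ind S \ CoreClosed.ind (mbox'.image Prod.snd)) }

/-- The transformation of a grounded basic effect. -/
def BasicEffect.update {V : Type} (ρ : V → Word) (K : CCKB) : BasicEffect V → CCKB
  | .add x S => K.insertBlock (x.eval id ρ) (ground ρ S)
  | .remove x S => K.removeBlock (x.eval id ρ) (ground ρ S)
  | .create x S => K.insertBlock (x.eval id ρ) (ground ρ S)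
  | .delete x => K.removeBlock (x.eval id ρ) (K.block (x.eval id ρ))

open Classical in
/-- The transformation of a grounded basic effect, undefined if it cannot be executed. -/
noncomputable def BasicEffect.apply {V : Type} (β : BasicEffect V) (ρ : V → Word) (K : CCKB) :
    Option CCKB :=
  if β.Applicable ρ K then some (β.update ρ K) else none

/-- Actions with input variables `Fin n`. In the conditional effect `[φ ↝ β] · γ` the query `φ` has
the answer variables `Fin m`, which may also be used in `β`. -/
inductive Action (n : ℕ) : Type
  | nil
  | basic (β : BasicEffect (Fin n)) (γ : Action n)
  | cond (m : ℕ) (φ : ActQuery (Fin n ⊕ Fin m)) (β : BasicEffect (Fin n ⊕ Fin m)) (γ : Action n)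

/-- The knowledge base resulting from the execution of the grounded action, undefined if some step
cannot be executed. In a conditional effect the nested basic effect is executed once for each answer
tuple, one after the other (the order is irrelevant). -/
noncomputable def Action.apply {n : ℕ} (θ : Fin n → Word) : Action n → CCKB → Option CCKB
  | .nil, K => some K
  | .basic β γ, K => (β.apply θ K).bind (γ.apply θ)
  | .cond _ φ β γ, K =>
      ((φ.ANS θ K).toList.foldlM (fun K' t => β.apply (Sum.elim θ t) K') K).bind (γ.apply θ)

/-- The action `γ` preserves `q` over `K`: all executable groundings leave the answers of `q`
unchanged. -/
def Preserves {n k : ℕ} (γ : Action n) (q : MustMay k) (K : CCKB) : Prop :=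
  ∀ (θ : Fin n → Word) (K' : CCKB), γ.apply θ K = some K' → q.ANS K = q.ANS K'

/-! ## Data and their encoding -/

/-- The data of a knowledge base, as lists. -/
structure Data : Type where
  openInd : List Word
  modelInd : List Word
  abox : List Assertion
  mbox : List (Word × Assertion)

/-- The knowledge base with given terminologies `T`, `S` and given data. -/
def Data.kb (T S : Finset Constraint) (D : Data) : CCKB where
  tbox := T
  sbox := S
  openInd := D.openInd.toFinset
  modelInd := D.modelInd.toFinset
  abox := D.abox.toFinset
  mbox := D.mbox.toFinset

/-- The input alphabet. -/
inductive Sym : Type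
  | bit (b : Bool)
  | done
  | openInd
  | modelInd
  | abox
  | mbox
  | concept
  | role
  | opn
  | core
  deriving DecidableEq

/-- A word, followed by an end marker. -/
def Word.encode (w : Word) : List Sym := w.map Sym.bit ++ [Sym.done]

/-- A mode is encoded by one symbol. -/
def Mode.encode : Mode → Sym
  | .opn => Sym.opn
  | .core => Sym.core

/-- Encoding of assertions. -/
def Assertion.encode : Assertion → List Sym
  | .concept A a => [Sym.concept, A.mode.encode] ++ Word.encode A.word ++ Word.encode a
  | .role R a b =>
      [Sym.role, R.mode.encode] ++ Word.encode R.word ++ Word.encode a ++ Word.encode b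

/-- Encoding of the data; individuals and predicates are written out as bit strings. -/
def Data.encode (D : Data) : List Sym :=
  D.openInd.flatMap (fun a => Sym.openInd :: Word.encode a) ++
  D.modelInd.flatMap (fun a => Sym.modelInd :: Word.encode a) ++
  D.abox.flatMap (fun f => Sym.abox :: Assertion.encode f) ++
  D.mbox.flatMap (fun p => Sym.mbox :: (Word.encode p.1 ++ Assertion.encode p.2))

/-- The inputs of the static verification problem for fixed `T`, `S`: the data for which the
knowledge base is well-formed. -/
abbrev Input (T S : Finset Constraint) : Type := {D : Data // (D.kb T S).WellFormed}

/-- The predicate `P` on `α` is decidable in polynomial time, for inputs encoded by `enc`. -/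
def DecidableInPolyTime {α Γ : Type} (enc : α → List Γ) (P : α → Prop) : Prop :=
  ∃ f : α → Bool, (∀ x, f x = true ↔ P x) ∧
    Nonempty (Turing.TM2ComputableInPolyTime enc Computability.encodeBool f)

end CoreClosed

/-! Preservation is a first-order property of the data, and a fixed first-order sentence can be
evaluated in polynomial time.

Definability. The data form a structure on words whose relations are the kinds of `Fact`, with
predicate names as ordinary arguments; `Def` collects the first-order definable properties. Three
ingredients make preservation definable (`Def.preserves`). The first is the canonical model
`CCKB.canon`. Over every individual grows a tree of witnesses; a witness is added only where neither
an asserted successor nor the parent already serves. Hence new elements never break functionality,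
and the canonical model maps homomorphically into every model. So satisfiability means that `canon`
is a model, and a `Must` query over a satisfiable knowledge base is evaluated in `canon`. Beyond its
first level a tree depends on the terminologies only, so its shape is fixed by finitely many
definable properties of the root (`CCKB.GenBy`). Quantifiers over positions in trees disappear by
`Def.ofFinite`: a property determined by finitely many definable ones is definable. The second
concerns `May`. Since infinitely many individuals are inactive, the elements that witness a query
can be given names (`Interp.exists_rename`). The query then becomes a finite set of additional ABox
assertions, and `CCKB.may_iff` reduces it to satisfiability. The third concerns actions. Executing
one basic effect for a whole set of groundings has a closed description that does not depend on the
order. Therefore a formula about the result can be rewritten as a formula about the original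
knowledge base (`Def.wp`, `Def.wp_foldlM`, `Def.wp_action`).

Evaluation. Quantifiers range over all words, but words that occur neither in the data nor in the
formula differ from each other only by equality. A back-and-forth argument (`Match`, `eval_toStr`)
replaces them by a fixed number of fresh symbolic words appended to the input. A quantifier is then
a scan of the input string, and a fact holds iff its encoding is an infix of that string. The
resulting nested loops of fixed depth are a stack program (`Prog.check_run`) that is compiled to a
`TM2` machine by `Prog.computableInPolyTime`. -/

namespace CoreClosed

/-! ## Structured stack programs and their compilation to `TM2` machines -/

/-- Structured programs over a family of stacks: `case k f` pops the stack `k` and branches on the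
result, `loop k f` pops the stack `k` and runs `f` until `k` is empty. -/
inductive Prog {K : Type} (Γ : K → Type) : Type
  | skip
  | push (k : K) (a : Γ k)
  | seq (p q : Prog Γ)
  | case (k : K) (f : Option (Γ k) → Prog Γ)
  | loop (k : K) (f : Γ k → Prog Γ)

namespace Prog

open Function Turing StateTransition

variable {K : Type} {Γ : K → Type}

/-- The labels of the compiled program. -/
def Lab : Prog Γ → Type
  | skip => Unit
  | push _ _ => Unit
  | seq p q => Lab p ⊕ Lab q
  | case _ f => Option (Σ o, Lab (f o))
  | loop _ f => Option (Σ a, Lab (f a))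

theorem finite_lab [∀ k, Finite (Γ k)] : ∀ p : Prog Γ, Finite (Lab p)
  | skip => inferInstanceAs (Finite Unit)
  | push _ _ => inferInstanceAs (Finite Unit)
  | seq p q =>
    have := finite_lab p
    have := finite_lab q
    inferInstanceAs (Finite (Lab p ⊕ Lab q))
  | case _ f =>
    have := fun o => finite_lab (f o)
    inferInstanceAs (Finite (Option (Σ o, Lab (f o))))
  | loop _ f =>
    have := fun o => finite_lab (f o)
    inferInstanceAs (Finite (Option (Σ a, Lab (f a))))

/-- The label at which the compiled program starts. -/
def entry : (p : Prog Γ) → Lab p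
  | skip => ()
  | push _ _ => ()
  | seq p _ => Sum.inl (entry p)
  | case _ _ => none
  | loop _ _ => none

variable [DecidableEq K]

/-- The compiled program, with its labels embedded into `Λ` and continuing at the label `exit`. -/
def code {Λ : Type} : (p : Prog Γ) → (Lab p → Λ) → Λ → Lab p → TM2.Stmt Γ Λ (∀ k, Option (Γ k))
  | skip, _, exit, _ => .goto fun _ => exit
  | push k a, _, exit, _ => .push k (fun _ => a) (.goto fun _ => exit)
  | seq p q, emb, _, Sum.inl l => code p (emb ∘ Sum.inl) (emb (Sum.inr (entry q))) l
  | seq _ q, emb, exit, Sum.inr l => code q (emb ∘ Sum.inr) exit l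
  | case k f, emb, _, none =>
    .pop k (fun v o => update v k o) (.goto fun v => emb (some ⟨v k, entry (f (v k))⟩))
  | case _ f, emb, exit, some ⟨o, l⟩ => code (f o) (fun l => emb (some ⟨o, l⟩)) exit l
  | loop k f, emb, exit, none =>
    .pop k (fun v o => update v k o)
      (.goto fun v => (v k).elim exit fun a => emb (some ⟨a, entry (f a)⟩))
  | loop _ f, emb, _, some ⟨a, l⟩ => code (f a) (fun l => emb (some ⟨a, l⟩)) (emb none) l

/-- `Run p s t s'`: the program `p` transforms the stacks `s` into `s'` in at most `t` steps. -/
inductive Run : Prog Γ → (∀ k, List (Γ k)) → ℕ → (∀ k, List (Γ k)) → Prop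
  | skip (s) : Run skip s 1 s
  | push (k a s) : Run (push k a) s 1 (update s k (a :: s k))
  | seq {p q s s' s'' t t'} : Run p s t s' → Run q s' t' s'' → Run (seq p q) s (t + t') s''
  | case {k f s s' t} : Run (f (s k).head?) (update s k (s k).tail) t s' →
      Run (case k f) s (t + 1) s'
  | loop_nil {k f s} : s k = [] → Run (loop k f) s 1 s
  | loop_cons {k f s s' s'' t t' a l} : s k = a :: l → Run (f a) (update s k l) t s' →
      Run (loop k f) s' t' s'' → Run (loop k f) s (t + 1 + t') s''
  | mono {p s s' t t'} : Run p s t s' → t ≤ t' → Run p s t' s'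

theorem evals_trans {σ : Type} {f : σ → Option σ} {a b : σ} {c : Option σ} {m n : ℕ}
    (h₁ : Nonempty (EvalsToInTime f a (some b) m)) (h₂ : Nonempty (EvalsToInTime f b c n)) :
    Nonempty (EvalsToInTime f a c (m + n)) := by
  obtain ⟨h₁⟩ := h₁
  obtain ⟨h₂⟩ := h₂
  rw [add_comm]
  exact ⟨EvalsToInTime.trans f m n a b c h₁ h₂⟩

theorem evals_one {σ : Type} {f : σ → Option σ} {a : σ} {b : Option σ} (h : f a = b) :
    Nonempty (EvalsToInTime f a b 1) :=
  ⟨⟨1, by simpa [flip] using h⟩, le_rfl⟩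

/-- Induction on the run. `emb` and `exit` are arbitrary so that the statement applies to a
subprogram placed inside a larger one. The registers `v` may be arbitrary because every branch reads
only the register that the preceding pop has just written. -/
theorem Run.evals {p : Prog Γ} {s s' : ∀ k, List (Γ k)} {t : ℕ} (h : Run p s t s') {Λ : Type}
    (M : Λ → TM2.Stmt Γ Λ (∀ k, Option (Γ k))) (emb : Lab p → Λ) (exit : Λ)
    (hM : ∀ l, M (emb l) = code p emb exit l) (v : ∀ k, Option (Γ k)) :
    ∃ v', Nonempty (EvalsToInTime (TM2.step M) ⟨some (emb (entry p)), v, s⟩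
      (some ⟨some exit, v', s'⟩) t) := by
  induction h generalizing exit v with
  | skip s => exact ⟨v, evals_one (by simp [hM, code])⟩
  | push k a s => exact ⟨v, evals_one (by simp [hM, code])⟩
  | @seq p q _ _ _ _ _ _ _ ih₁ ih₂ =>
    obtain ⟨v₁, h₁⟩ := ih₁ (emb ∘ Sum.inl) (emb (Sum.inr (entry q))) (fun l => hM (Sum.inl l)) v
    obtain ⟨v₂, h₂⟩ := ih₂ (emb ∘ Sum.inr) exit (fun l => hM (Sum.inr l)) v₁
    exact ⟨v₂, evals_trans h₁ h₂⟩
  | @case k f s s' t _ ih =>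
    obtain ⟨v₁, h₁⟩ := ih (fun l => emb (some ⟨_, l⟩)) exit (fun l => hM (some ⟨_, l⟩))
      (update v k (s k).head?)
    refine ⟨v₁, ?_⟩
    rw [add_comm]
    refine evals_trans (evals_one ?_) h₁
    rw [TM2.step, hM]
    simp only [code, entry, TM2.stepAux]
    rw [update_self]
  | @loop_nil k f s hs =>
    refine ⟨update v k none, evals_one ?_⟩
    rw [TM2.step, hM]
    have : update s k [] = s := by rw [← hs, update_eq_self]
    simp [code, entry, hs, this]
  | @loop_cons k f s s' s'' t t' a l hs _ _ ih₁ ih₂ =>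
    obtain ⟨v₁, h₁⟩ := ih₁ (fun l => emb (some ⟨a, l⟩)) (emb none) (fun l => hM (some ⟨a, l⟩))
      (update v k (some a))
    obtain ⟨v₂, h₂⟩ := ih₂ emb exit hM v₁
    refine ⟨v₂, evals_trans ?_ h₂⟩
    rw [add_comm]
    refine evals_trans (evals_one ?_) h₁
    rw [TM2.step, hM]
    simp [code, entry, hs]
  | mono _ ht ih =>
    obtain ⟨v₁, ⟨h₁⟩⟩ := ih emb exit hM v
    exact ⟨v₁, ⟨⟨h₁.toEvalsTo, h₁.steps_le_m.trans ht⟩⟩⟩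

/-- A program that writes the value of `f` to the stack `k₁` and clears all the other stacks within
polynomially many steps shows that `f` is computable in polynomial time. -/
theorem computableInPolyTime [Fintype K] [∀ k, Fintype (Γ k)] {α Γ₀ : Type} (enc : α → List Γ₀)
    (f : α → Bool) (p : Prog Γ) (k₀ k₁ : K) (e₀ : Γ k₀ ≃ Γ₀) (e₁ : Γ k₁ ≃ Bool)
    (time : Polynomial ℕ)
    (h : ∀ a, Run p (update (fun _ => []) k₀ ((enc a).map e₀.symm)) (time.eval (enc a).length)
      (update (fun _ => []) k₁ [e₁.symm (f a)])) :
    Nonempty (TM2ComputableInPolyTime enc Computability.encodeBool f) := by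
  have := finite_lab p
  have : Fintype (Option (Lab p)) := Fintype.ofFinite _
  -- The extra label `none` is the exit. It resets the registers before halting, since a halting
  -- configuration must carry the initial internal state; this costs the one additional step in
  -- `time + 1`.
  let M : Option (Lab p) → TM2.Stmt Γ (Option (Lab p)) (∀ k, Option (Γ k)) := fun o =>
    o.elim (.load (fun _ _ => none) .halt) (code p some none)
  let tm : FinTM2 :=
    { K := K, k₀ := k₀, k₁ := k₁, Γ := Γ, Λ := Option (Lab p), main := some (entry p),
      σ := ∀ k, Option (Γ k), initialState := fun _ => none, m := M }
  have hev : ∀ a, Nonempty (TM2OutputsInTime tm ((enc a).map e₀.symm)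
      (some ((Computability.encodeBool (f a)).map e₁.symm)) ((time + 1).eval (enc a).length)) := by
    intro a
    obtain ⟨v, hv⟩ := (h a).evals M some none (fun l => rfl) (fun _ => none)
    rw [Polynomial.eval_add, Polynomial.eval_one]
    have h₂ := evals_trans (c := some ⟨none, fun _ => none,
      update (fun _ => []) k₁ [e₁.symm (f a)]⟩) hv (evals_one rfl)
    convert h₂ using 1
    unfold TM2OutputsInTime
    congr 1
    · simp only [initList]
      congr 1
      funext (k : K)
      by_cases hk : k = k₀
      · cases hk; simp [tm]
      · simp [tm, hk]
    · simp only [haltList, Option.map_some]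
      congr 2
      funext (k : K)
      by_cases hk : k = k₁
      · cases hk; simp [tm, Computability.encodeBool]
      · simp [tm, hk]
  exact ⟨⟨⟨tm, e₀, e₁⟩, time + 1, fun a => (hev a).some⟩⟩

end Prog

end CoreClosed

namespace CoreClosed

open Function

/-! ## A machine model for first-order model checking on strings -/

/-- The working alphabet: the input symbols and one extra symbol, the letter of the words that do
not occur in the input. -/
abbrev Ltr : Type := Option Sym

/-- The working stacks: the input, three auxiliary stacks, and two stacks for each variable. -/
inductive Work (d : ℕ) : Type
  | hay
  | tmp
  | ndl
  | pre
  | var (i : Fin d)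
  | scan (i : Fin d)
  deriving DecidableEq, Fintype

/-- The stack names: input stack, output stack and working stacks. -/
inductive Stk (d : ℕ) : Type
  | inp
  | out
  | wk (w : Work d)
  deriving DecidableEq, Fintype

/-- The alphabets of the stacks. -/
abbrev Stk.Alph {d : ℕ} : Stk d → Type
  | .inp => Sym
  | .out => Bool
  | .wk _ => Ltr

/-- The contents of the stacks. -/
def conf {d : ℕ} (i : List Sym) (o : List Bool) (W : Work d → List Ltr) :
    ∀ k : Stk d, List k.Alph
  | .inp => i
  | .out => o
  | .wk w => W w

section

variable {d : ℕ} {i : List Sym} {o : List Bool} {W : Work d → List Ltr}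

@[simp] theorem conf_inp : conf i o W .inp = i := rfl
@[simp] theorem conf_out : conf i o W .out = o := rfl
@[simp] theorem conf_wk (w : Work d) : conf i o W (.wk w) = W w := rfl

@[simp] theorem update_conf_inp (x : List Sym) :
    update (conf i o W) .inp x = conf x o W := by
  funext k; cases k <;> simp [conf, update]

@[simp] theorem update_conf_out (x : List Bool) :
    update (conf i o W) .out x = conf i x W := by
  funext k; cases k <;> simp [conf, update]

@[simp] theorem update_conf_wk (w : Work d) (x : List Ltr) :
    update (conf i o W) (.wk w) x = conf i o (update W w x) := by
  funext k
  cases k with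
  | wk v =>
    by_cases h : v = w
    · subst h; simp
    · simp [h]
  | _ => simp [conf, update]

end

namespace Prog

variable {d : ℕ}

/-- Programs over the conf of the model checker. -/
abbrev P (d : ℕ) : Type := Prog (Stk.Alph (d := d))

/-- Empty the stack `a`. -/
def clear (a : Work d) : P d := .loop (.wk a) fun _ => .skip

/-- Move the stack `a` to the stack `b`, in reverse order. -/
def move (a b : Work d) : P d := .loop (.wk a) fun s => .push (.wk b) s

/-- Copy the stack `a` onto the stack `b`. -/
def copy (a b : Work d) : P d :=
  .seq (move a .tmp) (.loop (.wk .tmp) fun s => .seq (.push (.wk a) s) (.push (.wk b) s))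

theorem Run.of_eq {K : Type} {Γ : K → Type} [DecidableEq K] {p : Prog Γ}
    {s s₀ s' s₀' : ∀ k, List (Γ k)} {t t₀ : ℕ} (h : Run p s t s') (hs : s = s₀) (hs' : s' = s₀')
    (ht : t ≤ t₀) : Run p s₀ t₀ s₀' := by
  subst hs hs'
  exact h.mono ht

theorem clear_run (a : Work d) (i o) (W : Work d → List Ltr) :
    Run (clear a) (conf i o W) (2 * (W a).length + 1) (conf i o (update W a [])) := by
  generalize hl : W a = l
  induction l generalizing W with
  | nil =>
    have : update W a [] = W := by rw [← hl, update_eq_self]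
    rw [this]
    exact .loop_nil (by simpa using hl)
  | cons s l ih =>
    refine .mono (.loop_cons (a := s) (l := l) (by simpa using hl) (.skip _)
      ((ih (update W a l) (by simp)).of_eq (by simp) (by simp) le_rfl)) ?_
    simp; omega

theorem move_run {a b : Work d} (hab : a ≠ b) (i o) (W : Work d → List Ltr) :
    Run (move a b) (conf i o W) (2 * (W a).length + 1)
      (conf i o (update (update W a []) b ((W a).reverse ++ W b))) := by
  generalize hl : W a = l
  induction l generalizing W with
  | nil =>
    have : update W a [] = W := by rw [← hl, update_eq_self]
    simp only [this, List.reverse_nil, List.nil_append, update_eq_self]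
    exact .loop_nil (by simpa using hl)
  | cons s l ih =>
    refine .mono (.loop_cons (a := s) (l := l) (by simpa using hl) (.push _ _ _)
      ((ih (update (update W a l) b (s :: W b)) (by simp [hab])).of_eq (by simp [hab.symm]) ?_
        le_rfl)) (by simp; omega)
    congr 1
    funext k
    simp only [update_apply]
    split_ifs <;> simp_all

/-- The detour over `tmp` reverses the contents twice, so `a` is restored and `b` receives a copy in
the same order. -/
theorem copy_run {a b : Work d} (hab : a ≠ b) (ha : a ≠ .tmp) (hb : b ≠ .tmp) (i o)
    (W : Work d → List Ltr) (hW : W .tmp = []) :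
    Run (copy a b) (conf i o W) (5 * (W a).length + 2)
      (conf i o (update W b (W a ++ W b))) := by
  have key : ∀ (l : List Ltr) (W : Work d → List Ltr), W .tmp = l →
      Run (.loop (.wk .tmp) fun s => .seq (.push (.wk a) s) (.push (.wk b) s)) (conf i o W)
        (3 * l.length + 1) (conf i o (update (update (update W .tmp []) a (l.reverse ++ W a)) b
          (l.reverse ++ W b))) := by
    intro l
    induction l with
    | nil =>
      intro W hl
      have : update W .tmp [] = W := by rw [← hl, update_eq_self]
      simp only [this, List.reverse_nil, List.nil_append, update_eq_self]
      exact .loop_nil (by simpa using hl)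
    | cons s l ih =>
      intro W hl
      refine .mono (.loop_cons (a := s) (l := l) (by simpa using hl) (.seq (.push _ _ _)
        (.push _ _ _)) ((ih (update (update (update W .tmp l) a (s :: W a)) b (s :: W b))
          (by simp [ha.symm, hb.symm])).of_eq (by simp [ha, hab.symm, hb]) ?_ le_rfl))
        (by simp; omega)
      congr 1
      funext k
      simp only [update_apply]
      split_ifs <;> simp_all
  refine .mono (.seq (move_run ha i o W) ((key (W a).reverse
    (update (update W a []) .tmp ((W a).reverse ++ W .tmp)) (by simp [hW])).of_eq rfl ?_ le_rfl))
    (by simp; omega)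
  congr 1
  funext k
  simp only [update_apply]
  split_ifs <;> simp_all

/-- Push the string `t`, with the values of its variables, onto the stack `b`. -/
def build (b : Work d) : List (Ltr ⊕ Fin d) → P d
  | [] => .skip
  | .inl s :: t => .seq (.push (.wk b) s) (build b t)
  | .inr i :: t => .seq (copy (.var i) b) (build b t)

/-- The string `t`, with the values of its variables; these are stored in reverse order. -/
def inst (env : Fin d → List Ltr) (t : List (Ltr ⊕ Fin d)) : List Ltr :=
  t.flatMap (Sum.elim (fun s => [s]) fun i => (env i).reverse)

/-- Pushing letter by letter leaves the string reversed on the stack. As variables are stored in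
reverse order, copying a variable has the same effect as pushing its value. -/
theorem build_run {b : Work d} (hb : b = .ndl ∨ b = .pre) (t : List (Ltr ⊕ Fin d)) (L : ℕ) (i o)
    (W : Work d → List Ltr) (hW : W .tmp = []) (hL : ∀ j, (W (.var j)).length ≤ L) :
    Run (build b t) (conf i o W) (t.length * (5 * L + 2) + 1)
      (conf i o (update W b ((inst (fun j => W (.var j)) t).reverse ++ W b))) := by
  have hbt : b ≠ .tmp := by rcases hb with rfl | rfl <;> simp
  have hbv : ∀ j, b ≠ .var j := by rcases hb with rfl | rfl <;> simp
  induction t generalizing W with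
  | nil => simpa [inst, build] using Run.skip _
  | cons x t ih =>
    cases x with
    | inl s =>
      refine .mono (.seq (.push _ _ _) ((ih (update W b (s :: W b)) (by simp [hbt.symm, hW])
          (by simpa [(hbv _).symm] using hL)).of_eq (by simp) ?_ le_rfl)) ?_
      · simp [(hbv _).symm, inst]
      · simp only [List.length_cons]; nlinarith
    | inr j =>
      refine .mono (.seq (copy_run (hbv j).symm (by simp) hbt i o W hW)
        ((ih (update W b (W (.var j) ++ W b)) (by simp [hbt.symm, hW])
          (by simpa [(hbv _).symm] using hL)).of_eq (by simp) ?_ le_rfl)) ?_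
      · simp [(hbv _).symm, inst]
      · have := hL j
        simp only [List.length_cons]; nlinarith

theorem length_inst_le (env : Fin d → List Ltr) (L : ℕ) (hL : ∀ j, (env j).length ≤ L)
    (t : List (Ltr ⊕ Fin d)) : (inst env t).length ≤ t.length * (L + 1) := by
  induction t with
  | nil => simp [inst]
  | cons x t ih =>
    have : inst env (x :: t) = Sum.elim (fun s => [s]) (fun i => (env i).reverse) x ++ inst env t :=
      rfl
    rw [this, List.length_append, List.length_cons]
    cases x with
    | inl s => simp; nlinarith
    | inr j => have := hL j; simp; nlinarith

/-- Compare the top of the stack `pre` with `s`. -/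
def cmpStep (s : Ltr) : P d :=
  .case (.wk .pre) fun x =>
    if x = some s then .skip else .seq (.case .out fun _ => .skip) (.push .out false)

/-- Test whether the stack `ndl` is a prefix of the stack `pre`, and clear both. -/
def cmp : P d :=
  .seq (.push .out true) (.seq
    (.loop (.wk .ndl) cmpStep)
    (clear .pre))

theorem cmpStep_run (s : Ltr) (i o) (b : Bool) (W : Work d → List Ltr) :
    Run (cmpStep s) (conf i (b :: o) W) 4
      (conf i ((b && decide ((W .pre).head? = some s)) :: o) (update W .pre (W .pre).tail)) := by
  refine .case (t := 3) ?_
  by_cases hs : (W .pre).head? = some s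
  · simpa [hs] using Run.mono (.skip _) (by norm_num)
  · simp only [conf_wk, hs, if_false, decide_false, Bool.and_false, update_conf_wk]
    refine .seq (t := 2) (t' := 1) (.case (t := 1) (.skip _)) ?_
    simpa using Run.push (Γ := Stk.Alph (d := d)) .out false (conf i o (update W .pre (W .pre).tail))

theorem cmp_run (i o) (W : Work d → List Ltr) :
    Run cmp (conf i o W) (6 * (W .ndl).length + 2 * (W .pre).length + 3)
      (conf i (decide (W .ndl <+: W .pre) :: o) (update (update W .ndl []) .pre [])) := by
  -- The loop continues popping after a mismatch. What remains on `pre` is irrelevant except for its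
  -- length, which bounds the cost of the final clearing; hence the existential `m`.
  have key : ∀ (l : List Ltr) (W : Work d → List Ltr) (b : Bool), W .ndl = l →
      ∃ m, m.length ≤ (W .pre).length ∧
      Run (.loop (.wk .ndl) cmpStep) (conf i (b :: o) W) (6 * l.length + 1)
        (conf i ((b && decide (l <+: W .pre)) :: o) (update (update W .ndl []) .pre m)) := by
    intro l
    induction l with
    | nil =>
      intro W b hl
      have : update W .ndl [] = W := by rw [← hl, update_eq_self]
      refine ⟨W .pre, le_rfl, ?_⟩
      simp only [this, update_eq_self]
      simpa using Run.loop_nil (by simpa using hl)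
    | cons s l ih =>
      intro W b hl
      have ht : ∀ m : List Ltr,
          update (update (update (update W .ndl l) .pre (W .pre).tail) .ndl []) .pre m
            = update (update W .ndl []) .pre m := by
        intro m
        funext k
        cases k <;> simp [update]
      obtain ⟨m, hm, hr⟩ := ih (update (update W .ndl l) .pre (W .pre).tail)
        (b && decide ((W .pre).head? = some s)) (by simp)
      refine ⟨m, hm.trans (by simp), ?_⟩
      refine Run.mono (.loop_cons (a := s) (l := l) (by simpa using hl)
        ((cmpStep_run s i o b (update W .ndl l)).of_eq (by simp) rfl le_rfl)
        (hr.of_eq (by simp) ?_ le_rfl)) (by simp; omega)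
      rw [ht]
      congr 2
      rw [Bool.and_assoc, ← Bool.decide_and]
      congr 2
      cases h : W .pre with
      | nil => simp
      | cons a x => simp [eq_comm]
  obtain ⟨m, hm, hr⟩ := key (W .ndl) W true rfl
  have hc := clear_run .pre i (decide (W .ndl <+: W .pre) :: o)
    (update (update W .ndl []) .pre m)
  have hp := Run.push (Γ := Stk.Alph (d := d)) .out true (conf i o W)
  simp only [update_conf_out, conf_out, update_self, update_idem, Bool.true_and] at hc hr hp
  exact .mono (.seq hp (.seq hr hc)) (by omega)

end Prog

end CoreClosed

/-! ### String formulas and the model checking program -/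

namespace CoreClosed

open Function

/-- How a quantifier scans the input: which symbols it stores, after which symbols the stored string
is a value of the variable, and whether the stored string is cleared afterwards. -/
structure Scanner : Type where
  stores : Ltr → Bool
  yields : Ltr → Bool
  clears : Bool

/-- The values that the scanner finds in a string, when `acc` is stored already. -/
def Scanner.values (κ : Scanner) : List Ltr → List Ltr → List (List Ltr)
  | _, [] => []
  | acc, s :: l =>
    let acc' := if κ.stores s then s :: acc else acc
    if κ.yields s then acc' :: κ.values (if κ.clears then [] else acc') l else κ.values acc' l

/-- First-order formulas over strings, with suffix comparisons as atoms. -/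
inductive StrFml (d : ℕ) : Type
  | suf (t₁ t₂ : List (Ltr ⊕ Fin d))
  | neg (φ : StrFml d)
  | and (φ₁ φ₂ : StrFml d)
  | ex (κ : Scanner) (i : Fin d) (φ : StrFml d)

namespace StrFml

variable {d : ℕ}

/-- The truth value of a formula in the string `H`. The values of the variables are stored in
reverse order. -/
def eval (H : List Ltr) : (Fin d → List Ltr) → StrFml d → Bool
  | env, suf t₁ t₂ => decide ((Prog.inst env t₁).reverse <+: (Prog.inst env t₂).reverse)
  | env, neg φ => !φ.eval H env
  | env, and φ₁ φ₂ => φ₁.eval H env && φ₂.eval H env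
  | env, ex κ i φ => (κ.values [] H).any fun x => φ.eval H (update env i x)

/-- The variables are quantified in increasing order, starting with `n`. -/
def Leveled : ℕ → StrFml d → Prop
  | _, suf _ _ => True
  | n, neg φ => φ.Leveled n
  | n, and φ₁ φ₂ => φ₁.Leveled n ∧ φ₂.Leveled n
  | n, ex _ i φ => i.val = n ∧ φ.Leveled (n + 1)

end StrFml

namespace Prog

variable {d : ℕ}

/-- Replace the two topmost truth values by the value of `f`. -/
def binop (f : Bool → Bool → Bool) : P d :=
  .case .out fun x => .case .out fun y => .push .out (f (y == some true) (x == some true))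

theorem binop_run (f : Bool → Bool → Bool) (a b : Bool) (i o) (W : Work d → List Ltr) :
    Run (binop f) (conf i (a :: b :: o) W) 3 (conf i (f b a :: o) W) := by
  refine .case (t := 2) (.case (t := 1) ?_)
  have h := Run.push (Γ := Stk.Alph (d := d)) .out (f b a) (conf i o W)
  simpa using h

/-- One step of the scan of the input for the variable `i`, with the body `p`. -/
def scanStep (κ : Scanner) (i : Fin d) (p : P d) (s : Ltr) : P d :=
  .seq (if κ.stores s then .push (.wk (.var i)) s else .skip)
    (if κ.yields s then
      .seq p (.seq (binop (· || ·)) (if κ.clears then clear (.var i) else .skip))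
    else .skip)

/-- The model checking program. -/
def check : StrFml d → P d
  | .suf t₁ t₂ => .seq (build .ndl t₁) (.seq (build .pre t₂) cmp)
  | .neg φ => .seq (check φ) (.case .out fun x => .push .out (x != some true))
  | .and φ₁ φ₂ => .seq (check φ₁) (.seq (check φ₂) (binop (· && ·)))
  | .ex κ i φ => .seq (.push .out false) (.seq (copy .hay (.scan i))
      (.seq (.loop (.wk (.scan i)) (scanStep κ i (check φ))) (clear (.var i))))

/-- The working stacks are ready for the evaluation of a formula with quantifiers from level `n` on,
on the input `H`. -/
structure Ready (n : ℕ) (H : List Ltr) (W : Work d → List Ltr) : Prop where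
  hay : W .hay = H
  tmp : W .tmp = []
  ndl : W .ndl = []
  pre : W .pre = []
  free : ∀ j : Fin d, n ≤ j.val → W (.var j) = [] ∧ W (.scan j) = []
  length_le : ∀ j, (W (.var j)).length ≤ H.length

/-- The body `p` is assumed to push the truth value `v x` and to leave the working stacks unchanged,
so the top of the output stack accumulates the disjunction over all scanned values. The invariant
`hl` keeps each stored value no longer than the input, which makes the time bound `t` of the body
valid in every round. -/
theorem scan_run (κ : Scanner) (i : Fin d) (p : P d) (H : List Ltr) (v : List Ltr → Bool) (t : ℕ)
    (inp) (W : Work d → List Ltr)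
    (hp : ∀ x l o, x.length ≤ H.length →
      Run p (conf inp o (update (update W (.var i) x) (.scan i) l)) t
        (conf inp (v x :: o) (update (update W (.var i) x) (.scan i) l)))
    (l acc : List Ltr) (o : List Bool) (b : Bool) (hl : acc.length + l.length ≤ H.length) :
    ∃ acc', acc'.length ≤ H.length ∧
      Run (.loop (.wk (.scan i)) (scanStep κ i p))
        (conf inp (b :: o) (update (update W (.var i) acc) (.scan i) l))
        (l.length * (t + 2 * H.length + 6) + 1)
        (conf inp ((b || (κ.values acc l).any v) :: o)
          (update (update W (.var i) acc') (.scan i) [])) := by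
  induction l generalizing acc b with
  | nil =>
    refine ⟨acc, by simpa using hl, ?_⟩
    simpa [Scanner.values] using Run.loop_nil (by simp)
  | cons s l ih =>
    have comm : ∀ x y : List Ltr, update (update (update W (.var i) x) (.scan i) l) (.var i) y
        = update (update W (.var i) y) (.scan i) l := by
      intro x y
      rw [update_comm (by simp), update_idem]
    set acc₁ : List Ltr := if κ.stores s then s :: acc else acc with hacc₁
    set acc₂ : List Ltr := if κ.yields s then (if κ.clears then [] else acc₁) else acc₁ with hacc₂
    have h₁ : acc₁.length + l.length ≤ H.length := by
      simp only [List.length_cons] at hl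
      rw [hacc₁]
      split_ifs <;> (try simp only [List.length_cons]) <;> omega
    have h₂ : acc₂.length + l.length ≤ H.length := by
      rw [hacc₂]
      split_ifs <;> (try simp only [List.length_nil]) <;> omega
    obtain ⟨acc', hacc', hr⟩ := ih acc₂ (b || (κ.yields s && v acc₁)) h₂
    refine ⟨acc', hacc', .mono (.loop_cons (a := s) (l := l) (by simp)
      (t := 1 + (t + 2 * H.length + 4)) (.seq (t := 1)
      (s' := conf inp (b :: o) (update (update W (.var i) acc₁) (.scan i) l)) ?_ ?_)
      (hr.of_eq rfl ?_ le_rfl)) (by simp only [List.length_cons]; linarith)⟩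
    · rw [hacc₁]
      split_ifs
      · refine (Run.push _ _ _).of_eq rfl ?_ le_rfl
        simp [comm]
      · simpa using Run.skip _
    · rw [hacc₂]
      by_cases hy : κ.yields s
      · simp only [hy, if_true, Bool.true_and]
        refine .mono (.seq (hp acc₁ l _ (by omega)) (.seq (binop_run _ _ _ _ _ _)
          (t' := 2 * acc₁.length + 1) ?_)) (by omega)
        by_cases hc : κ.clears
        · simp only [hc, if_true]
          refine (clear_run _ _ _ _).of_eq rfl ?_ (by simp)
          simp [comm]
        · simpa [hc] using Run.mono (.skip _) (by omega)
      · simpa [hy] using Run.mono (.skip _) (by omega)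
    · congr 2
      rw [Scanner.values]
      simp only [← hacc₁, hacc₂]
      by_cases hy : κ.yields s <;> simp [hy, Bool.or_assoc]

/-- Each quantifier runs its body at most once per input symbol, on stacks no longer than the input,
so the bound is multiplied by a linear factor and lower-order terms are added. The polynomial
depends on the formula only. `Leveled` guarantees that a quantifier finds its own two stacks empty.
-/
theorem check_run (φ : StrFml d) : ∃ T : Polynomial ℕ, ∀ (n : ℕ) (H : List Ltr)
    (W : Work d → List Ltr) (i o), φ.Leveled n → Ready n H W →
    Run (check φ) (conf i o W) (T.eval H.length)
      (conf i (φ.eval H (fun j => W (.var j)) :: o) W) := by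
  induction φ with
  | suf t₁ t₂ =>
    refine ⟨(t₁.length + t₂.length) * (5 * .X + 2) + 2 +
      (6 * (t₁.length * (.X + 1)) + 2 * (t₂.length * (.X + 1)) + 3), ?_⟩
    intro n H W i o _ hW
    have e₁ := length_inst_le _ _ hW.length_le t₁
    have e₂ := length_inst_le _ _ hW.length_le t₂
    refine .mono (.seq (build_run (.inl rfl) t₁ H.length i o W hW.tmp hW.length_le)
      (.seq (build_run (.inr rfl) t₂ H.length i o _ (by simp [hW.tmp])
        (by simpa using hW.length_le)) ((cmp_run _ _ _).of_eq rfl ?_ ?_)))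
      (t := _ + (_ + (6 * (t₁.length * (H.length + 1)) + 2 * (t₂.length * (H.length + 1)) + 3))) ?_
    · simp only [hW.ndl, StrFml.eval]
      congr 1
      · simp [hW.pre]
      · funext k
        simp only [update_apply]
        split_ifs <;> simp_all [hW.ndl, hW.pre]
    · simp [hW.ndl, hW.pre]
      omega
    · simp
      ring_nf
      omega
  | neg φ ih =>
    obtain ⟨T, hT⟩ := ih
    refine ⟨T + 2, fun n H W i o hφ hW => ?_⟩
    refine .mono (.seq (hT n H W i o hφ hW) (t' := 2) (.case (t := 1)
      ((Run.push _ _ _).of_eq rfl ?_ le_rfl))) (by simp)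
    simp only [StrFml.eval, conf_out, update_conf_out, List.tail_cons, List.head?_cons]
    cases φ.eval H (fun j => W (.var j)) <;> rfl
  | and φ₁ φ₂ ih₁ ih₂ =>
    obtain ⟨T₁, hT₁⟩ := ih₁
    obtain ⟨T₂, hT₂⟩ := ih₂
    refine ⟨T₁ + T₂ + 3, fun n H W i o hφ hW => ?_⟩
    exact .mono (.seq (hT₁ n H W i o hφ.1 hW) (.seq (hT₂ n H W i _ hφ.2 hW)
      (binop_run _ _ _ _ _ _))) (by simp; omega)
  | ex κ j φ ih =>
    obtain ⟨T, hT⟩ := ih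
    refine ⟨1 + (5 * .X + 2 + (.X * (T + 2 * .X + 6) + 1 + (2 * .X + 1))), ?_⟩
    intro n H W i o hφ hW
    have hj := hW.free j hφ.1.ge
    have hscan := scan_run κ j (check φ) H
      (fun x => φ.eval H (update (fun j => W (.var j)) j x)) (T.eval H.length) i W ?_ H [] o false
      (by simp)
    · obtain ⟨acc, hacc, hr⟩ := hscan
      refine .mono (.seq (.push _ _ _) (.seq ((copy_run (by simp) (by simp) (by simp) i (false :: o)
        W hW.tmp).of_eq (by simp) rfl le_rfl) (.seq (hr.of_eq ?_ rfl le_rfl)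
        ((clear_run _ _ _ _).of_eq rfl ?_ (t₀ := 2 * H.length + 1) ?_)))) ?_
      · congr 1
        funext k
        simp only [update_apply]
        split_ifs <;> simp_all [hW.hay]
      · simp only [StrFml.eval, Bool.false_or]
        congr 1
        funext k
        simp only [update_apply]
        split_ifs <;> simp_all
      · simp [hacc]
      · simp [hW.hay]
    · intro x l o hx
      refine (hT (n + 1) H _ i o hφ.2 ⟨by simp [hW.hay], by simp [hW.tmp], by simp [hW.ndl],
        by simp [hW.pre], ?_, ?_⟩).of_eq rfl ?_ le_rfl
      · intro j' hj'
        have hne : j' ≠ j := by rintro rfl; have := hφ.1; omega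
        simpa [hne] using hW.free j' (by omega)
      · intro j'
        by_cases h : j' = j
        · subst h; simpa using hx
        · simpa [h] using hW.length_le j'
      · congr 3
        funext j'
        simp only [update_apply]
        split_ifs <;> simp_all

end Prog

end CoreClosed

/-! ### Polynomial time for fixed string formulas -/

namespace CoreClosed

open Function

theorem finite_sym : Finite Sym := by
  let f : Sym → Bool × Fin 9 := fun s => match s with
    | .bit b => (b, 0)
    | .done => (true, 1)
    | .openInd => (true, 2)
    | .modelInd => (true, 3)
    | .abox => (true, 4)
    | .mbox => (true, 5)
    | .concept => (true, 6)
    | .role => (true, 7)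
    | .opn => (true, 8)
    | .core => (false, 8)
  refine Finite.of_injective f ?_
  intro a b
  cases a <;> cases b <;> simp [f]

/-- Model checking of a fixed formula in the encoded data, extended by a fixed string, is possible in
polynomial time. -/
theorem StrFml.decidableInPolyTime {α : Type} (enc : α → List Sym) {d : ℕ} (φ : StrFml d)
    (hφ : φ.Leveled 0) (extra : List Ltr) :
    DecidableInPolyTime enc
      fun a => φ.eval ((enc a).map some ++ extra) (fun _ => []) = true := by
  refine ⟨fun a => φ.eval ((enc a).map some ++ extra) (fun _ => []), fun _ => Iff.rfl, ?_⟩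
  have := finite_sym
  have : Fintype Sym := Fintype.ofFinite _
  have : ∀ k : Stk d, Fintype k.Alph := by
    intro k
    cases k <;> unfold Stk.Alph <;> infer_instance
  obtain ⟨T, hT⟩ := Prog.check_run φ
  -- The string `extra` is written reversed and restored by a move to `hay`. The input is then
  -- placed in front of it by way of `tmp`, again with two reversals.
  let p : Prog.P d := .seq (Prog.build .ndl (extra.map .inl)) (.seq (Prog.move .ndl .hay)
    (.seq (.loop .inp fun s => .push (.wk .tmp) (some s))
      (.seq (Prog.move .tmp .hay) (.seq (Prog.check φ) (Prog.clear .hay)))))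
  refine Prog.computableInPolyTime enc _ p .inp .out (Equiv.refl _) (Equiv.refl _)
    (extra.length * 2 + 1 + (2 * extra.length + 1 + (2 * .X + 1 + (2 * .X + 1 +
      (T.comp (.X + extra.length) + (2 * (.X + extra.length) + 1)))))) ?_
  intro a
  set W₀ : Work d → List Ltr := fun _ => [] with hW₀
  set H : List Ltr := (enc a).map some ++ extra with hH
  have hinp : ∀ (l : List Sym) (W : Work d → List Ltr),
      Prog.Run (.loop .inp fun s => .push (.wk .tmp) (some s)) (conf l [] W) (2 * l.length + 1)
        (conf [] [] (update W .tmp ((l.map some).reverse ++ W .tmp))) := by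
    intro l
    induction l with
    | nil => intro W; simpa using Prog.Run.loop_nil (by simp)
    | cons s l ih =>
      intro W
      refine .mono (.loop_cons (a := s) (l := l) (by simp) (.push _ _ _)
        ((ih (update W .tmp (some s :: W .tmp))).of_eq (by simp) ?_ le_rfl)) (by simp; omega)
      simp
  have hinst : Prog.inst (fun j : Fin d => W₀ (.var j)) (extra.map .inl) = extra := by
    simp [Prog.inst, List.flatMap_map]
  have hb := Prog.build_run (b := .ndl) (.inl rfl) (extra.map .inl) 0 (enc a) [] W₀ rfl
    (fun _ => le_rfl)
  rw [hinst] at hb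
  have hm := Prog.move_run (a := .ndl) (b := .hay) (by simp) (enc a) []
    (update W₀ .ndl extra.reverse)
  have hi := hinp (enc a) (update W₀ .hay extra)
  have hm' := Prog.move_run (a := .tmp) (b := .hay) (by simp) [] []
    (update (update W₀ .hay extra) .tmp ((enc a).map some).reverse)
  have hc := hT 0 H (update W₀ .hay H) [] [] hφ ⟨by simp, by simp [hW₀], by simp [hW₀],
    by simp [hW₀], by simp [hW₀], by simp [hW₀]⟩
  have hl := Prog.clear_run .hay [] [φ.eval H fun _ => []] (update W₀ .hay H)
  have upd : ∀ (w : Work d) (x : List Ltr), update (update W₀ w x) w [] = W₀ := by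
    intro w x
    simp [hW₀]
  refine Prog.Run.of_eq (.seq (hb.of_eq rfl ?_ le_rfl) (.seq (hm.of_eq rfl ?_ le_rfl)
    (.seq (hi.of_eq rfl ?_ le_rfl) (.seq (hm'.of_eq rfl ?_ le_rfl) (.seq (hc.of_eq rfl ?_ le_rfl)
      hl))))) ?_ ?_ ?_
  · simp [hW₀]
  · simp [hW₀]
  · simp [hW₀]
  · congr 1
    funext k
    simp only [update_apply]
    split_ifs <;> simp_all
  · simp [hW₀]
  · funext k; cases k <;> simp [conf, update, hW₀]
  · rw [upd]
    funext k; cases k <;> simp [conf, update, hW₀]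
  · simp [hH]

end CoreClosed

namespace CoreClosed

open Function

/-! ## First-order logic over knowledge bases -/

/-- The facts of the data, with predicate names as further arguments. -/
inductive Fact (τ : Type) : Type
  | openInd (t : τ)
  | modelInd (t : τ)
  | aboxConcept (m : Mode) (A t : τ)
  | aboxRole (m : Mode) (R t₁ t₂ : τ)
  | mboxConcept (i : τ) (m : Mode) (A t : τ)
  | mboxRole (i : τ) (m : Mode) (R t₁ t₂ : τ)

namespace Fact

/-- Replace the arguments of a fact. -/
def map {τ τ' : Type} (g : τ → τ') : Fact τ → Fact τ'
  | openInd t => openInd (g t)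
  | modelInd t => modelInd (g t)
  | aboxConcept m A t => aboxConcept m (g A) (g t)
  | aboxRole m R t₁ t₂ => aboxRole m (g R) (g t₁) (g t₂)
  | mboxConcept i m A t => mboxConcept (g i) m (g A) (g t)
  | mboxRole i m R t₁ t₂ => mboxRole (g i) m (g R) (g t₁) (g t₂)

/-- The arguments of a fact. -/
def args {τ : Type} : Fact τ → List τ
  | openInd t => [t]
  | modelInd t => [t]
  | aboxConcept _ A t => [A, t]
  | aboxRole _ R t₁ t₂ => [R, t₁, t₂]
  | mboxConcept i _ A t => [i, A, t]
  | mboxRole i _ R t₁ t₂ => [i, R, t₁, t₂]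

/-- The fact holds in the knowledge base. -/
def HoldsIn (K : CCKB) : Fact Word → Prop
  | openInd a => a ∈ K.openInd
  | modelInd a => a ∈ K.modelInd
  | aboxConcept m A a => Atom.concept ⟨m, A⟩ a ∈ K.abox
  | aboxRole m R a b => Atom.role ⟨m, R⟩ a b ∈ K.abox
  | mboxConcept i m A a => (i, Atom.concept ⟨m, A⟩ a) ∈ K.mbox
  | mboxRole i m R a b => (i, Atom.role ⟨m, R⟩ a b) ∈ K.mbox

/-- The encoding of a fact, as a list of symbols and arguments. -/
def pieces {τ : Type} : Fact τ → List (Sym ⊕ τ)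
  | openInd t => [.inl .openInd, .inr t]
  | modelInd t => [.inl .modelInd, .inr t]
  | aboxConcept m A t => [.inl .abox, .inl .concept, .inl m.encode, .inr A, .inr t]
  | aboxRole m R t₁ t₂ => [.inl .abox, .inl .role, .inl m.encode, .inr R, .inr t₁, .inr t₂]
  | mboxConcept i m A t => [.inl .mbox, .inr i, .inl .concept, .inl m.encode, .inr A, .inr t]
  | mboxRole i m R t₁ t₂ =>
    [.inl .mbox, .inr i, .inl .role, .inl m.encode, .inr R, .inr t₁, .inr t₂]

theorem pieces_map {τ τ' : Type} (g : τ → τ') (f : Fact τ) :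
    (f.map g).pieces = f.pieces.map (Sum.map id g) := by
  cases f <;> rfl

theorem args_map {τ τ' : Type} (g : τ → τ') (f : Fact τ) : (f.map g).args = f.args.map g := by
  cases f <;> rfl

theorem inr_mem_pieces {τ : Type} {f : Fact τ} {t : τ} : .inr t ∈ f.pieces ↔ t ∈ f.args := by
  cases f <;> simp [pieces, args]

theorem map_map {τ τ' τ'' : Type} (g : τ → τ') (h : τ' → τ'') (f : Fact τ) :
    (f.map g).map h = f.map (h ∘ g) := by
  cases f <;> rfl

theorem map_congr {τ τ' : Type} {g h : τ → τ'} {f : Fact τ} (H : ∀ t ∈ f.args, g t = h t) :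
    f.map g = f.map h := by
  cases f <;> simp_all [map, args]

/-- An assertion of the ABox as a fact. -/
def ofABox : Assertion → Fact Word
  | .concept A a => .aboxConcept A.mode A.word a
  | .role R a b => .aboxRole R.mode R.word a b

/-- An assertion of a block of the core as a fact. -/
def ofMBox (i : Word) : Assertion → Fact Word
  | .concept A a => .mboxConcept i A.mode A.word a
  | .role R a b => .mboxRole i R.mode R.word a b

end Fact

/-- The list of all facts of the data. -/
def Data.facts (D : Data) : List (Fact Word) :=
  D.openInd.map .openInd ++ D.modelInd.map .modelInd ++ D.abox.map .ofABox ++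
    D.mbox.map fun p => .ofMBox p.1 p.2

theorem Data.mem_facts (T S : Finset Constraint) (D : Data) (f : Fact Word) :
    f ∈ D.facts ↔ f.HoldsIn (D.kb T S) := by
  cases f <;> simp [Data.facts, Fact.HoldsIn, Data.kb]
  case aboxConcept m A a =>
    constructor
    · rintro (⟨⟨⟨m, A⟩, a⟩ | ⟨⟨m, A⟩, a, b⟩, h, h'⟩ | ⟨i, ⟨⟨m, A⟩, a⟩ | ⟨⟨m, A⟩, a, b⟩, h, h'⟩) <;>
        simp_all [Fact.ofABox, Fact.ofMBox]
    · exact fun h => .inl ⟨_, h, rfl⟩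
  case aboxRole m A a b =>
    constructor
    · rintro (⟨⟨⟨m, A⟩, a⟩ | ⟨⟨m, A⟩, a, b⟩, h, h'⟩ | ⟨i, ⟨⟨m, A⟩, a⟩ | ⟨⟨m, A⟩, a, b⟩, h, h'⟩) <;>
        simp_all [Fact.ofABox, Fact.ofMBox]
    · exact fun h => .inl ⟨_, h, rfl⟩
  case mboxConcept m A a =>
    constructor
    · rintro (⟨⟨⟨m, A⟩, a⟩ | ⟨⟨m, A⟩, a, b⟩, h, h'⟩ | ⟨i, ⟨⟨m, A⟩, a⟩ | ⟨⟨m, A⟩, a, b⟩, h, h'⟩) <;>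
        simp_all [Fact.ofABox, Fact.ofMBox]
    · exact fun h => .inr ⟨_, _, h, rfl⟩
  case mboxRole m A a b =>
    constructor
    · rintro (⟨⟨⟨m, A⟩, a⟩ | ⟨⟨m, A⟩, a, b⟩, h, h'⟩ | ⟨i, ⟨⟨m, A⟩, a⟩ | ⟨⟨m, A⟩, a, b⟩, h, h'⟩) <;>
        simp_all [Fact.ofABox, Fact.ofMBox]
    · exact fun h => .inr ⟨_, _, h, rfl⟩
  all_goals
    rintro (⟨⟨⟨m, A⟩, a⟩ | ⟨⟨m, A⟩, a, b⟩, h, h'⟩ | ⟨i, ⟨⟨m, A⟩, a⟩ | ⟨⟨m, A⟩, a, b⟩, h, h'⟩) <;>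
      simp [Fact.ofABox, Fact.ofMBox] at h'

/-- First-order formulas over the facts of a knowledge base. -/
inductive Fml : Type → Type 1
  | eq {V : Type} (s t : Tm V) : Fml V
  | fact {V : Type} (f : Fact (Tm V)) : Fml V
  | neg {V : Type} (φ : Fml V) : Fml V
  | and {V : Type} (φ₁ φ₂ : Fml V) : Fml V
  | ex {V : Type} (φ : Fml (Option V)) : Fml V

/-- Extend an assignment by the value `a` for the variable `none`. -/
def extend {V D : Type} (ρ : V → D) (a : D) : Option V → D := fun o => o.elim a ρ

/-- Truth of a first-order formula in a knowledge base; the quantifiers range over all words. -/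
def Fml.Sem (K : CCKB) : {V : Type} → (V → Word) → Fml V → Prop
  | _, ρ, .eq s t => s.eval id ρ = t.eval id ρ
  | _, ρ, .fact f => (f.map (Tm.eval id ρ)).HoldsIn K
  | _, ρ, .neg φ => ¬ φ.Sem K ρ
  | _, ρ, .and φ₁ φ₂ => φ₁.Sem K ρ ∧ φ₂.Sem K ρ
  | _, ρ, .ex φ => ∃ a, φ.Sem K (extend ρ a)

/-! ## Strings encoding facts -/

/-- The letters of (symbolic) words. -/
def isLetter : Ltr → Bool
  | none => true
  | some (.bit _) => true
  | _ => false

/-- The symbols that start a fact. -/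
def isMarker : Ltr → Bool
  | some .openInd => true
  | some .modelInd => true
  | some .abox => true
  | some .mbox => true
  | _ => false

/-- A word as a string of letters. -/
def letters (w : Word) : List Ltr := w.map fun b => some (.bit b)

theorem letters_injective : Injective letters := by
  apply List.map_injective_iff.2
  intro a b
  simp

/-- The string of a list of symbols and of (symbolic) words. -/
def spell (l : List (Sym ⊕ List Ltr)) : List Ltr :=
  l.flatMap (Sum.elim (fun s => [some s]) fun g => g ++ [some .done])

theorem spell_cons (x) (l : List (Sym ⊕ List Ltr)) : spell (x :: l) = spell [x] ++ spell l := by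
  simp [spell]

theorem spell_append (l₁ l₂ : List (Sym ⊕ List Ltr)) :
    spell (l₁ ++ l₂) = spell l₁ ++ spell l₂ := by
  simp [spell]

/-- The symbols and words of the list can be read off unambiguously. -/
def Readable (l : List (Sym ⊕ List Ltr)) : Prop :=
  ∀ x ∈ l, Sum.elim (fun s => isLetter (some s) = false ∧ s ≠ .done)
    (fun g => ∀ a ∈ g, isLetter a = true) x

/-- The end marker is not a letter, so its first occurrence fixes where the word ends. -/
theorem append_done_prefix {g g' : List Ltr} (hg : ∀ a ∈ g, isLetter a = true)
    (hg' : ∀ a ∈ g', isLetter a = true) {r r' : List Ltr}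
    (h : g ++ some .done :: r <+: g' ++ some .done :: r') : g = g' ∧ r <+: r' := by
  induction g generalizing g' with
  | nil =>
    cases g' with
    | nil => exact ⟨rfl, by simpa using h⟩
    | cons a g' =>
      have h' : some .done = a := by simpa using (List.cons_prefix_cons.1 h).1
      have := hg' a (by simp)
      simp [← h', isLetter] at this
  | cons b g ih =>
    cases g' with
    | nil =>
      have h' : b = some .done := by simpa using (List.cons_prefix_cons.1 h).1
      have := hg b (by simp)
      simp [h', isLetter] at this
    | cons a g' =>
      simp only [List.cons_append, List.cons_prefix_cons] at h
      obtain ⟨rfl, h⟩ := h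
      obtain ⟨rfl, hr⟩ := ih (fun a ha => hg a (by simp [ha]))
        (fun a ha => hg' a (by simp [ha])) h
      exact ⟨rfl, hr⟩

theorem exists_spell_inr {g : List Ltr} (hg : ∀ a ∈ g, isLetter a = true) (r : List Ltr) :
    ∃ a r', g ++ some .done :: r = a :: r' ∧ (isLetter a = true ∨ a = some .done) := by
  cases g with
  | nil => exact ⟨_, _, rfl, .inr rfl⟩
  | cons a g => exact ⟨_, _, rfl, .inl (hg a (by simp))⟩

/-- Unique readability: the spelling of a word starts with a letter or the end marker, and a
readable symbol is neither. The first letter therefore tells the two kinds of pieces apart. -/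
theorem Readable.prefix_of_spell {l l' : List (Sym ⊕ List Ltr)} (hl : Readable l)
    (hl' : Readable l') (h : spell l <+: spell l') : l <+: l' := by
  induction l generalizing l' with
  | nil => simp
  | cons x l ih =>
    have hx := hl x (by simp)
    have hxl : Readable l := fun y hy => hl y (by simp [hy])
    cases l' with
    | nil => cases x <;> simp [spell] at h
    | cons x' l' =>
      have hx' := hl' x' (by simp)
      have hxl' : Readable l' := fun y hy => hl' y (by simp [hy])
      rw [spell_cons x, spell_cons x'] at h
      cases x with
      | inl s =>
        cases x' with
        | inl s' =>
          simp only [spell, List.flatMap_singleton, Sum.elim_inl, List.singleton_append,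
            List.cons_prefix_cons, Option.some.injEq] at h
          obtain ⟨rfl, h⟩ := h
          exact List.cons_prefix_cons.2 ⟨rfl, ih hxl hxl' h⟩
        | inr g' =>
          obtain ⟨a, r, hr, ha⟩ := exists_spell_inr hx' (spell l')
          simp only [spell, List.flatMap_singleton, Sum.elim_inl, Sum.elim_inr,
            List.singleton_append, List.append_assoc] at h hr
          rw [hr, List.cons_prefix_cons] at h
          simp only [Sum.elim_inl] at hx
          rw [← h.1, hx.1] at ha
          simp [hx.2] at ha
      | inr g =>
        cases x' with
        | inl s' =>
          obtain ⟨a, r, hr, ha⟩ := exists_spell_inr hx (spell l)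
          simp only [spell, List.flatMap_singleton, Sum.elim_inl, Sum.elim_inr,
            List.singleton_append, List.append_assoc] at h hr
          rw [hr, List.cons_prefix_cons] at h
          simp only [Sum.elim_inl] at hx'
          rw [h.1, hx'.1] at ha
          simp [hx'.2] at ha
        | inr g' =>
          simp only [spell, List.flatMap_singleton, Sum.elim_inr, List.append_assoc,
            List.singleton_append] at h
          obtain ⟨rfl, hr⟩ := append_done_prefix hx hx' h
          exact List.cons_prefix_cons.2 ⟨rfl, ih hxl hxl' hr⟩

/-- A string without markers is found at the start of a record only. -/
theorem infix_records {a : Ltr} {s : List Ltr} (ha : isMarker a = true)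
    (hs : ∀ x ∈ s, isMarker x = false) (recs : List (Ltr × List Ltr))
    (hr : ∀ r ∈ recs, isMarker r.1 = true ∧ ∀ x ∈ r.2, isMarker x = false) :
    a :: s <:+: recs.flatMap (fun r => r.1 :: r.2) ↔ ∃ r ∈ recs, a = r.1 ∧ s <+: r.2 := by
  -- An occurrence starts with the marker `a`, so it cannot start inside the marker-free body of a
  -- record.
  have strip : ∀ b R : List Ltr, (∀ x ∈ b, isMarker x = false) →
      a :: s <:+: b ++ R → a :: s <:+: R := by
    intro b R hb h
    induction b with
    | nil => exact h
    | cons x b ih =>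
      rw [List.cons_append, List.infix_cons_iff] at h
      rcases h with h | h
      · rw [List.cons_prefix_cons] at h
        have := hb x (by simp)
        rw [← h.1, ha] at this
        simp at this
      · exact ih (fun x hx => hb x (by simp [hx])) h
  -- Having no marker, `s` cannot reach into the next record.
  have cut : ∀ (s b R : List Ltr), (∀ x ∈ s, isMarker x = false) →
      (∀ x r, R = x :: r → isMarker x = true) → s <+: b ++ R → s <+: b := by
    intro s b R hs hR h
    induction b generalizing s with
    | nil =>
      cases s with
      | nil => simp
      | cons x s =>
        obtain ⟨r, hr⟩ := h
        have h₁ := hR x (s ++ r) (by simpa using hr.symm)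
        rw [hs x (by simp)] at h₁
        simp at h₁
    | cons y b ih =>
      cases s with
      | nil => simp
      | cons x s =>
        rw [List.cons_append, List.cons_prefix_cons] at h
        rw [List.cons_prefix_cons]
        exact ⟨h.1, ih s (fun x hx => hs x (by simp [hx])) h.2⟩
  induction recs with
  | nil => simp
  | cons r recs ih =>
    have ih := ih fun r hr' => hr r (by simp [hr'])
    simp only [List.flatMap_cons, List.mem_cons, exists_eq_or_imp, ← ih, List.cons_append]
    rw [List.infix_cons_iff, List.cons_prefix_cons]
    constructor
    · rintro (⟨h₁, h₂⟩ | h)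
      · refine .inl ⟨h₁, cut s r.2 _ hs ?_ h₂⟩
        intro x t hx
        cases recs with
        | nil => simp at hx
        | cons r' recs =>
          simp only [List.flatMap_cons, List.cons_append, List.cons.injEq] at hx
          rw [← hx.1]
          exact (hr r' (by simp)).1
      · exact .inr (strip r.2 _ (hr r (by simp)).2 h)
    · rintro (⟨h₁, h₂⟩ | h)
      · exact .inl ⟨h₁, h₂.trans (List.prefix_append _ _)⟩
      · exact .inr (h.trans (List.suffix_append _ _).isInfix)

end CoreClosed

/-! ### Translation of first-order formulas into string formulas -/

namespace CoreClosed

open Function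

/-- The scanner that finds the words of the input. -/
def Scanner.words : Scanner := ⟨isLetter, (· == some .done), true⟩

/-- The scanner that finds the prefixes of the input. -/
def Scanner.prefixes : Scanner := ⟨fun _ => true, fun _ => true, false⟩

theorem Scanner.mem_values_prefixes (l acc x : List Ltr) :
    x ∈ Scanner.prefixes.values acc l ↔ ∃ p, p ≠ [] ∧ p <+: l ∧ x = p.reverse ++ acc := by
  induction l generalizing acc with
  | nil => simp [Scanner.values]
  | cons s l ih =>
    simp only [Scanner.values, Scanner.prefixes, if_true, List.mem_cons] at ih ⊢
    simp only [Bool.false_eq_true, if_false]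
    rw [ih]
    constructor
    · rintro (rfl | ⟨p, _, hp, rfl⟩)
      · exact ⟨[s], by simp, by simp, by simp⟩
      · exact ⟨s :: p, by simp, by simpa using hp, by simp⟩
    · rintro ⟨p, hp, hpl, rfl⟩
      cases p with
      | nil => simp at hp
      | cons a p =>
        obtain ⟨rfl, hpl'⟩ := List.cons_prefix_cons.1 hpl
        cases p with
        | nil => simp
        | cons b p => exact .inr ⟨b :: p, by simp, hpl', by simp⟩

/-- Non-letters are not stored and only the end marker yields, after which the store is cleared. So
exactly the words are produced, reversed because letters are pushed. -/
theorem Scanner.mem_values_words {l : List (Sym ⊕ List Ltr)} (hl : Readable l) (x : List Ltr) :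
    x ∈ Scanner.words.values [] (spell l) ↔ ∃ g, .inr g ∈ l ∧ x = g.reverse := by
  have aux : ∀ (g acc r : List Ltr), (∀ a ∈ g, isLetter a = true) →
      Scanner.words.values acc (g ++ some .done :: r)
        = (g.reverse ++ acc) :: Scanner.words.values [] r := by
    intro g
    induction g with
    | nil => intro acc r _; simp [Scanner.values, Scanner.words, isLetter]
    | cons a g ih =>
      intro acc r hg
      have ha := hg a (by simp)
      have hne : a ≠ some .done := by rintro rfl; simp [isLetter] at ha
      have := ih (a :: acc) r fun a ha => hg a (by simp [ha])
      simp only [Scanner.words] at this ⊢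
      simp [Scanner.values, ha, hne, this]
  induction l with
  | nil => simp [spell, Scanner.values]
  | cons y l ih =>
    have ih := ih fun y hy => hl y (by simp [hy])
    have hy := hl y (by simp)
    rw [spell_cons]
    cases y with
    | inl s =>
      have : Scanner.words.values [] (spell [.inl s] ++ spell l)
          = Scanner.words.values [] (spell l) := by
        simp [spell, Scanner.words, Scanner.values, hy.1, hy.2]
      simp [this, ih]
    | inr g =>
      have : Scanner.words.values [] (spell [.inr g] ++ spell l)
          = g.reverse :: Scanner.words.values [] (spell l) := by
        have := aux g [] (spell l) hy
        simpa [spell] using this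
      simp [this, ih, or_and_right, exists_or]

section Translation

variable {d : ℕ}

/-- A term as a string with variables. -/
def Tm.str {V : Type} (lv : V → Fin d) : Tm V → List (Ltr ⊕ Fin d)
  | .const c => (letters c).map .inl
  | .var v => [.inr (lv v)]

/-- A symbol or a term as a string with variables. -/
def pieceStr {V : Type} (lv : V → Fin d) : Sym ⊕ Tm V → List (Ltr ⊕ Fin d)
  | .inl s => [.inl (some s)]
  | .inr t => t.str lv ++ [.inl (some .done)]

theorem inst_append (env : Fin d → List Ltr) (s t : List (Ltr ⊕ Fin d)) :
    Prog.inst env (s ++ t) = Prog.inst env s ++ Prog.inst env t := by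
  simp [Prog.inst]

theorem inst_str {V : Type} {lv : V → Fin d} {env : Fin d → List Ltr} {g : V → List Ltr}
    (h : ∀ v, env (lv v) = (g v).reverse) (t : Tm V) :
    Prog.inst env (t.str lv) = t.eval letters g := by
  cases t with
  | const c => simp [Tm.str, Tm.eval, Prog.inst, List.flatMap_map]
  | var v => simp [Tm.str, Tm.eval, Prog.inst, h]

theorem inst_pieces {V : Type} {lv : V → Fin d} {env : Fin d → List Ltr} {g : V → List Ltr}
    (h : ∀ v, env (lv v) = (g v).reverse) (l : List (Sym ⊕ Tm V)) :
    Prog.inst env (l.flatMap (pieceStr lv)) = spell (l.map (Sum.map id (Tm.eval letters g))) := by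
  induction l with
  | nil => rfl
  | cons x l ih =>
    rw [List.flatMap_cons, inst_append, List.map_cons, spell_cons, ih]
    congr 1
    cases x with
    | inl s => simp [pieceStr, Prog.inst, spell]
    | inr t =>
      rw [pieceStr, inst_append, inst_str h]
      simp [spell, Prog.inst]

variable [NeZero d]

/-- The translation of a first-order formula, with variables from `n` on for its quantifiers. -/
def Fml.toStr : {V : Type} → (V → Fin d) → ℕ → Fml V → StrFml d
  -- The leading `abox` turns the suffix test into an equality test: it is not a letter and cannot
  -- occur inside a word.
  | _, lv, _, .eq s t => .suf (.inl (some .abox) :: s.str lv) (.inl (some .abox) :: t.str lv)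
  -- An infix is a suffix of a prefix, so one scan over the prefixes searches the input for the
  -- encoding of the fact.
  | _, lv, n, .fact f => .ex .prefixes (Fin.ofNat d n)
      (.suf (f.pieces.flatMap (pieceStr lv)) [.inr (Fin.ofNat d n)])
  | _, lv, n, .neg φ => .neg (φ.toStr lv n)
  | _, lv, n, .and φ₁ φ₂ => .and (φ₁.toStr lv n) (φ₂.toStr lv n)
  | _, lv, n, .ex φ => .ex .words (Fin.ofNat d n)
      (φ.toStr (fun o => o.elim (Fin.ofNat d n) lv) (n + 1))

/-- The number of nested quantifiers in the translation. -/
def Fml.depth : {V : Type} → Fml V → ℕ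
  | _, .eq _ _ => 0
  | _, .fact _ => 1
  | _, .neg φ => φ.depth
  | _, .and φ₁ φ₂ => max φ₁.depth φ₂.depth
  | _, .ex φ => φ.depth + 1

theorem Fml.leveled_toStr {V : Type} (φ : Fml V) (lv : V → Fin d) (n : ℕ) (h : n + φ.depth ≤ d) :
    (φ.toStr lv n).Leveled n := by
  induction φ generalizing n with
  | eq s t => trivial
  | fact f => exact ⟨Nat.mod_eq_of_lt (by simp [depth] at h; omega), trivial⟩
  | neg φ ih => exact ih lv n h
  | and φ₁ φ₂ ih₁ ih₂ =>
    simp only [depth] at h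
    exact ⟨ih₁ lv n (by omega), ih₂ lv n (by omega)⟩
  | ex φ ih =>
    simp only [depth] at h
    exact ⟨Nat.mod_eq_of_lt (by omega), ih _ _ (by omega)⟩

end Translation

/-- The constants of a formula. -/
def Tm.consts {V : Type} : Tm V → List Word
  | .const c => [c]
  | .var _ => []

/-- The constants of a formula. -/
def Fml.consts : {V : Type} → Fml V → List Word
  | _, .eq s t => s.consts ++ t.consts
  | _, .fact f => f.args.flatMap Tm.consts
  | _, .neg φ => φ.consts
  | _, .and φ₁ φ₂ => φ₁.consts ++ φ₂.consts
  | _, .ex φ => φ.consts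

/-! ## The input of the model checker -/

/-- A symbolic word that does not occur in any input. -/
def fresh (j : ℕ) : List Ltr := List.replicate (j + 1) none

theorem fresh_ne_letters (j : ℕ) (w : Word) : fresh j ≠ letters w := by
  cases w <;> simp [fresh, letters, List.replicate_succ]

theorem fresh_injective : Injective fresh := by
  intro i j h
  simpa [fresh] using congrArg List.length h

/-- The facts of the data, and a record of further symbolic words. -/
def Data.records (D : Data) (cs : List (List Ltr)) : List (List (Sym ⊕ List Ltr)) :=
  D.facts.map (fun f => (f.map letters).pieces) ++ [.inl .abox :: cs.map .inr]

/-- The symbolic words in the input. -/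
def Data.symWords (D : Data) (cs : List (List Ltr)) : Set (List Ltr) :=
  {g | .inr g ∈ (D.records cs).flatten}

/-- The input of the model checker. -/
def Data.hay (D : Data) (cs : List (List Ltr)) : List Ltr := spell (D.records cs).flatten

theorem letter_of_mem_letters {w : Word} {a : Ltr} (h : a ∈ letters w) : isLetter a = true := by
  simp only [letters, List.mem_map] at h
  obtain ⟨b, _, rfl⟩ := h
  rfl

theorem Fact.readable_pieces {f : Fact (List Ltr)}
    (h : ∀ g ∈ f.args, ∀ a ∈ g, isLetter a = true) : Readable f.pieces := by
  rintro (s | g) hx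
  · have hm : ∀ m : Mode, isLetter (some m.encode) = false ∧ m.encode ≠ .done := by
      rintro (_ | _) <;> simp [Mode.encode, isLetter]
    cases f <;> simp [pieces] at hx <;> rcases hx with rfl | rfl | rfl <;>
      first | exact hm _ | exact ⟨rfl, by simp⟩
  · exact h g (inr_mem_pieces.1 hx)

theorem Data.readable_records (D : Data) {cs : List (List Ltr)}
    (hcs : ∀ g ∈ cs, ∀ a ∈ g, isLetter a = true) : ∀ l ∈ D.records cs, Readable l := by
  intro l hl
  simp only [records, List.mem_append, List.mem_map, List.mem_singleton] at hl
  rcases hl with ⟨f, _, rfl⟩ | rfl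
  · refine Fact.readable_pieces fun g hg a ha => ?_
    rw [Fact.args_map] at hg
    obtain ⟨w, _, rfl⟩ := List.mem_map.1 hg
    exact letter_of_mem_letters ha
  · intro x hx
    simp only [List.mem_cons, List.mem_map] at hx
    rcases hx with rfl | ⟨g, hg, rfl⟩
    · simp [isLetter]
    · exact hcs g hg

theorem Fact.exists_pieces {τ : Type} (f : Fact τ) : ∃ m l, f.pieces = .inl m :: l ∧
    isMarker (some m) = true ∧ ∀ s, .inl s ∈ l → isMarker (some s) = false := by
  have hm : ∀ m : Mode, isMarker (some m.encode) = false := by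
    rintro (_ | _) <;> simp [Mode.encode, isMarker]
  cases f <;> refine ⟨_, _, rfl, rfl, fun s hs => ?_⟩ <;> simp at hs <;>
    rcases hs with rfl | rfl | rfl <;> first | exact hm _ | rfl

/-- The symbols at fixed places determine the kind of the fact, and with it the length of the list,
so no encoding is a proper prefix of another. -/
theorem Fact.eq_of_pieces_prefix {τ : Type} {f f' : Fact τ} (h : f.pieces <+: f'.pieces) :
    f = f' := by
  have hm : ∀ m m' : Mode, m.encode = m'.encode → m = m' := by
    rintro (_ | _) (_ | _) <;> simp [Mode.encode]
  cases f <;> cases f' <;> simp [pieces] at h ⊢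
  case aboxConcept.aboxConcept => exact ⟨hm _ _ h.1, h.2⟩
  case aboxRole.aboxRole => exact ⟨hm _ _ h.1, h.2⟩
  case mboxConcept.mboxConcept => exact ⟨h.1, hm _ _ h.2.1, h.2.2⟩
  case mboxRole.mboxRole => exact ⟨h.1, hm _ _ h.2.1, h.2.2⟩
  all_goals exact h

theorem not_marker_of_letter {a : Ltr} (h : isLetter a = true) : isMarker a = false := by
  cases a with
  | none => rfl
  | some s => cases s <;> simp_all [isLetter, isMarker]

theorem Readable.not_marker {l : List (Sym ⊕ List Ltr)} (hl : Readable l)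
    (h : ∀ s, .inl s ∈ l → isMarker (some s) = false) : ∀ x ∈ spell l, isMarker x = false := by
  intro x hx
  simp only [spell, List.mem_flatMap] at hx
  obtain ⟨y, hy, hxy⟩ := hx
  cases y with
  | inl s =>
    simp only [Sum.elim_inl, List.mem_singleton] at hxy
    subst hxy
    exact h s hy
  | inr g =>
    simp only [Sum.elim_inr, List.mem_append, List.mem_singleton] at hxy
    rcases hxy with hxy | rfl
    · exact not_marker_of_letter (hl _ hy x hxy)
    · rfl

/-- Each record starts with its only marker, so `infix_records` locates the encoding at the start of
a record; unique readability then identifies the fact. -/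
theorem Data.spell_infix_hay (D : Data) {cs : List (List Ltr)}
    (hcs : ∀ g ∈ cs, ∀ a ∈ g, isLetter a = true) {f : Fact (List Ltr)}
    (hf : ∀ g ∈ f.args, ∀ a ∈ g, isLetter a = true) :
    spell f.pieces <:+: D.hay cs ↔ ∃ f₀ ∈ D.facts, f = f₀.map letters := by
  have split : ∀ l ∈ D.records cs, ∃ m b, l = .inl m :: b ∧ isMarker (some m) = true ∧
      ∀ s, .inl s ∈ b → isMarker (some s) = false := by
    intro l hl
    simp only [records, List.mem_append, List.mem_map, List.mem_singleton] at hl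
    rcases hl with ⟨f, _, rfl⟩ | rfl
    · exact (f.map letters).exists_pieces
    · exact ⟨_, _, rfl, rfl, by simp⟩
  have hread := D.readable_records hcs
  have hhay : D.hay cs = ((D.records cs).map fun l =>
      ((spell l).headD none, (spell l).tail)).flatMap fun r => r.1 :: r.2 := by
    rw [hay, List.flatMap_map]
    have : ∀ L : List (List (Sym ⊕ List Ltr)), (∀ l ∈ L, ∃ m b, l = .inl m :: b) →
        spell L.flatten = L.flatMap fun l => (spell l).headD none :: (spell l).tail := by
      intro L hL
      induction L with
      | nil => rfl
      | cons l L ih =>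
        obtain ⟨m, b, rfl⟩ := hL l (by simp)
        rw [List.flatten_cons, spell_append, ih fun l hl => hL l (by simp [hl]), List.flatMap_cons]
        simp [spell]
    exact this _ fun l hl => let ⟨m, b, h, _⟩ := split l hl; ⟨m, b, h⟩
  obtain ⟨m, b, hb, hm, hs⟩ := f.exists_pieces
  have hfr : Readable (.inl m :: b) := hb ▸ Fact.readable_pieces hf
  have hbr : Readable b := fun x hx => hfr x (by simp [hx])
  have hsp : spell f.pieces = some m :: spell b := by simp [hb, spell]
  rw [hhay, hsp, infix_records hm (hbr.not_marker hs)]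
  · simp only [List.mem_map, exists_exists_and_eq_and]
    constructor
    · rintro ⟨l, hl, h₁, h₂⟩
      obtain ⟨m', b', rfl, _⟩ := split l hl
      have hpre : f.pieces <+: .inl m' :: b' := by
        refine hb ▸ hfr.prefix_of_spell (hread _ hl) ?_
        rw [spell_cons, spell_cons (.inl m')]
        simp only [spell, Sum.elim_inl, List.flatMap_cons,
          List.singleton_append, List.headD_cons, List.tail_cons] at h₁ h₂ ⊢
        exact List.cons_prefix_cons.2 ⟨h₁, h₂⟩
      simp only [records, List.mem_append, List.mem_map, List.mem_singleton] at hl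
      rcases hl with ⟨f₀, hf₀, h⟩ | h
      · refine ⟨f₀, hf₀, ?_⟩
        rw [← h] at hpre
        exact Fact.eq_of_pieces_prefix hpre
      -- The record of additional words is no source of spurious facts: after `abox` comes a word or
      -- nothing, whereas an ABox fact continues with a symbol.
      · rw [h] at hpre
        exfalso
        clear * - hpre
        cases f <;> cases cs <;> simp [Fact.pieces] at hpre
    · rintro ⟨f₀, hf₀, rfl⟩
      refine ⟨_, by simp only [records, List.mem_append, List.mem_map]; exact .inl ⟨f₀, hf₀, rfl⟩, ?_⟩
      simp [hb, spell]
  · simp only [List.mem_map]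
    rintro _ ⟨l, hl, rfl⟩
    obtain ⟨m', b', rfl, hm', hs'⟩ := split l hl
    have hb' : Readable b' := fun x hx => hread _ hl x (by simp [hx])
    refine ⟨by simpa [spell] using hm', ?_⟩
    have := hb'.not_marker hs'
    simpa [spell] using this

end CoreClosed

/-! ### Back-and-forth between words and symbolic words -/

namespace CoreClosed

open Function

/-- The assignments `ρ` of words and `g` of symbolic words look the same, relative to a set of
symbolic words. -/
structure Match {V : Type} (C : Set (List Ltr)) (ρ : V → Word) (g : V → List Ltr) : Prop where
  mem : ∀ v, g v ∈ C
  word : ∀ v w, letters w ∈ C → (ρ v = w ↔ g v = letters w)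
  eq : ∀ u v, ρ u = ρ v ↔ g u = g v

namespace Match

variable {V : Type} {C : Set (List Ltr)} {ρ : V → Word} {g : V → List Ltr}

theorem eval_eq (h : Match C ρ g) {s t : Tm V} (hs : ∀ c ∈ s.consts, letters c ∈ C)
    (ht : ∀ c ∈ t.consts, letters c ∈ C) :
    s.eval id ρ = t.eval id ρ ↔ s.eval letters g = t.eval letters g := by
  cases s with
  | const a =>
    cases t with
    | const b => simpa [Tm.eval] using letters_injective.eq_iff.symm
    | var v =>
      have := h.word v a (hs a (by simp [Tm.consts]))
      simpa [Tm.eval, eq_comm] using this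
  | var u =>
    cases t with
    | const b => exact h.word u b (ht b (by simp [Tm.consts]))
    | var v => exact h.eq u v

theorem eval_word (h : Match C ρ g) {s : Tm V} (hs : ∀ c ∈ s.consts, letters c ∈ C) {w : Word}
    (hw : letters w ∈ C) : s.eval id ρ = w ↔ s.eval letters g = letters w := by
  cases s with
  | const a => simpa [Tm.eval] using letters_injective.eq_iff.symm
  | var u => exact h.word u w hw

theorem extend_word (h : Match C ρ g) {w : Word} (hw : letters w ∈ C) :
    Match C (extend ρ w) (extend g (letters w)) := by
  refine ⟨?_, ?_, ?_⟩
  · rintro (_ | v)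
    · exact hw
    · exact h.mem v
  · rintro (_ | v) w' hw'
    · simpa [extend] using letters_injective.eq_iff.symm
    · exact h.word v w' hw'
  · rintro (_ | u) (_ | v)
    · simp
    · have := h.word v w hw
      simpa [extend, eq_comm] using this
    · exact h.word u w hw
    · exact h.eq u v

theorem extend_var (h : Match C ρ g) (v : V) : Match C (extend ρ (ρ v)) (extend g (g v)) := by
  refine ⟨?_, ?_, ?_⟩
  · rintro (_ | u) <;> exact h.mem _
  · rintro (_ | u) w' hw' <;> exact h.word _ w' hw'
  · rintro (_ | u) (_ | u') <;> exact h.eq _ _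

theorem extend_new (h : Match C ρ g) {w : Word} {x : List Ltr} (hx : x ∈ C) (hw : letters w ∉ C)
    (hx' : ∀ w, x ≠ letters w) (hρ : ∀ v, ρ v ≠ w) (hg : ∀ v, g v ≠ x) :
    Match C (extend ρ w) (extend g x) := by
  refine ⟨?_, ?_, ?_⟩
  · rintro (_ | v)
    · exact hx
    · exact h.mem v
  · rintro (_ | v) w' hw'
    · refine iff_of_false ?_ (hx' w')
      rintro rfl
      exact hw hw'
    · exact h.word v w' hw'
  · rintro (_ | u) (_ | v)
    · simp
    · exact iff_of_false (hρ v).symm (hg v).symm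
    · exact iff_of_false (hρ u) (hg u)
    · exact h.eq u v

/-- The "forth" step. A word in `C`, or one that is already a value, is matched by itself or by the
corresponding variable. Any other word is matched by an unused fresh word, which exists by the
pigeonhole principle. -/
theorem exists_sym [Finite V] (h : Match C ρ g) {n : ℕ} (hn : Nat.card V < n)
    (hC : ∀ j < n, fresh j ∈ C) (w : Word) : ∃ x ∈ C, Match C (extend ρ w) (extend g x) := by
  by_cases hw : letters w ∈ C
  · exact ⟨_, hw, h.extend_word hw⟩
  by_cases hv : ∃ v, ρ v = w
  · obtain ⟨v, rfl⟩ := hv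
    exact ⟨_, h.mem v, h.extend_var v⟩
  · obtain ⟨j, hj⟩ : ∃ j : Fin n, ∀ v, g v ≠ fresh j := by
      by_contra hc
      push Not at hc
      choose f hf using hc
      have hinj : Injective f := by
        intro i j hij
        apply Fin.ext
        apply fresh_injective
        rw [← hf i, ← hf j, hij]
      have := Nat.card_le_card_of_injective f hinj
      simp at this
      omega
    exact ⟨_, hC j j.2, h.extend_new (hC j j.2) hw (fresh_ne_letters j)
      (fun v hv' => hv ⟨v, hv'⟩) hj⟩

/-- The "back" step. For a symbolic word that is neither an actual word nor already a value, any
word outside a finite set will do, as there are infinitely many words. -/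
theorem exists_word [Finite V] (h : Match C ρ g) (hC : C.Finite) {x : List Ltr} (hx : x ∈ C) :
    ∃ w, Match C (extend ρ w) (extend g x) := by
  by_cases hw : ∃ w, x = letters w
  · obtain ⟨w, rfl⟩ := hw
    exact ⟨w, h.extend_word hx⟩
  by_cases hv : ∃ v, g v = x
  · obtain ⟨v, rfl⟩ := hv
    exact ⟨_, h.extend_var v⟩
  · have hfin : (letters ⁻¹' C ∪ Set.range ρ).Finite :=
      (hC.preimage letters_injective.injOn).union (Set.finite_range ρ)
    obtain ⟨w, hw'⟩ := hfin.exists_notMem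
    simp only [Set.mem_union, Set.mem_preimage, Set.mem_range, not_or, not_exists] at hw'
    exact ⟨w, h.extend_new hx hw'.1 (fun w h => hw ⟨w, h⟩) hw'.2 fun v h => hv ⟨v, h⟩⟩

end Match

/-- Matching assignments agree on atoms, because all words in the data and all constants of the
formula lie in `D.symWords cs`. They can be extended in both directions, so a quantifier over all
words agrees with one over the words of the input. -/
theorem eval_toStr {d : ℕ} [NeZero d] (T S : Finset Constraint) (D : Data) {cs : List (List Ltr)}
    (hcs : ∀ g ∈ cs, ∀ a ∈ g, isLetter a = true) (hfresh : ∀ j < d, fresh j ∈ D.symWords cs)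
    {V : Type} (hVf : Finite V) (φ : Fml V) {ρ : V → Word} {g : V → List Ltr} {env : Fin d → List Ltr}
    {lv : V → Fin d} {n : ℕ} (hn : n + φ.depth ≤ d) (hV : Nat.card V = n) (hlv : ∀ v, (lv v).val < n)
    (hM : Match (D.symWords cs) ρ g) (henv : ∀ v, env (lv v) = (g v).reverse)
    (hφ : ∀ c ∈ φ.consts, letters c ∈ D.symWords cs) :
    (φ.toStr lv n).eval (D.hay cs) env = true ↔ φ.Sem (D.kb T S) ρ := by
  have hread : Readable (D.records cs).flatten := by
    intro x hx
    obtain ⟨l, hl, hx⟩ := List.mem_flatten.1 hx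
    exact D.readable_records hcs l hl x hx
  have hlet : ∀ x ∈ D.symWords cs, ∀ a ∈ x, isLetter a = true := fun x hx => hread _ hx
  induction φ generalizing n env with
  | eq s t =>
    simp only [Fml.consts, List.mem_append] at hφ
    simp only [Fml.toStr, StrFml.eval, Fml.Sem, decide_eq_true_eq, List.reverse_prefix]
    rw [hM.eval_eq (fun c hc => hφ c (.inl hc)) (fun c hc => hφ c (.inr hc))]
    have hcons : ∀ t : Tm _, Prog.inst env (.inl (some .abox) :: t.str lv)
        = some .abox :: t.eval letters g := by
      intro t
      rw [← inst_str henv t]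
      rfl
    rw [hcons, hcons, List.suffix_cons_iff]
    constructor
    · rintro (h | h)
      · simpa using h
      · have hmem : some Sym.abox ∈ t.eval letters g := h.subset (by simp)
        have : isLetter (some .abox) = true := by
          cases t with
          | const c => exact letter_of_mem_letters hmem
          | var v => exact hlet _ (hM.mem v) _ hmem
        simp [isLetter] at this
    · intro h
      exact .inl (by rw [h])
  | fact f =>
    simp only [Fml.depth] at hn
    have hne : ∀ v, lv v ≠ Fin.ofNat d n := by
      intro v hv
      have := hlv v
      rw [hv, Fin.val_ofNat, Nat.mod_eq_of_lt (by omega)] at this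
      omega
    have hinst : ∀ x, Prog.inst (update env (Fin.ofNat d n) x) (f.pieces.flatMap (pieceStr lv))
        = spell (f.map (Tm.eval letters g)).pieces := by
      intro x
      rw [Fact.pieces_map]
      refine inst_pieces (fun v => ?_) _
      rw [update_of_ne (hne v), henv]
    have hletf : ∀ x ∈ (f.map (Tm.eval letters g)).args, ∀ a ∈ x, isLetter a = true := by
      intro x hx a ha
      rw [Fact.args_map] at hx
      obtain ⟨t, _, rfl⟩ := List.mem_map.1 hx
      cases t with
      | const c => exact letter_of_mem_letters ha
      | var v => exact hlet _ (hM.mem v) _ ha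
    simp only [Fml.toStr, StrFml.eval, Fml.Sem, List.any_eq_true, decide_eq_true_eq, hinst,
      List.reverse_prefix, ← Data.mem_facts T S]
    have hvar : ∀ x, Prog.inst (update env (Fin.ofNat d n) x) [.inr (Fin.ofNat d n)]
        = x.reverse := by
      intro x
      simp [Prog.inst]
    simp only [hvar, Scanner.mem_values_prefixes]
    have h₁ : (∃ x, (∃ p, p ≠ [] ∧ p <+: D.hay cs ∧ x = p.reverse ++ []) ∧
        spell (f.map (Tm.eval letters g)).pieces <:+ x.reverse) ↔
        spell (f.map (Tm.eval letters g)).pieces <:+: D.hay cs := by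
      rw [List.infix_iff_suffix_prefix]
      constructor
      · rintro ⟨_, ⟨p, _, hp, rfl⟩, h⟩
        exact ⟨p, by simpa using h, hp⟩
      · rintro ⟨p, h, hp⟩
        refine ⟨_, ⟨p, ?_, hp, rfl⟩, by simpa using h⟩
        rintro rfl
        obtain ⟨m, l, hl, _⟩ := (f.map (Tm.eval letters g)).exists_pieces
        simp [hl, spell] at h
    rw [h₁, D.spell_infix_hay hcs hletf]
    have hargs : ∀ f₀ ∈ D.facts, ∀ w ∈ f₀.args, letters w ∈ D.symWords cs := by
      intro f₀ hf₀ w hw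
      refine List.mem_flatten.2 ⟨_, by simp only [Data.records, List.mem_append, List.mem_map];
                                       exact .inl ⟨f₀, hf₀, rfl⟩, ?_⟩
      rw [Fact.inr_mem_pieces, Fact.args_map]
      exact List.mem_map_of_mem hw
    have hmap : ∀ f₀ ∈ D.facts, (f.map (Tm.eval letters g) = f₀.map letters ↔
        f.map (Tm.eval id ρ) = f₀) := by
      intro f₀ hf₀
      have hw := hargs f₀ hf₀
      have hc : ∀ t ∈ f.args, ∀ c ∈ t.consts, letters c ∈ D.symWords cs :=
        fun t ht c hc => hφ c (List.mem_flatMap.2 ⟨t, ht, hc⟩)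
      have key : ∀ t ∈ f.args, ∀ w ∈ f₀.args,
          (t.eval letters g = letters w ↔ t.eval id ρ = w) :=
        fun t ht w hw' => (hM.eval_word (hc t ht) (hw w hw')).symm
      clear * - key
      cases f <;> cases f₀ <;> simp [Fact.map, Fact.args] at key ⊢ <;> simp [key]
    constructor
    · rintro ⟨f₀, hf₀, h⟩
      rwa [(hmap f₀ hf₀).1 h]
    · intro h
      exact ⟨_, h, (hmap _ h).2 rfl⟩
  | neg φ ih =>
    simp only [Fml.toStr, StrFml.eval, Fml.Sem, Bool.not_eq_true', ← Bool.not_eq_true]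
    exact not_congr (ih hVf hn hV hlv hM henv hφ)
  | and φ₁ φ₂ ih₁ ih₂ =>
    simp only [Fml.depth] at hn
    simp only [Fml.consts, List.mem_append] at hφ
    simp only [Fml.toStr, StrFml.eval, Fml.Sem, Bool.and_eq_true]
    exact and_congr (ih₁ hVf (by omega) hV hlv hM henv fun c hc => hφ c (.inl hc))
      (ih₂ hVf (by omega) hV hlv hM henv fun c hc => hφ c (.inr hc))
  | ex φ ih =>
    simp only [Fml.depth] at hn
    have hne : ∀ v, lv v ≠ Fin.ofNat d n := by
      intro v hv
      have := hlv v
      rw [hv, Fin.val_ofNat, Nat.mod_eq_of_lt (by omega)] at this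
      omega
    have hstep : ∀ {w : Word} {x : List Ltr},
        Match (D.symWords cs) (extend ρ w) (extend g x) →
        ((φ.toStr (fun o => o.elim (Fin.ofNat d n) lv) (n + 1)).eval (D.hay cs)
          (update env (Fin.ofNat d n) x.reverse) = true ↔ φ.Sem (D.kb T S) (extend ρ w)) := by
      intro w x hx
      refine ih inferInstance (by omega) (by simp [hV]) ?_ hx ?_ hφ
      · rintro (_ | v)
        · simp [Nat.mod_eq_of_lt (show n < d by omega)]
        · exact (hlv v).trans (by omega)
      · rintro (_ | v)
        · simp [extend]
        · simp only [Option.elim_some]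
          rw [update_of_ne (hne v), henv]
          rfl
    simp only [Fml.toStr, StrFml.eval, Fml.Sem, List.any_eq_true, Data.hay,
      Scanner.mem_values_words hread]
    constructor
    · rintro ⟨_, ⟨x, hx, rfl⟩, h⟩
      have hfin : (D.symWords cs).Finite := by
        refine ((List.finite_toSet (D.records cs).flatten).preimage
          Sum.inr_injective.injOn).subset fun x hx => hx
      obtain ⟨w, hw⟩ := hM.exists_word hfin hx
      exact ⟨w, (hstep hw).1 h⟩
    · rintro ⟨w, h⟩
      obtain ⟨x, hx, hw⟩ := hM.exists_sym (n := d) (by omega) hfresh w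
      exact ⟨_, ⟨x, hx, rfl⟩, (hstep hw).2 h⟩

theorem spell_pieces_ofABox (f : Assertion) :
    (Sym.abox :: f.encode).map some = spell ((Fact.ofABox f).map letters).pieces := by
  cases f <;> simp [Assertion.encode, Word.encode, spell, Fact.ofABox, Fact.map, Fact.pieces,
    letters, Function.comp_def]

theorem spell_pieces_ofMBox (i : Word) (f : Assertion) :
    (Sym.mbox :: (Word.encode i ++ f.encode)).map some
      = spell ((Fact.ofMBox i f).map letters).pieces := by
  cases f <;> simp [Assertion.encode, Word.encode, spell, Fact.ofMBox, Fact.map, Fact.pieces,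
    letters, Function.comp_def]

/-- Splits the input of the model checker into the genuine encoding and a string independent of the
data, which the machine can write by itself. -/
theorem Data.hay_eq (D : Data) (cs : List (List Ltr)) :
    D.hay cs = D.encode.map some ++ spell (.inl .abox :: cs.map .inr) := by
  have h₁ : ∀ L : List (List (Sym ⊕ List Ltr)), spell L.flatten = L.flatMap spell := by
    intro L
    induction L with
    | nil => rfl
    | cons l L ih => rw [List.flatten_cons, spell_append, ih, List.flatMap_cons]
  rw [hay, h₁, records, List.flatMap_append]
  congr 1
  · simp only [facts, encode, List.map_append, List.flatMap_append, List.map_flatMap,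
      List.flatMap_map, spell_pieces_ofABox, spell_pieces_ofMBox, List.map_map]
    simp [Fact.map, Fact.pieces, spell, Word.encode, letters, Function.comp_def]
  · simp

/-- First-order properties of the data can be decided in polynomial time. -/
theorem Fml.decidableInPolyTime (T S : Finset Constraint) (φ : Fml Empty) :
    DecidableInPolyTime (fun D : Input T S => D.1.encode)
      (fun D => φ.Sem (D.1.kb T S) Empty.elim) := by
  set d := φ.depth + 1
  -- The constants make atoms with constants comparable. The number `d = φ.depth + 1` exceeds the
  -- number of variables in scope at any quantifier, as the pigeonhole argument requires.
  set cs : List (List Ltr) := φ.consts.map letters ++ (List.range d).map fresh with hcs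
  have hlet : ∀ g ∈ cs, ∀ a ∈ g, isLetter a = true := by
    intro g hg a ha
    simp only [hcs, List.mem_append, List.mem_map] at hg
    rcases hg with ⟨w, _, rfl⟩ | ⟨j, _, rfl⟩
    · exact letter_of_mem_letters ha
    · rw [List.eq_of_mem_replicate ha]
      rfl
  obtain ⟨f, hf, hf'⟩ := StrFml.decidableInPolyTime (fun D : Input T S => D.1.encode)
    (φ.toStr (d := d) Empty.elim 0) (φ.leveled_toStr _ _ (by omega))
    (spell (.inl .abox :: cs.map .inr))
  refine ⟨f, fun D => ?_, hf'⟩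
  have hmem : ∀ g ∈ cs, g ∈ D.1.symWords cs := by
    intro g hg
    simp [Data.symWords, Data.records, hg]
  rw [hf]
  beta_reduce
  rw [← Data.hay_eq]
  refine eval_toStr T S D.1 hlet (fun j hj => hmem _ ?_) inferInstance φ
    (g := Empty.elim) (by omega) (by simp) (by simp) ⟨by simp, by simp, by simp⟩ (by simp) fun c hc => hmem _ ?_
  · simp only [hcs, List.mem_append, List.mem_map, List.mem_range]
    exact .inr ⟨j, hj, rfl⟩
  · simp only [hcs, List.mem_append, List.mem_map]
    exact .inl ⟨c, hc, rfl⟩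

end CoreClosed

namespace CoreClosed

open Function

/-! ## Definable properties of knowledge bases -/

/-- Replace the variables of a term. -/
def Tm.subst {U V : Type} (g : U → Tm V) : Tm U → Tm V
  | .const c => .const c
  | .var u => g u

theorem Tm.eval_subst {U V D : Type} (c : Word → D) (ρ : V → D) (g : U → Tm V) (t : Tm U) :
    (t.subst g).eval c ρ = t.eval c fun u => (g u).eval c ρ := by
  cases t <;> rfl

/-- Replace the variables of a formula. -/
def Fml.subst : {U V : Type} → (U → Tm V) → Fml U → Fml V
  | _, _, g, .eq s t => .eq (s.subst g) (t.subst g)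
  | _, _, g, .fact f => .fact (f.map (Tm.subst g))
  | _, _, g, .neg φ => .neg (φ.subst g)
  | _, _, g, .and φ₁ φ₂ => .and (φ₁.subst g) (φ₂.subst g)
  | _, _, g, .ex φ =>
    .ex (φ.subst fun o => o.elim (.var none) fun u => (g u).subst fun v => .var (some v))

theorem Fml.sem_subst (K : CCKB) {U V : Type} (φ : Fml U) (g : U → Tm V) (ρ : V → Word) :
    (φ.subst g).Sem K ρ ↔ φ.Sem K fun u => (g u).eval id ρ := by
  induction φ generalizing V with
  | eq s t => simp [subst, Sem, Tm.eval_subst]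
  | fact f => simp [subst, Sem, Fact.map_map, Function.comp_def, Tm.eval_subst]
  | neg φ ih => exact not_congr (ih g ρ)
  | and φ₁ φ₂ ih₁ ih₂ => exact and_congr (ih₁ g ρ) (ih₂ g ρ)
  | ex φ ih =>
    simp only [subst, Sem]
    refine exists_congr fun a => ?_
    rw [ih]
    apply iff_of_eq
    congr 1
    funext o
    cases o with
    | none => rfl
    | some u => simp [extend, Tm.eval_subst]; rfl

/-- The property `P` of knowledge bases in `𝒢` and of assignments is first-order definable. -/
def Def (𝒢 : CCKB → Prop) {V : Type} (P : CCKB → (V → Word) → Prop) : Prop :=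
  ∃ φ : Fml V, ∀ K, 𝒢 K → ∀ ρ, φ.Sem K ρ ↔ P K ρ

/-- The function is given by a term. -/
def IsTm {V : Type} (s : (V → Word) → Word) : Prop := ∃ t : Tm V, ∀ ρ, s ρ = t.eval id ρ

namespace IsTm

variable {U V : Type}

theorem var (v : V) : IsTm fun ρ => ρ v := ⟨.var v, fun _ => rfl⟩

theorem const (c : Word) : IsTm fun _ : V → Word => c := ⟨.const c, fun _ => rfl⟩

theorem subst {s : (U → Word) → Word} (hs : IsTm s) {g : U → (V → Word) → Word}
    (hg : ∀ u, IsTm (g u)) : IsTm fun ρ => s fun u => g u ρ := by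
  obtain ⟨t, ht⟩ := hs
  choose g' hg' using hg
  refine ⟨t.subst g', fun ρ => ?_⟩
  simp only [ht, hg', Tm.eval_subst]

theorem comp {s : (U → Word) → Word} (hs : IsTm s) (e : U → V) : IsTm fun ρ => s (ρ ∘ e) :=
  hs.subst fun u => var (e u)

theorem tm {t : Tm U} {g : U → (V → Word) → Word} (hg : ∀ u, IsTm (g u)) :
    IsTm fun ρ => t.eval id fun u => g u ρ :=
  subst ⟨t, fun _ => rfl⟩ hg

end IsTm

namespace Def

variable {𝒢 : CCKB → Prop} {U V : Type} {P Q : CCKB → (V → Word) → Prop}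

theorem congr (h : ∀ K, 𝒢 K → ∀ ρ, P K ρ ↔ Q K ρ) (hP : Def 𝒢 P) : Def 𝒢 Q :=
  let ⟨φ, hφ⟩ := hP
  ⟨φ, fun K hK ρ => (hφ K hK ρ).trans (h K hK ρ)⟩

theorem not (hP : Def 𝒢 P) : Def 𝒢 fun K ρ => ¬ P K ρ :=
  let ⟨φ, hφ⟩ := hP
  ⟨.neg φ, fun K hK ρ => not_congr (hφ K hK ρ)⟩

theorem and (hP : Def 𝒢 P) (hQ : Def 𝒢 Q) : Def 𝒢 fun K ρ => P K ρ ∧ Q K ρ :=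
  let ⟨φ, hφ⟩ := hP
  let ⟨ψ, hψ⟩ := hQ
  ⟨.and φ ψ, fun K hK ρ => and_congr (hφ K hK ρ) (hψ K hK ρ)⟩

theorem or (hP : Def 𝒢 P) (hQ : Def 𝒢 Q) : Def 𝒢 fun K ρ => P K ρ ∨ Q K ρ :=
  (hP.not.and hQ.not).not.congr fun _ _ _ => by tauto

theorem imp (hP : Def 𝒢 P) (hQ : Def 𝒢 Q) : Def 𝒢 fun K ρ => P K ρ → Q K ρ :=
  (hP.not.or hQ).congr fun _ _ _ => by tauto

theorem iff (hP : Def 𝒢 P) (hQ : Def 𝒢 Q) : Def 𝒢 fun K ρ => (P K ρ ↔ Q K ρ) :=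
  ((hP.imp hQ).and (hQ.imp hP)).congr fun _ _ _ => by tauto

theorem ex {P : CCKB → (V → Word) → Word → Prop}
    (h : Def 𝒢 fun K (ρ : Option V → Word) => P K (ρ ∘ some) (ρ none)) :
    Def 𝒢 fun K ρ => ∃ w, P K ρ w :=
  let ⟨φ, hφ⟩ := h
  ⟨.ex φ, fun K hK ρ => exists_congr fun a => hφ K hK (extend ρ a)⟩

theorem all {P : CCKB → (V → Word) → Word → Prop}
    (h : Def 𝒢 fun K (ρ : Option V → Word) => P K (ρ ∘ some) (ρ none)) :
    Def 𝒢 fun K ρ => ∀ w, P K ρ w :=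
  (ex h.not (P := fun K ρ w => ¬ P K ρ w)).not.congr fun _ _ _ => by simp

theorem eq {s t : (V → Word) → Word} (hs : IsTm s) (ht : IsTm t) :
    Def 𝒢 fun _ ρ => s ρ = t ρ :=
  let ⟨s', hs'⟩ := hs
  let ⟨t', ht'⟩ := ht
  ⟨.eq s' t', fun K _ ρ => by simp [Fml.Sem, hs', ht']⟩

theorem const (p : Prop) : Def 𝒢 fun _ (_ : V → Word) => p := by
  by_cases hp : p
  · exact (eq (IsTm.const []) (IsTm.const [])).congr fun _ _ _ => by simp [hp]
  · exact (eq (IsTm.const []) (IsTm.const [])).not.congr fun _ _ _ => by simp [hp]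

theorem fact {f : Fact ((V → Word) → Word)} (hf : ∀ s ∈ f.args, IsTm s) :
    Def 𝒢 fun K ρ => (f.map fun s => s ρ).HoldsIn K := by
  -- `Fact.map` needs a total function, so functions that are not terms receive a dummy constant.
  have h : ∀ s : (V → Word) → Word, ∃ t : Tm V, IsTm s → ∀ ρ, s ρ = t.eval id ρ := by
    intro s
    by_cases hs : IsTm s
    · exact ⟨hs.choose, fun _ => hs.choose_spec⟩
    · exact ⟨.const [], fun h => absurd h hs⟩
  choose g hg using h
  refine ⟨.fact (f.map g), fun K _ ρ => ?_⟩
  rw [Fml.Sem, Fact.map_map]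
  beta_reduce
  rw [Fact.map_congr (g := fun s => s ρ) (h := Tm.eval id ρ ∘ g) fun s hs => hg s (hf s hs) ρ]

section

variable {s t r i : (V → Word) → Word}

theorem mem_openInd (ht : IsTm t) : Def 𝒢 fun K ρ => t ρ ∈ K.openInd :=
  fact (f := .openInd t) (by simpa [Fact.args])

theorem mem_modelInd (ht : IsTm t) : Def 𝒢 fun K ρ => t ρ ∈ K.modelInd :=
  fact (f := .modelInd t) (by simpa [Fact.args])

theorem concept_mem_abox (m : Mode) (hs : IsTm s) (ht : IsTm t) :
    Def 𝒢 fun K ρ => Atom.concept ⟨m, s ρ⟩ (t ρ) ∈ K.abox :=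
  fact (f := .aboxConcept m s t) (by simp [Fact.args, *])

theorem role_mem_abox (m : Mode) (hs : IsTm s) (ht : IsTm t) (hr : IsTm r) :
    Def 𝒢 fun K ρ => Atom.role ⟨m, s ρ⟩ (t ρ) (r ρ) ∈ K.abox :=
  fact (f := .aboxRole m s t r) (by simp [Fact.args, *])

theorem concept_mem_mbox (m : Mode) (hi : IsTm i) (hs : IsTm s) (ht : IsTm t) :
    Def 𝒢 fun K ρ => (i ρ, Atom.concept ⟨m, s ρ⟩ (t ρ)) ∈ K.mbox :=
  fact (f := .mboxConcept i m s t) (by simp [Fact.args, *])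

theorem role_mem_mbox (m : Mode) (hi : IsTm i) (hs : IsTm s) (ht : IsTm t) (hr : IsTm r) :
    Def 𝒢 fun K ρ => (i ρ, Atom.role ⟨m, s ρ⟩ (t ρ) (r ρ)) ∈ K.mbox :=
  fact (f := .mboxRole i m s t r) (by simp [Fact.args, *])

end

theorem subst {P : CCKB → (U → Word) → Prop} (hP : Def 𝒢 P) {g : U → (V → Word) → Word}
    (hg : ∀ u, IsTm (g u)) : Def 𝒢 fun K ρ => P K fun u => g u ρ := by
  obtain ⟨φ, hφ⟩ := hP
  choose g' hg' using hg
  refine ⟨φ.subst g', fun K hK ρ => ?_⟩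
  rw [Fml.sem_subst, hφ K hK]
  simp only [hg']

theorem comp {P : CCKB → (U → Word) → Prop} (hP : Def 𝒢 P) (e : U → V) :
    Def 𝒢 fun K ρ => P K (ρ ∘ e) :=
  hP.subst fun u => IsTm.var (e u)

theorem exFinite {ι : Type*} [Finite ι] {P : ι → CCKB → (V → Word) → Prop}
    (h : ∀ i, Def 𝒢 (P i)) : Def 𝒢 fun K ρ => ∃ i, P i K ρ := by
  have key : ∀ l : List ι, Def 𝒢 fun K ρ => ∃ i ∈ l, P i K ρ := by
    intro l
    induction l with
    | nil => exact (const False).congr fun _ _ _ => by simp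
    | cons i l ih => exact ((h i).or ih).congr fun _ _ _ => by simp
  have := Fintype.ofFinite ι
  exact (key Finset.univ.toList).congr fun _ _ _ => by simp

theorem allFinite {ι : Type*} [Finite ι] {P : ι → CCKB → (V → Word) → Prop}
    (h : ∀ i, Def 𝒢 (P i)) : Def 𝒢 fun K ρ => ∀ i, P i K ρ :=
  (exFinite fun i => (h i).not).not.congr fun _ _ _ => by simp

theorem exMem {ι : Type*} {l : List ι} {P : ι → CCKB → (V → Word) → Prop}
    (h : ∀ i ∈ l, Def 𝒢 (P i)) : Def 𝒢 fun K ρ => ∃ i ∈ l, P i K ρ :=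
  have : Finite {i // i ∈ l} := (List.finite_toSet l).to_subtype
  (exFinite (ι := {i // i ∈ l}) fun i => h i i.2).congr fun _ _ _ => by simp

theorem allMem {ι : Type*} {l : List ι} {P : ι → CCKB → (V → Word) → Prop}
    (h : ∀ i ∈ l, Def 𝒢 (P i)) : Def 𝒢 fun K ρ => ∀ i ∈ l, P i K ρ :=
  have : Finite {i // i ∈ l} := (List.finite_toSet l).to_subtype
  (allFinite (ι := {i // i ∈ l}) fun i => h i i.2).congr fun _ _ _ => by simp

theorem exMemFinset {ι : Type*} {l : Finset ι} {P : ι → CCKB → (V → Word) → Prop}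
    (h : ∀ i ∈ l, Def 𝒢 (P i)) : Def 𝒢 fun K ρ => ∃ i ∈ l, P i K ρ :=
  (exMem (l := l.toList) fun i hi => h i (by simpa using hi)).congr fun _ _ _ => by simp

theorem allMemFinset {ι : Type*} {l : Finset ι} {P : ι → CCKB → (V → Word) → Prop}
    (h : ∀ i ∈ l, Def 𝒢 (P i)) : Def 𝒢 fun K ρ => ∀ i ∈ l, P i K ρ :=
  (allMem (l := l.toList) fun i hi => h i (by simpa using hi)).congr fun _ _ _ => by simp

/-- A property that is determined by finitely many definable properties is definable. -/
theorem ofFinite {ι : Type} [Finite ι] {Q : ι → CCKB → (V → Word) → Prop}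
    (hQ : ∀ i, Def 𝒢 (Q i))
    (h : ∀ K ρ K' ρ', 𝒢 K → 𝒢 K' → (∀ i, Q i K ρ ↔ Q i K' ρ') → P K ρ → P K' ρ') : Def 𝒢 P := by
  have : Finite (ι → Prop) := Pi.finite
  -- The defining formula is the disjunction over those truth patterns of the `Q i` that are
  -- realised by some pair satisfying `P`. There are finitely many patterns, and which ones occur
  -- need not be computed.
  refine (exFinite (ι := {σ : ι → Prop //
      ∃ K ρ, 𝒢 K ∧ P K ρ ∧ ∀ i, Q i K ρ ↔ σ i}) fun σ => allFinite fun i =>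
        (hQ i).iff (const (σ.1 i))).congr fun K hK ρ => ?_
  constructor
  · rintro ⟨⟨σ, K', ρ', hK', hP, hσ⟩, hi⟩
    exact h K' ρ' K ρ hK' hK (fun i => (hσ i).trans (hi i).symm) hP
  · exact fun hP => ⟨⟨fun i => Q i K ρ, K, ρ, hK, hP, fun i => Iff.rfl⟩, fun i => Iff.rfl⟩

theorem exTuple {m : ℕ} {P : CCKB → (V → Word) → (Fin m → Word) → Prop}
    (h : Def 𝒢 fun K (ρ : V ⊕ Fin m → Word) => P K (ρ ∘ Sum.inl) (ρ ∘ Sum.inr)) :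
    Def 𝒢 fun K ρ => ∃ y, P K ρ y := by
  induction m with
  | zero =>
    refine (h.subst (g := Sum.elim (fun v ρ => ρ v) fun i => i.elim0) ?_).congr fun K _ ρ => ?_
    · rintro (v | i)
      · exact IsTm.var v
      · exact i.elim0
    · constructor
      · exact fun h => ⟨_, h⟩
      · rintro ⟨y, hy⟩
        convert hy
        rfl
  | succ m ih =>
    have h' := h.subst (g := Sum.elim (fun v (ρ : Option (V ⊕ Fin m) → Word) => ρ (some (.inl v)))
      fun i ρ => Fin.cases (motive := fun _ => Word) (ρ none) (fun j => ρ (some (.inr j))) i) (by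
        rintro (v | i)
        · exact IsTm.var _
        · refine Fin.cases ?_ (fun j => ?_) i
          · exact IsTm.var _
          · exact IsTm.var _)
    have h₂ := ih (P := fun K ρ y => ∃ w, P K ρ (Fin.cons w y)) (ex (h'.congr fun K _ ρ => by
      apply iff_of_eq
      congr 1))
    refine h₂.congr fun K _ ρ => ?_
    constructor
    · rintro ⟨y, w, hw⟩
      exact ⟨_, hw⟩
    · rintro ⟨y, hy⟩
      exact ⟨Fin.tail y, y 0, by rwa [Fin.cons_self_tail]⟩

theorem allTuple {m : ℕ} {P : CCKB → (V → Word) → (Fin m → Word) → Prop}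
    (h : Def 𝒢 fun K (ρ : V ⊕ Fin m → Word) => P K (ρ ∘ Sum.inl) (ρ ∘ Sum.inr)) :
    Def 𝒢 fun K ρ => ∀ y, P K ρ y :=
  (exTuple h.not (P := fun K ρ y => ¬ P K ρ y)).not.congr fun _ _ _ => by simp

/-- Definability of the weakest precondition of a partial transformation of knowledge bases that is
described by the definable property `R`. -/
theorem wp {F : CCKB → (U → Word) → Option CCKB} {R : CCKB → (U → Word) → Fact Word → Prop}
    (hok : Def 𝒢 fun K ρ => ∃ K', F K ρ = some K')
    (h𝒢 : ∀ K ρ K', 𝒢 K → F K ρ = some K' → 𝒢 K')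
    (hR : ∀ K ρ K' f, 𝒢 K → F K ρ = some K' → (f.HoldsIn K' ↔ R K ρ f))
    (hdef : ∀ {V : Type} (e : U → V) (f : Fact (Tm V)),
      Def 𝒢 fun K (ρ : V → Word) => R K (ρ ∘ e) (f.map (Tm.eval id ρ)))
    {P : CCKB → (U → Word) → Prop} (hP : Def 𝒢 P) :
    Def 𝒢 fun K ρ => ∃ K', F K ρ = some K' ∧ P K' ρ := by
  -- Replace each fact in the formula by its description in the old knowledge base. The map `e`
  -- remembers the parameters of the transformation while bound variables are added.
  have key : ∀ {V : Type} (φ : Fml V) (e : U → V), ∃ ψ : Fml V, ∀ K ρ K', 𝒢 K →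
      F K (ρ ∘ e) = some K' → (ψ.Sem K ρ ↔ φ.Sem K' ρ) := by
    intro V φ
    induction φ with
    | eq s t => exact fun e => ⟨.eq s t, fun _ _ _ _ _ => Iff.rfl⟩
    | fact f =>
      intro e
      obtain ⟨ψ, hψ⟩ := hdef e f
      exact ⟨ψ, fun K ρ K' hK hF => (hψ K hK ρ).trans (hR K _ K' _ hK hF).symm⟩
    | neg φ ih =>
      intro e
      obtain ⟨ψ, hψ⟩ := ih e
      exact ⟨.neg ψ, fun K ρ K' hK hF => not_congr (hψ K ρ K' hK hF)⟩
    | and φ₁ φ₂ ih₁ ih₂ =>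
      intro e
      obtain ⟨ψ₁, h₁⟩ := ih₁ e
      obtain ⟨ψ₂, h₂⟩ := ih₂ e
      exact ⟨.and ψ₁ ψ₂, fun K ρ K' hK hF => and_congr (h₁ K ρ K' hK hF) (h₂ K ρ K' hK hF)⟩
    | ex φ ih =>
      intro e
      obtain ⟨ψ, hψ⟩ := ih (some ∘ e)
      exact ⟨.ex ψ, fun K ρ K' hK hF => exists_congr fun a => hψ K (extend ρ a) K' hK hF⟩
  obtain ⟨φ, hφ⟩ := hP
  obtain ⟨ψ, hψ⟩ := key φ id
  have hψ' : Def 𝒢 fun K ρ => ψ.Sem K ρ := ⟨ψ, fun _ _ _ => Iff.rfl⟩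
  refine (hok.and hψ').congr fun K hK ρ => ?_
  constructor
  · rintro ⟨⟨K', hF⟩, h⟩
    exact ⟨K', hF, (hφ K' (h𝒢 K ρ K' hK hF) ρ).1 ((hψ K ρ K' hK hF).1 h)⟩
  · rintro ⟨K', hF, h⟩
    exact ⟨⟨K', hF⟩, (hψ K ρ K' hK hF).2 ((hφ K' (h𝒢 K ρ K' hK hF) ρ).2 h)⟩

end Def

end CoreClosed

namespace CoreClosed

open Function Relation

/-! ## The canonical model -/

/-- The inverse of a role. -/
def Role.conv : Role → Role
  | .dir r => .inv r
  | .inv r => .dir r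

@[simp] theorem Role.conv_conv (p : Role) : p.conv.conv = p := by cases p <;> rfl

theorem Interp.mem_roleExt_conv {Δ : Type} (I : Interp Δ) (p : Role) (d e : Δ) :
    (d, e) ∈ I.roleExt p.conv ↔ (e, d) ∈ I.roleExt p := by
  cases p <;> rfl

theorem Interp.mem_basicExt_ex {Δ : Type} (I : Interp Δ) (p : Role) (d : Δ) :
    d ∈ I.basicExt (.ex p) ↔ ∃ e, (d, e) ∈ I.roleExt p := Iff.rfl

/-- Entailment between basic concepts by the positive inclusions of `C`. -/
def Sub (C : Finset Constraint) : Basic → Basic → Prop :=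
  ReflTransGen fun B₁ B₂ => Constraint.pos B₁ B₂ ∈ C

theorem Sub.basicExt {Δ : Type} {I : Interp Δ} {C : Finset Constraint}
    (hC : ∀ c ∈ C, I.SatConstraint c) {B B' : Basic} (h : Sub C B B') :
    I.basicExt B ⊆ I.basicExt B' := by
  induction h with
  | refl => exact subset_rfl
  | tail _ h ih => exact ih.trans (hC _ h)

/-- The basic concepts of the new element that is a witness for the role `p`. -/
def NewType (C : Finset Constraint) (p : Role) (B : Basic) : Prop := Sub C (.ex p.conv) B

namespace CCKB

variable (K : CCKB)

/-- The terminological statements of the knowledge base. -/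
def axioms : Finset Constraint := K.tbox ∪ K.sbox

/-- The assertions of the knowledge base. -/
def Base (f : Assertion) : Prop := f ∈ K.abox ∨ f ∈ K.core

/-- The asserted role connections. -/
def BaseRole : Role → Word → Word → Prop
  | .dir R, a, b => K.Base (.role R a b)
  | .inv R, a, b => K.Base (.role R b a)

/-- The asserted basic concepts of an individual. -/
def BaseType (a : Word) : Basic → Prop
  | .bot => False
  | .atom A => K.Base (.concept A a)
  | .ex p => ∃ b, K.BaseRole p a b

/-- The entailed basic concepts of an individual. -/
def Cl (a : Word) (B : Basic) : Prop := ∃ B', K.BaseType a B' ∧ Sub K.axioms B' B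

/-- A new witness for the role `p` of the individual `a` is needed. -/
def Gen (a : Word) (p : Role) : Prop := K.Cl a (.ex p) ∧ ¬ ∃ b, K.BaseRole p a b

/-- A new witness for the role `p` of the element `(a, l)` is needed. -/
def Step (a : Word) : List Role → Role → Prop
  | [], p => K.Gen a p
  | q :: _, p => NewType K.axioms q (.ex p) ∧ p ≠ q.conv

/-- The element `(a, l)` belongs to the canonical model. -/
def Valid (a : Word) : List Role → Prop
  | [] => True
  | p :: l => Valid a l ∧ K.Step a l p

/-- The basic concepts of the element `(a, l)`. -/
def Ty (a : Word) : List Role → Basic → Prop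
  | [], B => K.Cl a B
  | p :: l, B => K.Valid a (p :: l) ∧ NewType K.axioms p B

/-- The elements of the canonical model: an individual, followed by a sequence of witnesses, the last
one first. -/
abbrev Elt : Type := Word × List Role

/-- The role connections of the canonical model. -/
def CanonRole (p : Role) (x y : Elt) : Prop :=
  (∃ a b, x = (a, []) ∧ y = (b, []) ∧ K.BaseRole p a b) ∨
  (y = (x.1, p :: x.2) ∧ K.Valid y.1 y.2) ∨ (x = (y.1, p.conv :: y.2) ∧ K.Valid x.1 x.2)

/-- The canonical model. -/
def canon : Interp Elt where
  ind a := (a, [])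
  concept A := {x | K.Ty x.1 x.2 (.atom A)}
  role R := {x | K.CanonRole (.dir R) x.1 x.2}
  unique_names a b h := by simpa using h

theorem mem_roleExt_canon (p : Role) (x y : Elt) :
    (x, y) ∈ K.canon.roleExt p ↔ K.CanonRole p x y := by
  cases p with
  | dir R => exact Iff.rfl
  | inv R =>
    change K.CanonRole (.dir R) y x ↔ _
    simp only [CanonRole, BaseRole, Role.conv]
    constructor
    · rintro (⟨a, b, rfl, rfl, h⟩ | h | h)
      · exact .inl ⟨b, a, rfl, rfl, h⟩
      · exact .inr (.inr h)
      · exact .inr (.inl h)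
    · rintro (⟨a, b, rfl, rfl, h⟩ | h | h)
      · exact .inl ⟨b, a, rfl, rfl, h⟩
      · exact .inr (.inr h)
      · exact .inr (.inl h)

variable {K}

theorem Step.ty {a : Word} {l : List Role} {p : Role} (hl : K.Valid a l) (h : K.Step a l p) :
    K.Ty a l (.ex p) := by
  cases l with
  | nil => exact h.1
  | cons q l => exact ⟨hl, h.1⟩

theorem Ty.sub {a : Word} {l : List Role} {B B' : Basic} (h : K.Ty a l B)
    (hs : Sub K.axioms B B') : K.Ty a l B' := by
  cases l with
  | nil =>
    obtain ⟨B₀, h₀, h₁⟩ := h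
    exact ⟨B₀, h₀, h₁.trans hs⟩
  | cons p l => exact ⟨h.1, h.2.trans hs⟩

/-- A required role successor always exists: an asserted one, else the parent if the role leads back
to it, else a new witness. Conversely, every connection entails the type. The case `⊥` is excluded
on the left only by its empty extension, as `Ty` may contain it. -/
theorem mem_basicExt_canon (x : Elt) (B : Basic) :
    x ∈ K.canon.basicExt B ↔ B ≠ .bot ∧ K.Ty x.1 x.2 B := by
  obtain ⟨a, l⟩ := x
  cases B with
  | bot => simp [Interp.basicExt]
  | atom A => simp [Interp.basicExt, canon]
  | ex p =>
    simp only [Interp.mem_basicExt_ex, mem_roleExt_canon, ne_eq, reduceCtorEq, not_false_eq_true,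
      true_and]
    constructor
    · rintro ⟨y, ⟨a', b, h, rfl, hb⟩ | ⟨rfl, h⟩ | ⟨h, hv⟩⟩
      · simp only [Prod.mk.injEq] at h
        obtain ⟨rfl, rfl⟩ := h
        exact ⟨.ex p, ⟨b, hb⟩, .refl⟩
      · exact Step.ty h.1 h.2
      · simp only [Prod.mk.injEq] at h
        obtain ⟨rfl, rfl⟩ := h
        refine ⟨hv, ?_⟩
        rw [NewType, Role.conv_conv]
        exact .refl
    · intro h
      cases l with
      | nil =>
        by_cases hb : ∃ b, K.BaseRole p a b
        · obtain ⟨b, hb⟩ := hb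
          exact ⟨(b, []), .inl ⟨a, b, rfl, rfl, hb⟩⟩
        · exact ⟨(a, [p]), .inr (.inl ⟨rfl, trivial, h, hb⟩)⟩
      | cons q l =>
        by_cases hq : p = q.conv
        · subst hq
          exact ⟨(a, l), .inr (.inr ⟨by simp, h.1⟩)⟩
        · exact ⟨(a, p :: q :: l), .inr (.inl ⟨rfl, h.1, h.2, hq⟩)⟩

/-- The knowledge base has a model. -/
def Sat (K : CCKB) : Prop := ∃ (Δ : Type) (I : Interp Δ), I.IsModel K

/-- A new witness for `p` is created only if there is neither an asserted `p`-successor nor a parent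
reached by `p`, and there is only one for each role. So two distinct successors can only both be
asserted. -/
theorem canon_func {p : Role} (h : ∀ a b b', K.BaseRole p a b → K.BaseRole p a b' → b = b') :
    K.canon.SatConstraint (.func p) := by
  rintro x y y' hy hy'
  rw [mem_roleExt_canon] at hy hy'
  rcases hy with ⟨a, b, rfl, rfl, hb⟩ | ⟨hy, hv⟩ | ⟨hx, hv⟩
  · rcases hy' with ⟨a', b', h₁, rfl, hb'⟩ | ⟨rfl, hv'⟩ | ⟨hx', -⟩
    · simp only [Prod.mk.injEq, and_true] at h₁
      subst h₁
      rw [h _ _ _ hb hb']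
    · exact (hv'.2.2 ⟨b, hb⟩).elim
    · simp at hx'
  · rcases hy' with ⟨a', b', rfl, rfl, hb'⟩ | ⟨rfl, -⟩ | ⟨hx', -⟩
    · rw [hy] at hv
      exact (hv.2.2 ⟨b', hb'⟩).elim
    · exact hy
    · rw [hy, hx'] at hv
      exact (hv.2.2 (by simp)).elim
  · rcases hy' with ⟨a', b', h₁, rfl, hb'⟩ | ⟨hy', hv'⟩ | ⟨hx', -⟩
    · simp [hx] at h₁
    · rw [hy', hx] at hv'
      exact (hv'.2.2 (by simp)).elim
    · rw [hx] at hx'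
      simp only [Prod.mk.injEq, List.cons.injEq, true_and] at hx'
      exact Prod.ext hx'.1 hx'.2

theorem canon_base {f : Assertion} (hf : K.Base f) : K.canon.SatAssertion f := by
  cases f with
  | concept A a => exact ⟨.atom A, hf, .refl⟩
  | role R a b => exact .inl ⟨a, b, rfl, rfl, hf⟩

/-! ### Homomorphisms from the canonical model into arbitrary models -/

section Hom

variable {Δ : Type} {I : Interp Δ}

theorem satConstraint_axioms (hI : I.IsModel K) : ∀ c ∈ K.axioms, I.SatConstraint c := by
  intro c hc
  rcases Finset.mem_union.1 hc with hc | hc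
  · exact hI.1 c hc
  · exact hI.2.1 c hc

theorem satAssertion_of_base (hK : ∀ f ∈ K.core, f.IsCore ↑K.modelInd) (hI : I.IsModel K)
    {f : Assertion} (h : K.Base f) : I.SatAssertion f := by
  rcases h with h | h
  · exact hI.2.2.1 f h
  · exact (hI.2.2.2.1 f (hK f h)).2 h

theorem roleExt_of_baseRole (hK : ∀ f ∈ K.core, f.IsCore ↑K.modelInd) (hI : I.IsModel K)
    {p : Role} {a b : Word} (h : K.BaseRole p a b) : (I.ind a, I.ind b) ∈ I.roleExt p := by
  cases p <;> exact satAssertion_of_base hK hI h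

open Classical in
/-- The homomorphism from the canonical model to the model `I`. -/
noncomputable def hom (I : Interp Δ) (a : Word) : List Role → Δ
  | [] => I.ind a
  | p :: l => if h : ∃ e, (hom I a l, e) ∈ I.roleExt p then h.choose else I.ind a

/-- By induction on the path, the image of the parent has the type that required the witness. The
chosen successor therefore exists in `I`, and it has the types entailed by the inverse role. -/
theorem hom_ty (hK : ∀ f ∈ K.core, f.IsCore ↑K.modelInd) (hI : I.IsModel K) (a : Word)
    (l : List Role) {B : Basic} (h : K.Ty a l B) : hom I a l ∈ I.basicExt B := by
  induction l generalizing B with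
  | nil =>
    obtain ⟨B₀, h₀, h₁⟩ := h
    refine h₁.basicExt (satConstraint_axioms hI) ?_
    cases B₀ with
    | bot => exact h₀.elim
    | atom A => exact satAssertion_of_base hK hI h₀
    | ex p =>
      obtain ⟨b, hb⟩ := h₀
      exact ⟨I.ind b, roleExt_of_baseRole hK hI hb⟩
  | cons p l ih =>
    have hex : ∃ e, (hom I a l, e) ∈ I.roleExt p := ih (Step.ty h.1.1 h.1.2)
    refine h.2.basicExt (satConstraint_axioms hI) ⟨hom I a l, ?_⟩
    rw [I.mem_roleExt_conv, hom, dif_pos hex]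
    exact hex.choose_spec

theorem hom_valid (hK : ∀ f ∈ K.core, f.IsCore ↑K.modelInd) (hI : I.IsModel K) {a : Word}
    {l : List Role} {p : Role} (h : K.Valid a (p :: l)) :
    (hom I a l, hom I a (p :: l)) ∈ I.roleExt p := by
  have hex : ∃ e, (hom I a l, e) ∈ I.roleExt p := hom_ty hK hI a l (Step.ty h.1 h.2)
  rw [hom, dif_pos hex]
  exact hex.choose_spec

theorem hom_role (hK : ∀ f ∈ K.core, f.IsCore ↑K.modelInd) (hI : I.IsModel K) {p : Role}
    {x y : Elt} (h : K.CanonRole p x y) : (hom I x.1 x.2, hom I y.1 y.2) ∈ I.roleExt p := by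
  rcases h with ⟨a, b, rfl, rfl, h⟩ | ⟨h, hv⟩ | ⟨h, hv⟩
  · exact roleExt_of_baseRole hK hI h
  · rw [h] at hv ⊢
    exact hom_valid hK hI hv
  · rw [h] at hv ⊢
    have := hom_valid hK hI hv
    rwa [I.mem_roleExt_conv] at this

theorem hom_satAtom (hK : ∀ f ∈ K.core, f.IsCore ↑K.modelInd) (hI : I.IsModel K) {f : Atom Elt}
    (h : K.canon.SatAtom f) : I.SatAtom (f.map fun x => hom I x.1 x.2) := by
  cases f with
  | concept A x => exact hom_ty hK hI _ _ h
  | role R x y => exact hom_role hK hI h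

/-- Any violation in the canonical model would be carried into `I` by the homomorphism, which fixes
individuals. -/
theorem canon_isModel (hK : ∀ f ∈ K.core, f.IsCore ↑K.modelInd) (hI : I.IsModel K) :
    K.canon.IsModel K := by
  have hax : ∀ c ∈ K.axioms, K.canon.SatConstraint c := by
    intro c hc
    have hIc := satConstraint_axioms hI c hc
    cases c with
    | pos B₁ B₂ =>
      intro x hx
      rw [mem_basicExt_canon] at hx ⊢
      have hty := hx.2.sub (.single hc)
      refine ⟨?_, hty⟩
      -- If `⊥` were entailed, the homomorphic image would lie in the empty extension of `⊥` in `I`.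
      rintro rfl
      exact hom_ty hK hI _ _ hty
    | neg B₁ B₂ =>
      intro x hx hx'
      rw [mem_basicExt_canon] at hx hx'
      exact hIc (hom_ty hK hI _ _ hx.2) (hom_ty hK hI _ _ hx'.2)
    | func p =>
      refine canon_func fun a b b' hb hb' => ?_
      exact I.unique_names
        (hIc _ _ _ (roleExt_of_baseRole hK hI hb) (roleExt_of_baseRole hK hI hb'))
  refine ⟨fun c hc => hax c (Finset.mem_union_left _ hc),
    fun c hc => hax c (Finset.mem_union_right _ hc), fun f hf => canon_base (.inl hf), ?_, ?_⟩
  · intro f hf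
    refine ⟨fun h => ?_, fun h => canon_base (.inr h)⟩
    refine (hI.2.2.2.1 f hf).1 ?_
    have := hom_satAtom hK hI h
    cases f <;> exact this
  · intro a ha p hp x hx
    have hty : K.Cl a (.ex p) :=
      (mem_basicExt_canon (a, []) (.ex p)).1 ⟨x, hx⟩ |>.2
    rw [mem_roleExt_canon] at hx
    rcases hx with ⟨a', b, -, rfl, -⟩ | ⟨rfl, hv⟩ | ⟨h, -⟩
    · exact ⟨b, rfl⟩
    -- In `I` a core successor of a model individual is named, hence asserted in the core by the
    -- closed-world condition. This contradicts the need for a new witness.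
    · obtain ⟨e, he⟩ := hom_ty hK hI a [] hty
      obtain ⟨b, rfl⟩ := hI.2.2.2.2 a ha p hp e he
      refine (hv.2.2 ⟨b, ?_⟩).elim
      cases p with
      | dir R => exact .inr ((hI.2.2.2.1 (.role R a b) ⟨hp, .inl ha⟩).1 he)
      | inv R => exact .inr ((hI.2.2.2.1 (.role R b a) ⟨hp, .inr ha⟩).1 he)
    · simp [canon] at h

end Hom

theorem sat_iff (hK : ∀ f ∈ K.core, f.IsCore ↑K.modelInd) : K.Sat ↔ K.canon.IsModel K :=
  ⟨fun ⟨_, _, hI⟩ => canon_isModel hK hI, fun h => ⟨_, _, h⟩⟩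

theorem _root_.CoreClosed.Atom.map_map {τ τ' τ'' : Type} (g : τ → τ') (h : τ' → τ'') (f : Atom τ) :
    (f.map g).map h = f.map (h ∘ g) := by
  cases f <;> rfl

/-- Homomorphisms preserve conjunctive queries; the absence of inequalities is essential, as the
homomorphism need not be injective. -/
theorem must_iff (hK : ∀ f ∈ K.core, f.IsCore ↑K.modelInd) {k : ℕ} (φ : UCQ k)
    (c : Fin k → Word) :
    MustMay.Holds K c (.must φ) ↔ (K.Sat → UCQNeq.Holds K.canon φ.1 c) := by
  constructor
  · exact fun h hs => h _ _ ((sat_iff hK).1 hs)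
  · intro h Δ I hI
    obtain ⟨q, hq, y, hy, -⟩ := h ⟨Δ, I, hI⟩
    refine ⟨q, hq, fun i => hom I (y i).1 (y i).2, ?_, by simp [φ.2 q hq]⟩
    intro f hf
    have := hom_satAtom hK hI (hy f hf)
    rw [Atom.map_map] at this
    convert this using 2
    funext t
    rcases t with a | (i | i) <;> rfl

end CCKB

end CoreClosed

/-! ### Finite descriptions of witness trees, and definability of satisfiability -/

namespace CoreClosed

open Function Relation

/-- The knowledge bases with the terminologies `T` and `S` whose core consists of core assertions. -/
structure Good (T S : Finset Constraint) (K : CCKB) : Prop where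
  tbox : K.tbox = T
  sbox : K.sbox = S
  core : ∀ f ∈ K.core, f.IsCore ↑K.modelInd

theorem Good.axioms_eq {T S : Finset Constraint} {K : CCKB} (h : Good T S K) :
    K.axioms = T ∪ S := by
  rw [CCKB.axioms, h.tbox, h.sbox]

namespace CCKB

/-- The constraint `c` requires a new witness for the individual `a`. -/
def GenBy (K : CCKB) (a : Word) : Constraint → Prop
  | .pos _ (.ex p) => K.Gen a p
  | _ => False

/-- Assert further assertions in the ABox. -/
def addFacts (K : CCKB) (F : Finset Assertion) : CCKB := { K with abox := K.abox ∪ F }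

variable {K K' : CCKB}

theorem mem_core_iff {f : Assertion} : f ∈ K.core ↔ ∃ i, (i, f) ∈ K.mbox := by
  simp [core]

theorem cl_iff {a : Word} {B : Basic} : K.Cl a B ↔
    K.BaseType a B ∨ ∃ c ∈ K.axioms, ∃ B₁, c = .pos B₁ B ∧ K.Cl a B₁ := by
  constructor
  · rintro ⟨B₀, h₀, h₁⟩
    rcases ReflTransGen.cases_tail h₁ with rfl | ⟨B₁, h₁, h₂⟩
    · exact .inl h₀
    · exact .inr ⟨_, h₂, B₁, rfl, B₀, h₀, h₁⟩
  · rintro (h | ⟨_, hc, B₁, rfl, B₀, h₀, h₁⟩)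
    · exact ⟨B, h, .refl⟩
    · exact ⟨B₀, h₀, h₁.tail hc⟩

theorem cl_iff_head {a : Word} {B : Basic} : K.Cl a B ↔
    K.BaseType a B ∨ ∃ c ∈ K.axioms, ∃ B₁ B₂, c = .pos B₁ B₂ ∧ Sub K.axioms B₁ B ∧
      K.BaseType a B₁ := by
  constructor
  · rintro ⟨B₀, h₀, h₁⟩
    rcases ReflTransGen.cases_head h₁ with rfl | ⟨B₁, h₂, h₃⟩
    · exact .inl h₀
    · exact .inr ⟨_, h₂, B₀, B₁, rfl, h₁, h₀⟩
  · rintro (h | ⟨_, hc, B₁, B₂, rfl, h₁, h₀⟩)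
    · exact ⟨B, h, .refl⟩
    · exact ⟨B₁, h₀, h₁⟩

/-- A type `∃p` that is not asserted must come from an inclusion with right-hand side `∃p`. So only
the finitely many roles in the axioms matter, and `GenBy` covers all of them. -/
theorem gen_iff {a : Word} {p : Role} :
    K.Gen a p ↔ ∃ c ∈ K.axioms, ∃ B, c = .pos B (.ex p) ∧ K.GenBy a c := by
  constructor
  · intro h
    rcases cl_iff.1 h.1 with hb | ⟨c, hc, B, rfl, -⟩
    · exact (h.2 hb).elim
    · exact ⟨_, hc, B, rfl, h⟩
  · rintro ⟨_, -, B, rfl, h⟩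
    exact h

/-- Only the first step of a path consults the data of the root; all later ones depend on the
axioms. Individuals with the same `GenBy` pattern thus carry the same tree, even in different
knowledge bases. -/
theorem valid_congr {a a' : Word} (hax : K.axioms = K'.axioms)
    (h : ∀ c ∈ K.axioms, K.GenBy a c ↔ K'.GenBy a' c) (l : List Role) :
    K.Valid a l ↔ K'.Valid a' l := by
  induction l with
  | nil => exact Iff.rfl
  | cons p l ih =>
    refine and_congr ih ?_
    cases l with
    | nil =>
      simp only [Step]
      rw [gen_iff, gen_iff, ← hax]
      exact exists_congr fun c => and_congr_right fun hc => exists_congr fun B =>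
        and_congr_right fun _ => h c hc
    | cons q l => simp only [Step, hax]

theorem ty_congr {a a' : Word} (hax : K.axioms = K'.axioms)
    (h : ∀ c ∈ K.axioms, K.GenBy a c ↔ K'.GenBy a' c) {B : Basic} (hB : K.Cl a B ↔ K'.Cl a' B)
    (l : List Role) : K.Ty a l B ↔ K'.Ty a' l B := by
  cases l with
  | nil => exact hB
  | cons p l => rw [Ty, Ty, valid_congr hax h, hax]

end CCKB

namespace Def

variable {T S : Finset Constraint} {V : Type}

section

variable {s t r : (V → Word) → Word}

theorem concept_mem_core (m : Mode) (hs : IsTm s) (ht : IsTm t) :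
    Def (Good T S) fun K ρ => Atom.concept ⟨m, s ρ⟩ (t ρ) ∈ K.core :=
  (ex (P := fun K ρ i => (i, Atom.concept ⟨m, s ρ⟩ (t ρ)) ∈ K.mbox)
    (concept_mem_mbox m (IsTm.var _) (hs.comp _) (ht.comp _))).congr
      fun _ _ _ => CCKB.mem_core_iff.symm

theorem role_mem_core (m : Mode) (hs : IsTm s) (ht : IsTm t) (hr : IsTm r) :
    Def (Good T S) fun K ρ => Atom.role ⟨m, s ρ⟩ (t ρ) (r ρ) ∈ K.core :=
  (ex (P := fun K ρ i => (i, Atom.role ⟨m, s ρ⟩ (t ρ) (r ρ)) ∈ K.mbox)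
    (role_mem_mbox m (IsTm.var _) (hs.comp _) (ht.comp _) (hr.comp _))).congr
      fun _ _ _ => CCKB.mem_core_iff.symm

theorem base_concept (m : Mode) (hs : IsTm s) (ht : IsTm t) :
    Def (Good T S) fun K ρ => K.Base (.concept ⟨m, s ρ⟩ (t ρ)) :=
  (concept_mem_abox m hs ht).or (concept_mem_core m hs ht)

theorem base_role (m : Mode) (hs : IsTm s) (ht : IsTm t) (hr : IsTm r) :
    Def (Good T S) fun K ρ => K.Base (.role ⟨m, s ρ⟩ (t ρ) (r ρ)) :=
  (role_mem_abox m hs ht hr).or (role_mem_core m hs ht hr)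

theorem baseRole (p : Role) (ht : IsTm t) (hr : IsTm r) :
    Def (Good T S) fun K ρ => K.BaseRole p (t ρ) (r ρ) := by
  cases p with
  | dir R => exact base_role R.mode (IsTm.const R.word) ht hr
  | inv R => exact base_role R.mode (IsTm.const R.word) hr ht

theorem exists_baseRole (p : Role) (ht : IsTm t) :
    Def (Good T S) fun K ρ => ∃ b, K.BaseRole p (t ρ) b :=
  ex (P := fun K ρ b => K.BaseRole p (t ρ) b) (baseRole p (ht.comp _) (IsTm.var _))

theorem baseType (B : Basic) (ht : IsTm t) :
    Def (Good T S) fun K ρ => K.BaseType (t ρ) B := by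
  cases B with
  | bot => exact const False
  | atom A => exact base_concept A.mode (IsTm.const A.word) ht
  | ex p => exact exists_baseRole p ht

theorem cl (B : Basic) (ht : IsTm t) : Def (Good T S) fun K ρ => K.Cl (t ρ) B := by
  refine ((baseType B ht).or (exMemFinset (l := T ∪ S) (P := fun c K ρ => ∃ B₁ B₂,
    c = .pos B₁ B₂ ∧ Sub (T ∪ S) B₁ B ∧ K.BaseType (t ρ) B₁) fun c _ => ?_)).congr
    fun K hK ρ => ?_
  · cases c with
    | pos B₁ B₂ =>
      refine ((const (Sub (T ∪ S) B₁ B)).and (baseType B₁ ht)).congr fun K _ ρ => ?_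
      simp
    | _ => exact (const False).congr fun K _ ρ => by simp
  · rw [CCKB.cl_iff_head, hK.axioms_eq]

theorem gen (p : Role) (ht : IsTm t) : Def (Good T S) fun K ρ => K.Gen (t ρ) p :=
  (cl (.ex p) ht).and (exists_baseRole p ht).not

theorem genBy (c : Constraint) (ht : IsTm t) : Def (Good T S) fun K ρ => K.GenBy (t ρ) c := by
  rcases c with ⟨B₁, _ | _ | p⟩ | _ | _
  case pos.ex => exact gen p ht
  all_goals exact const False

end

/-- The quantifier over paths `l` has an infinite range, but its truth depends only on the finitely
many `GenBy` properties and on the two types of the root, so `ofFinite` applies. -/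
theorem not_ty (B₁ B₂ : Basic) :
    Def (Good T S) fun K (_ : V → Word) => ∀ a l, ¬ (K.Ty a l B₁ ∧ K.Ty a l B₂) := by
  refine all (P := fun K ρ a => ∀ l, ¬ (K.Ty a l B₁ ∧ K.Ty a l B₂)) ?_
  refine ofFinite (ι := Bool ⊕ {c // c ∈ T ∪ S}) (Q := Sum.elim
    (fun b K ρ => K.Cl (ρ none) (if b then B₁ else B₂)) fun c K ρ => K.GenBy (ρ none) c) ?_ ?_
  · rintro (b | c)
    · exact cl _ (IsTm.var _)
    · exact genBy _ (IsTm.var _)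
  · intro K ρ K' ρ' hK hK' h hP l
    have hax : K.axioms = K'.axioms := by rw [hK.axioms_eq, hK'.axioms_eq]
    have hg : ∀ c ∈ K.axioms, K.GenBy (ρ none) c ↔ K'.GenBy (ρ' none) c := by
      intro c hc
      rw [hK.axioms_eq] at hc
      exact h (.inr ⟨c, hc⟩)
    have h₁ : K.Cl (ρ none) B₁ ↔ K'.Cl (ρ' none) B₁ := h (.inl true)
    have h₂ : K.Cl (ρ none) B₂ ↔ K'.Cl (ρ' none) B₂ := h (.inl false)
    rw [← CCKB.ty_congr hax hg h₁, ← CCKB.ty_congr hax hg h₂]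
    exact hP l

/-- By construction a positive inclusion can fail only if its right-hand side is `⊥`, and
functionality only on asserted connections. The remaining conditions say that certain pairs of types
never meet. -/
theorem satConstraint_canon (c : Constraint) :
    Def (Good T S) fun K (_ : V → Word) => c ∈ K.axioms → K.canon.SatConstraint c := by
  cases c with
  | pos B₁ B₂ =>
    refine ((const (B₁ = .bot ∨ B₂ ≠ .bot)).or ((const (.pos B₁ B₂ ∈ T ∪ S)).imp
      (not_ty B₁ B₁))).congr fun K hK ρ => ?_
    rw [hK.axioms_eq]
    constructor
    · rintro h hc ⟨a, l⟩ hx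
      rw [CCKB.mem_basicExt_canon] at hx ⊢
      rcases h with (h | h) | h
      · exact (hx.1 h).elim
      · exact ⟨h, hx.2.sub (.single (by rwa [hK.axioms_eq]))⟩
      · exact (h hc a l ⟨hx.2, hx.2⟩).elim
    · intro h
      by_contra hcon
      push Not at hcon
      obtain ⟨⟨h₁, rfl⟩, hc, a, l, hty, -⟩ := hcon
      have := h hc ((CCKB.mem_basicExt_canon (a, l) B₁).2 ⟨h₁, hty⟩)
      rw [CCKB.mem_basicExt_canon] at this
      exact this.1 rfl
  | neg B₁ B₂ =>
    refine ((const (B₁ = .bot ∨ B₂ = .bot)).or ((const (.neg B₁ B₂ ∈ T ∪ S)).imp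
      (not_ty B₁ B₂))).congr fun K hK ρ => ?_
    rw [hK.axioms_eq]
    constructor
    · rintro h hc ⟨a, l⟩ hx hx'
      rw [CCKB.mem_basicExt_canon] at hx hx'
      rcases h with (h | h) | h
      · exact (hx.1 h).elim
      · exact (hx'.1 h).elim
      · exact (h hc a l ⟨hx.2, hx'.2⟩).elim
    · intro h
      by_contra hcon
      push Not at hcon
      obtain ⟨⟨h₁, h₂⟩, hc, a, l, hty, hty'⟩ := hcon
      exact h hc ((CCKB.mem_basicExt_canon (a, l) B₁).2 ⟨h₁, hty⟩)
        ((CCKB.mem_basicExt_canon (a, l) B₂).2 ⟨h₂, hty'⟩)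
  | func p =>
    refine ((const (.func p ∈ T ∪ S)).imp (all (P := fun K _ a => ∀ b b', K.BaseRole p a b →
      K.BaseRole p a b' → b = b') (all (all ((baseRole p (IsTm.var (some (some none)))
        (IsTm.var (some none))).imp ((baseRole p (IsTm.var (some (some none)))
        (IsTm.var none)).imp (eq (IsTm.var (some none)) (IsTm.var none)))))))).congr
          fun K hK ρ => ?_
    rw [hK.axioms_eq]
    refine forall_congr' fun _ => ⟨CCKB.canon_func, fun h a b b' hb hb' => ?_⟩
    have := h (a, []) (b, []) (b', []) ((K.mem_roleExt_canon _ _ _).2 (.inl ⟨a, b, rfl, rfl, hb⟩))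
      ((K.mem_roleExt_canon _ _ _).2 (.inl ⟨a, b', rfl, rfl, hb'⟩))
    simpa using this

/-- Satisfiability is first-order definable. -/
theorem sat : Def (Good T S) fun K (_ : V → Word) => K.Sat := by
  have h₁ : Def (Good T S) fun K (_ : V → Word) => ∀ c ∈ T ∪ S, c ∈ K.axioms →
      K.canon.SatConstraint c := allMemFinset fun c _ => satConstraint_canon c
  -- The concept name is a quantified word here. An entailed name is either asserted or the
  -- right-hand side of one of the finitely many inclusions, which keeps this definable.
  have h₂ : Def (Good T S) fun K (_ : V → Word) => ∀ A a, a ∈ K.modelInd →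
      (K.Base (.concept ⟨.core, A⟩ a) ∨ ∃ c ∈ T ∪ S, ∃ B, c = .pos B (.atom ⟨.core, A⟩) ∧
        K.Cl a B) → .concept ⟨.core, A⟩ a ∈ K.core := by
    refine all (P := fun K _ A => _) (all (P := fun K _ a => _) ((mem_modelInd (IsTm.var _)).imp
      (((base_concept _ (IsTm.var (some none)) (IsTm.var _)).or (exMemFinset fun c _ => ?_)).imp
        (concept_mem_core _ (IsTm.var (some none)) (IsTm.var _)))))
    rcases c with ⟨B, _ | A | _⟩ | _ | _
    case pos.atom =>
      refine ((const (A.mode = .core)).and ((eq (IsTm.var (some none)) (IsTm.const A.word)).and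
        (cl B (IsTm.var none)))).congr fun K _ ρ => ?_
      obtain ⟨m, w⟩ := A
      simp only [comp_apply, Constraint.pos.injEq, Basic.atom.injEq, ConceptName.mk.injEq]
      constructor
      · rintro ⟨rfl, rfl, h⟩
        exact ⟨B, ⟨rfl, rfl, rfl⟩, h⟩
      · rintro ⟨_, ⟨rfl, rfl, rfl⟩, h⟩
        exact ⟨rfl, rfl, h⟩
    all_goals exact (const False).congr fun K _ ρ => by simp
  have h₃ : Def (Good T S) fun K (_ : V → Word) => ∀ R a b, (a ∈ K.modelInd ∨ b ∈ K.modelInd) →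
      K.Base (.role ⟨.core, R⟩ a b) → .role ⟨.core, R⟩ a b ∈ K.core :=
    all (P := fun K _ R => _) (all (P := fun K _ a => _) (all (P := fun K _ b => _)
      (((mem_modelInd (IsTm.var (some none))).or (mem_modelInd (IsTm.var none))).imp
        ((base_role _ (IsTm.var (some (some none))) (IsTm.var (some none)) (IsTm.var none)).imp
          (role_mem_core _ (IsTm.var (some (some none))) (IsTm.var (some none))
            (IsTm.var none))))))
  -- New witnesses are anonymous, so a model individual must not need one for a core-closed role.
  have h₄ : Def (Good T S) fun K (_ : V → Word) => ∀ a, a ∈ K.modelInd → ∀ c ∈ T ∪ S,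
      (∃ B p, c = .pos B (.ex p) ∧ p.mode = .core) → ¬ K.GenBy a c :=
    all (P := fun K _ a => _) ((mem_modelInd (IsTm.var none)).imp (allMemFinset fun c _ =>
      (const _).imp (genBy c (IsTm.var none)).not))
  refine (h₁.and (h₂.and (h₃.and h₄))).congr fun K hK ρ => ?_
  rw [CCKB.sat_iff hK.core, ← hK.axioms_eq]
  constructor
  · rintro ⟨h₁, h₂, h₃, h₄⟩
    refine ⟨fun c hc => ?_, fun c hc => ?_, fun f hf => CCKB.canon_base (.inl hf), ?_, ?_⟩
    · have := Finset.mem_union_left K.sbox hc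
      exact h₁ c this this
    · have := Finset.mem_union_right K.tbox hc
      exact h₁ c this this
    · refine fun f hf => ⟨fun h => ?_, fun h => CCKB.canon_base (.inr h)⟩
      cases f with
      | concept A a =>
        obtain ⟨m, w⟩ := A
        obtain ⟨rfl, ha⟩ := hf
        refine h₂ w a ha ?_
        have hcl : K.Cl a (.atom ⟨.core, w⟩) := h
        rwa [CCKB.cl_iff] at hcl
      | role R a b =>
        obtain ⟨m, w⟩ := R
        obtain ⟨rfl, hab⟩ := hf
        refine h₃ w a b hab ?_
        rcases h with ⟨a', b', h, h', hb⟩ | ⟨h, -⟩ | ⟨h, -⟩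
        · simp only [CCKB.canon, Prod.mk.injEq, and_true] at h h'
          rw [h, h']
          exact hb
        · simp [CCKB.canon] at h
        · simp [CCKB.canon] at h
    · intro a ha p hp x hx
      rw [CCKB.mem_roleExt_canon] at hx
      rcases hx with ⟨a', b, -, rfl, -⟩ | ⟨rfl, hv⟩ | ⟨h, -⟩
      · exact ⟨b, rfl⟩
      · obtain ⟨c, hc, B, rfl, hg⟩ := CCKB.gen_iff.1 hv.2
        exact (h₄ a ha _ hc ⟨B, p, rfl, hp⟩ hg).elim
      · simp [CCKB.canon] at h
  · intro h
    refine ⟨fun c hc _ => CCKB.satConstraint_axioms h c hc, ?_, ?_, ?_⟩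
    · intro A a ha hb
      refine (h.2.2.2.1 (.concept ⟨.core, A⟩ a) ⟨rfl, ha⟩).1 ?_
      change K.Cl a (.atom ⟨.core, A⟩)
      rwa [CCKB.cl_iff]
    · intro R a b hab hb
      exact (h.2.2.2.1 (.role ⟨.core, R⟩ a b) ⟨rfl, hab⟩).1 (CCKB.canon_base hb)
    · rintro a ha _ hc ⟨B, p, rfl, hp⟩ hg
      have hv : K.Valid a [p] := ⟨trivial, hg⟩
      obtain ⟨b, hb⟩ := h.2.2.2.2 a ha p hp (a, [p])
        ((K.mem_roleExt_canon _ _ _).2 (.inr (.inl ⟨rfl, hv⟩)))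
      simp [CCKB.canon] at hb

end Def

end CoreClosed

namespace CoreClosed

open Function Relation

/-! ## Definability of `Must` queries -/

/-- The path of the value of a term in the canonical model. -/
def Tm.path {k e : ℕ} (l : Fin e → List Role) : Tm (Fin k ⊕ Fin e) → List Role
  | .const _ => []
  | .var v => Sum.elim (fun _ => []) l v

namespace Def

variable {T S : Finset Constraint}

/-- Each existential variable is split into a root word, quantified in the logic, and a path. The
existence of suitable paths is eliminated by `ofFinite`. -/
theorem holds_canon {k : ℕ} (q : CQ k) (hq : q.ineqs = []) :
    Def (Good T S) fun K ρ => q.Holds K.canon ρ := by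
  have hex : Def (Good T S) fun K (ρ : Fin k → Word) => ∃ h : Fin q.e → Word,
      ∃ l : Fin q.e → List Role, ∀ f ∈ q.atoms, K.canon.SatAtom
        (f.map fun t => (t.eval id (Sum.elim ρ h), t.path l)) := by
    refine exTuple (P := fun K ρ h => ∃ l : Fin q.e → List Role, ∀ f ∈ q.atoms, K.canon.SatAtom
        (f.map fun t => (t.eval id (Sum.elim ρ h), t.path l))) ?_
    have htm : ∀ t : Tm (Fin k ⊕ Fin q.e), IsTm fun ρ : Fin k ⊕ Fin q.e → Word => t.eval id ρ :=
      fun t => ⟨t, fun _ => rfl⟩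
    -- The relevant data of the roots. For a role atom the Boolean gives two slots: the asserted
    -- connection and the tree of the first root, or the equality of the roots and the tree of the
    -- second.
    let Q : {f // f ∈ q.atoms} × Bool × Option {c // c ∈ T ∪ S} → CCKB →
        (Fin k ⊕ Fin q.e → Word) → Prop := fun i K ρ => match i.1.1, i.2 with
      | .concept A t, (_, none) => K.Cl (t.eval id ρ) (.atom A)
      | .concept _ t, (_, some c) => K.GenBy (t.eval id ρ) c
      | .role R t₁ t₂, (true, none) => K.BaseRole (.dir R) (t₁.eval id ρ) (t₂.eval id ρ)
      | .role _ t₁ t₂, (false, none) => t₁.eval id ρ = t₂.eval id ρ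
      | .role _ t₁ _, (true, some c) => K.GenBy (t₁.eval id ρ) c
      | .role _ _ t₂, (false, some c) => K.GenBy (t₂.eval id ρ) c
    have : Finite {f // f ∈ q.atoms} := (List.finite_toSet q.atoms).to_subtype
    refine ofFinite (Q := Q) ?_ ?_
    · rintro ⟨⟨f, hf⟩, b, o⟩
      cases f <;> cases b <;> cases o <;> simp only [Q]
      all_goals first
        | exact cl _ (htm _)
        | exact genBy _ (htm _)
        | exact eq (htm _) (htm _)
        | exact baseRole _ (htm _) (htm _)
    · rintro K ρ K' ρ' hK hK' h ⟨l, hl⟩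
      have hax : K.axioms = K'.axioms := by rw [hK.axioms_eq, hK'.axioms_eq]
      refine ⟨l, fun f hf => ?_⟩
      have hl := hl f hf
      simp only [Sum.elim_comp_inl_inr] at hl ⊢
      cases f with
      | concept A t =>
        have h₁ : K.Cl (t.eval id ρ) (.atom A) ↔ K'.Cl (t.eval id ρ') (.atom A) :=
          h ⟨⟨_, hf⟩, true, none⟩
        have h₂ : ∀ c ∈ K.axioms, K.GenBy (t.eval id ρ) c ↔ K'.GenBy (t.eval id ρ') c := by
          intro c hc
          rw [hK.axioms_eq] at hc
          exact h ⟨⟨_, hf⟩, true, some ⟨c, hc⟩⟩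
        exact (CCKB.ty_congr hax h₂ h₁ (t.path l)).1 hl
      | role R t₁ t₂ =>
        have h₁ : K.BaseRole (.dir R) (t₁.eval id ρ) (t₂.eval id ρ) ↔
            K'.BaseRole (.dir R) (t₁.eval id ρ') (t₂.eval id ρ') := h ⟨⟨_, hf⟩, true, none⟩
        have h₂ : t₁.eval id ρ = t₂.eval id ρ ↔ t₁.eval id ρ' = t₂.eval id ρ' :=
          h ⟨⟨_, hf⟩, false, none⟩
        have h₃ : ∀ c ∈ K.axioms, K.GenBy (t₁.eval id ρ) c ↔ K'.GenBy (t₁.eval id ρ') c := by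
          intro c hc
          rw [hK.axioms_eq] at hc
          exact h ⟨⟨_, hf⟩, true, some ⟨c, hc⟩⟩
        have h₄ : ∀ c ∈ K.axioms, K.GenBy (t₂.eval id ρ) c ↔ K'.GenBy (t₂.eval id ρ') c := by
          intro c hc
          rw [hK.axioms_eq] at hc
          exact h ⟨⟨_, hf⟩, false, some ⟨c, hc⟩⟩
        rcases hl with ⟨a, b, ha, hb, hR⟩ | ⟨he, hv⟩ | ⟨he, hv⟩
        · simp only [Prod.mk.injEq] at ha hb
          obtain ⟨rfl, ha⟩ := ha
          obtain ⟨rfl, hb⟩ := hb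
          exact .inl ⟨_, _, Prod.ext rfl ha, Prod.ext rfl hb, h₁.1 hR⟩
        · simp only [Prod.mk.injEq] at he
          refine .inr (.inl ⟨Prod.ext (h₂.1 he.1.symm).symm he.2, ?_⟩)
          exact (CCKB.valid_congr hax h₄ _).1 hv
        · simp only [Prod.mk.injEq] at he
          refine .inr (.inr ⟨Prod.ext (h₂.1 he.1) he.2, ?_⟩)
          exact (CCKB.valid_congr hax h₃ _).1 hv
  refine hex.congr fun K _ ρ => ?_
  have hval : ∀ (h : Fin q.e → Word) (l : Fin q.e → List Role) (t : Tm (Fin k ⊕ Fin q.e)),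
      (t.eval id (Sum.elim ρ h), t.path l) = Tm.eval K.canon.ind
        (Sum.elim (fun i => K.canon.ind (ρ i)) fun i => (h i, l i)) t := by
    intro h l t
    rcases t with a | (i | i) <;> rfl
  constructor
  · rintro ⟨h, l, hl⟩
    simp only [hval] at hl
    exact ⟨_, hl, by simp [hq]⟩
  · rintro ⟨y, hy, -⟩
    refine ⟨fun i => (y i).1, fun i => (y i).2, ?_⟩
    simp only [hval]
    exact hy

theorem must {k : ℕ} (φ : UCQ k) :
    Def (Good T S) fun K ρ => MustMay.Holds K ρ (.must φ) :=
  (sat.imp (exMem fun q hq => holds_canon q (φ.2 q hq))).congr fun _ hK _ =>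
    (CCKB.must_iff hK.core φ _).symm

end Def

/-! ## Definability of `May` queries -/

/-- An element of a model without a name can be named by an inactive individual. -/
theorem Interp.rename_isModel {K : CCKB} {Δ : Type} {I : Interp Δ} (hI : I.IsModel K) {z : Δ}
    (hz : ∀ a, I.ind a ≠ z) {w : Word} (h₁ : w ∉ K.modelInd) (h₂ : w ∉ CoreClosed.ind K.core)
    (h₃ : w ∉ CoreClosed.ind K.abox) : ∃ I' : Interp Δ, I'.concept = I.concept ∧ I'.role = I.role ∧
      I'.ind = update I.ind w z ∧ I'.IsModel K := by
  have hinj : Injective (update I.ind w z) := by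
    intro a b
    simp only [update_apply]
    split_ifs with ha hb hb
    · intro; rw [ha, hb]
    · intro h; exact (hz b h.symm).elim
    · intro h; exact (hz a h).elim
    · exact fun h => I.unique_names h
  let I' : Interp Δ := ⟨update I.ind w z, I.concept, I.role, hinj⟩
  have hrole : ∀ p, I'.roleExt p = I.roleExt p := by intro p; cases p <;> rfl
  have hbasic : ∀ B, I'.basicExt B = I.basicExt B := by
    intro B
    cases B with
    | ex p => simp only [Interp.basicExt, hrole]
    | _ => rfl
  have hsat : ∀ c, I'.SatConstraint c ↔ I.SatConstraint c := by
    intro c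
    cases c <;> simp only [Interp.SatConstraint, hbasic, hrole]
  have hass : ∀ f : Assertion, w ∉ f.ind → (I'.SatAssertion f ↔ I.SatAssertion f) := by
    intro f hf
    cases f with
    | concept A a =>
      simp only [Assertion.ind, Finset.mem_singleton] at hf
      simp [Interp.SatAssertion, Atom.map, Interp.SatAtom, I', update_of_ne (Ne.symm hf)]
    | role R a b =>
      simp only [Assertion.ind, Finset.mem_insert, Finset.mem_singleton, not_or] at hf
      simp [Interp.SatAssertion, Atom.map, Interp.SatAtom, I', update_of_ne (Ne.symm hf.1),
        update_of_ne (Ne.symm hf.2)]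
  have hne : ∀ a ∈ K.modelInd, I'.ind a = I.ind a := by
    intro a ha
    exact update_of_ne (by rintro rfl; exact h₁ ha) _ _
  have hw : I'.ind w = z := update_self _ _ _
  refine ⟨I', rfl, rfl, rfl, fun c hc => (hsat c).2 (hI.1 c hc), fun c hc => (hsat c).2 (hI.2.1 c hc),
    fun f hf => (hass f ?_).2 (hI.2.2.1 f hf), fun f hf => ?_, ?_⟩
  · exact fun h => h₃ (Finset.mem_biUnion.2 ⟨f, hf, h⟩)
  · by_cases hwf : w ∈ f.ind
    · refine iff_of_false ?_ fun h => h₂ (Finset.mem_biUnion.2 ⟨f, h, hwf⟩)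
      intro h
      cases f with
      | concept A a =>
        simp only [Assertion.ind, Finset.mem_singleton] at hwf
        subst hwf
        exact h₁ hf.2
      | role R a b =>
        obtain ⟨hm, hab⟩ := hf
        simp only [Assertion.ind, Finset.mem_insert, Finset.mem_singleton] at hwf
        have h : (I'.ind a, I'.ind b) ∈ I.role R := h
        rcases hab with ha | hb
        · rcases hwf with rfl | rfl
          · exact h₁ ha
          · rw [hne a ha, hw] at h
            -- The new assertion about `w` cannot hold: a core-closed role leads from model
            -- individuals to named elements only, and `z` had no name.
            obtain ⟨c, hc⟩ := hI.2.2.2.2 a ha (.dir R) hm z h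
            exact hz c hc
        · rcases hwf with rfl | rfl
          · rw [hne b hb, hw] at h
            obtain ⟨c, hc⟩ := hI.2.2.2.2 b hb (.inv R) hm z h
            exact hz c hc
          · exact h₁ hb
    · exact (hass f hwf).trans (hI.2.2.2.1 f hf)
  · intro a ha p hp d hd
    rw [hne a ha, hrole] at hd
    obtain ⟨b, rfl⟩ := hI.2.2.2.2 a ha p hp d hd
    -- The old value of `w` loses its name. This is harmless, since a core successor named `w` would
    -- put `w` into the core.
    refine ⟨b, update_of_ne ?_ _ _⟩
    rintro rfl
    cases p with
    | dir R =>
      have := (hI.2.2.2.1 (.role R a b) ⟨hp, .inl ha⟩).1 hd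
      exact h₂ (Finset.mem_biUnion.2 ⟨_, this, by simp [Assertion.ind]⟩)
    | inv R =>
      have := (hI.2.2.2.1 (.role R b a) ⟨hp, .inr ha⟩).1 hd
      exact h₂ (Finset.mem_biUnion.2 ⟨_, this, by simp [Assertion.ind]⟩)

/-- Finitely many elements of a model can be named, without changing the names in a finite set. -/
theorem Interp.exists_rename {K : CCKB} {Δ : Type} {I : Interp Δ} (hI : I.IsModel K)
    (F : Finset Word) {Y : Set Δ} (hY : Y.Finite) : ∃ I' : Interp Δ, I'.concept = I.concept ∧
      I'.role = I.role ∧ (∀ a ∈ F, I'.ind a = I.ind a) ∧ Y ⊆ Set.range I'.ind ∧ I'.IsModel K := by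
  induction Y, hY using Set.Finite.induction_on with
  | empty => exact ⟨I, rfl, rfl, fun _ _ => rfl, by simp, hI⟩
  | @insert z Y _ hY ih =>
    obtain ⟨I', hc, hr, hF, hYr, hI'⟩ := ih
    by_cases hz : ∃ a, I'.ind a = z
    · exact ⟨I', hc, hr, hF, Set.insert_subset hz hYr, hI'⟩
    · push Not at hz
      obtain ⟨w, hw⟩ := ((F ∪ K.modelInd ∪ CoreClosed.ind K.core ∪ CoreClosed.ind K.abox).finite_toSet.union
        (hY.preimage I'.unique_names.injOn)).exists_notMem
      simp only [Finset.coe_union, Set.mem_union, Finset.mem_coe, Set.mem_preimage, not_or] at hw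
      obtain ⟨⟨⟨⟨hwF, hw₁⟩, hw₂⟩, hw₃⟩, hwY⟩ := hw
      obtain ⟨I'', hc', hr', hi, hI''⟩ := Interp.rename_isModel hI' hz hw₁ hw₂ hw₃
      refine ⟨I'', hc'.trans hc, hr'.trans hr, fun a ha => ?_, ?_, hI''⟩
      · rw [hi, update_of_ne (by rintro rfl; exact hwF ha), hF a ha]
      · rw [hi]
        rintro y (rfl | hy)
        · exact ⟨w, update_self _ _ _⟩
        · obtain ⟨a, rfl⟩ := hYr hy
          exact ⟨a, update_of_ne (by rintro rfl; exact hwY hy) _ _⟩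

/-- The arguments of an atom. -/
def Atom.args {τ : Type} : Atom τ → List τ
  | .concept _ t => [t]
  | .role _ t₁ t₂ => [t₁, t₂]

theorem Atom.map_congr {τ τ' : Type} {g h : τ → τ'} {f : Atom τ} (H : ∀ t ∈ f.args, g t = h t) :
    f.map g = f.map h := by
  cases f <;> simp_all [map, args]

/-- The assertions that state that the tuples `c` and `y` are an answer of the query. -/
def CQ.ground {k : ℕ} (q : CQ k) (ρ : Fin k ⊕ Fin q.e → Word) : Finset Assertion :=
  (q.atoms.map (Atom.map (Tm.eval id ρ))).toFinset

theorem CCKB.isModel_addFacts {K : CCKB} {F : Finset Assertion} {Δ : Type} {I : Interp Δ} :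
    I.IsModel (K.addFacts F) ↔ I.IsModel K ∧ ∀ f ∈ F, I.SatAssertion f := by
  simp only [Interp.IsModel, addFacts, Finset.mem_union, or_imp, forall_and]
  constructor
  · rintro ⟨h₁, h₂, ⟨h₃, h₄⟩, h₅⟩
    exact ⟨⟨h₁, h₂, h₃, h₅⟩, h₄⟩
  · rintro ⟨⟨h₁, h₂, h₃, h₅⟩, h₄⟩
    exact ⟨h₁, h₂, ⟨h₃, h₄⟩, h₅⟩

/-- After renaming, all existential witnesses have names. The atoms of the query are then assertions
to be added to the ABox, and by the unique name assumption its inequalities are inequalities of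
words. -/
theorem CCKB.may_iff {K : CCKB} {k : ℕ} (φ : UCQNeq k) (c : Fin k → Word) :
    MustMay.Holds K c (.may φ) ↔ ∃ q ∈ φ, ∃ y : Fin q.e → Word,
      (∀ p ∈ q.ineqs, p.1.eval id (Sum.elim c y) ≠ p.2.eval id (Sum.elim c y)) ∧
      (K.addFacts (q.ground (Sum.elim c y))).Sat := by
  have heval : ∀ {Δ : Type} (I : Interp Δ) {e : ℕ} (y : Fin e → Word) (t : Tm (Fin k ⊕ Fin e)),
      Tm.eval I.ind (Sum.elim (fun i => I.ind (c i)) fun i => I.ind (y i)) t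
        = I.ind (t.eval id (Sum.elim c y)) := by
    intro Δ I e y t
    rcases t with a | (i | i) <;> rfl
  constructor
  · rintro ⟨Δ, I, hI, q, hq, y, hy, hne⟩
    -- The names that the renaming must leave alone: the answer tuple and the constants of the
    -- query.
    let F : Finset Word := (Set.finite_range c).toFinset ∪
      (q.atoms.flatMap (fun f => f.args.flatMap Tm.consts) ++
        q.ineqs.flatMap fun p => p.1.consts ++ p.2.consts).toFinset
    obtain ⟨I', hc, hr, hF, hY, hI'⟩ := Interp.exists_rename hI F (Set.finite_range y)
    choose y' hy' using fun i => hY ⟨i, rfl⟩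
    have hcF : ∀ i, I'.ind (c i) = I.ind (c i) := fun i => hF _ (by simp [F])
    have hval : ∀ t : Tm (Fin k ⊕ Fin q.e), (∀ a ∈ t.consts, a ∈ F) →
        I'.ind (t.eval id (Sum.elim c y'))
          = Tm.eval I.ind (Sum.elim (fun i => I.ind (c i)) y) t := by
      intro t ht
      rw [← heval]
      rcases t with a | (i | i)
      · exact hF a (ht a (by simp [Tm.consts]))
      · exact hcF i
      · exact hy' i
    have hsat : ∀ f : Atom Δ, I'.SatAtom f ↔ I.SatAtom f := by
      intro f
      cases f <;> simp only [Interp.SatAtom, hc, hr]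
    refine ⟨q, hq, y', fun p hp h => hne p hp ?_, Δ, I', CCKB.isModel_addFacts.2 ⟨hI', ?_⟩⟩
    · have h₁ := hval p.1 fun a ha => by
        simp only [F, Finset.mem_union, List.mem_toFinset, List.mem_append, List.mem_flatMap]
        exact .inr (.inr ⟨p, hp, .inl ha⟩)
      have h₂ := hval p.2 fun a ha => by
        simp only [F, Finset.mem_union, List.mem_toFinset, List.mem_append, List.mem_flatMap]
        exact .inr (.inr ⟨p, hp, .inr ha⟩)
      exact h₁.symm.trans ((congrArg I'.ind h).trans h₂)
    · intro f hf
      simp only [CQ.ground, List.mem_toFinset, List.mem_map] at hf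
      obtain ⟨f, hf, rfl⟩ := hf
      rw [Interp.SatAssertion, hsat, Atom.map_map]
      have := hy f hf
      rwa [Atom.map_congr fun t ht => (hval t fun a ha => by
        simp only [F, Finset.mem_union, List.mem_toFinset, List.mem_append, List.mem_flatMap]
        exact .inr (.inl ⟨f, hf, t, ht, ha⟩)).symm] at this
  · rintro ⟨q, hq, y, hne, Δ, I, hI⟩
    obtain ⟨hI, hF⟩ := CCKB.isModel_addFacts.1 hI
    refine ⟨Δ, I, hI, q, hq, fun i => I.ind (y i), fun f hf => ?_, fun p hp h => hne p hp ?_⟩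
    · have := hF (f.map (Tm.eval id (Sum.elim c y)))
        (by simp only [CQ.ground, List.mem_toFinset, List.mem_map]; exact ⟨f, hf, rfl⟩)
      rw [Interp.SatAssertion, Atom.map_map] at this
      convert this using 2
      funext t
      exact heval I y t
    · simp only [heval] at h
      exact I.unique_names h

theorem IsTm.evalTm {V : Type} (t : Tm V) : IsTm fun ρ => t.eval id ρ := ⟨t, fun _ => rfl⟩

/-- The assertion is given by an atom over terms. -/
def IsAtom {V : Type} (f : (V → Word) → Assertion) : Prop :=
  (∃ m, ∃ A t : (V → Word) → Word, IsTm A ∧ IsTm t ∧ ∀ ρ, f ρ = .concept ⟨m, A ρ⟩ (t ρ)) ∨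
    ∃ m, ∃ R t t' : (V → Word) → Word, IsTm R ∧ IsTm t ∧ IsTm t' ∧
      ∀ ρ, f ρ = .role ⟨m, R ρ⟩ (t ρ) (t' ρ)

namespace IsAtom

variable {U V : Type}

theorem concept (m : Mode) {A t : (V → Word) → Word} (hA : IsTm A) (ht : IsTm t) :
    IsAtom fun ρ => .concept ⟨m, A ρ⟩ (t ρ) :=
  .inl ⟨m, A, t, hA, ht, fun _ => rfl⟩

theorem role (m : Mode) {R t t' : (V → Word) → Word} (hR : IsTm R) (ht : IsTm t)
    (ht' : IsTm t') : IsAtom fun ρ => .role ⟨m, R ρ⟩ (t ρ) (t' ρ) :=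
  .inr ⟨m, R, t, t', hR, ht, ht', fun _ => rfl⟩

theorem comp {f : (U → Word) → Assertion} (hf : IsAtom f) (e : U → V) :
    IsAtom fun ρ => f (ρ ∘ e) := by
  rcases hf with ⟨m, A, t, hA, ht, h⟩ | ⟨m, A, t, t', hA, ht, ht', h⟩
  · exact .inl ⟨m, _, _, hA.comp e, ht.comp e, fun _ => h _⟩
  · exact .inr ⟨m, _, _, _, hA.comp e, ht.comp e, ht'.comp e, fun _ => h _⟩

theorem map (f : Atom (Tm U)) {g : U → (V → Word) → Word} (hg : ∀ u, IsTm (g u)) :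
    IsAtom fun ρ => f.map (Tm.eval id fun u => g u ρ) := by
  rcases f with ⟨A, t⟩ | ⟨R, t, t'⟩
  · exact concept A.mode (IsTm.const A.word) (IsTm.tm hg (t := t))
  · exact role R.mode (IsTm.const R.word) (IsTm.tm hg (t := t)) (IsTm.tm hg (t := t'))

end IsAtom

theorem Def.eq_atom {𝒢 : CCKB → Prop} {V : Type} {f f' : (V → Word) → Assertion}
    (hf : IsAtom f) (hf' : IsAtom f') : Def 𝒢 fun _ ρ => f ρ = f' ρ := by
  rcases hf with ⟨m, A, t, hA, ht, h⟩ | ⟨m, A, t₁, t₂, hA, ht₁, ht₂, h⟩ <;>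
    rcases hf' with ⟨m', A', t', hA', ht', h'⟩ | ⟨m', A', t₁', t₂', hA', ht₁', ht₂', h'⟩
  · refine ((const (m = m')).and ((eq hA hA').and (eq ht ht'))).congr fun K _ ρ => ?_
    simp [h, h', and_assoc]
  · exact (const False).congr fun K _ ρ => by simp [h, h']
  · exact (const False).congr fun K _ ρ => by simp [h, h']
  · refine ((const (m = m')).and ((eq hA hA').and ((eq ht₁ ht₁').and (eq ht₂ ht₂')))).congr
      fun K _ ρ => ?_
    simp [h, h', and_assoc]

namespace Def

variable {T S : Finset Constraint}

/-- Applies `wp` to the addition of the grounded atoms. The extended ABox may contain individuals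
that are not open, which is why `Good` puts no condition on the ABox. -/
theorem may {k : ℕ} (φ : UCQNeq k) :
    Def (Good T S) fun K ρ => MustMay.Holds K ρ (.may φ) := by
  refine (exMem (l := φ) fun q _ => exTuple (P := fun K ρ y =>
    (∀ p ∈ q.ineqs, p.1.eval id (Sum.elim ρ y) ≠ p.2.eval id (Sum.elim ρ y)) ∧
      (K.addFacts (q.ground (Sum.elim ρ y))).Sat) ((allMem fun p _ => ?_).and ?_)).congr
        fun K _ ρ => (CCKB.may_iff φ ρ).symm
  · simp only [Sum.elim_comp_inl_inr]
    exact (eq (IsTm.evalTm _) (IsTm.evalTm _)).not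
  · simp only [Sum.elim_comp_inl_inr]
    have hw := wp (𝒢 := Good T S) (U := Fin k ⊕ Fin q.e)
      (F := fun K ρ => some (K.addFacts (q.ground ρ)))
      (R := fun K ρ f => f.HoldsIn (K.addFacts (q.ground ρ)))
      ((const True).congr fun K _ ρ => by simp) ?_ ?_ ?_ (P := fun K _ => K.Sat) sat
    · exact hw.congr fun K _ ρ => by simp
    · rintro K ρ _ hK h
      simp only [Option.some.injEq] at h
      subst h
      exact ⟨hK.tbox, hK.sbox, hK.core⟩
    · rintro K ρ _ f hK h
      simp only [Option.some.injEq] at h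
      subst h
      exact Iff.rfl
    · intro V e f
      have hg : ∀ u, IsTm fun ρ : V → Word => ρ (e u) := fun u => IsTm.var _
      cases f with
      | openInd t => exact mem_openInd (IsTm.evalTm t)
      | modelInd t => exact mem_modelInd (IsTm.evalTm t)
      | mboxConcept i m A t =>
        exact concept_mem_mbox m (IsTm.evalTm i) (IsTm.evalTm A) (IsTm.evalTm t)
      | mboxRole i m A t t' =>
        exact role_mem_mbox m (IsTm.evalTm i) (IsTm.evalTm A) (IsTm.evalTm t) (IsTm.evalTm t')
      | aboxConcept m A t =>
        refine ((concept_mem_abox m (IsTm.evalTm A) (IsTm.evalTm t)).or (exMem (l := q.atoms)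
          fun f _ => eq_atom (IsAtom.concept m (IsTm.evalTm A) (IsTm.evalTm t))
            (IsAtom.map f hg))).congr fun K _ ρ => ?_
        simp [CCKB.addFacts, CQ.ground, Fact.map, Fact.HoldsIn, eq_comm, comp_def]
      | aboxRole m A t t' =>
        refine ((role_mem_abox m (IsTm.evalTm A) (IsTm.evalTm t) (IsTm.evalTm t')).or
          (exMem (l := q.atoms) fun f _ => eq_atom (IsAtom.role m (IsTm.evalTm A)
            (IsTm.evalTm t) (IsTm.evalTm t')) (IsAtom.map f hg))).congr fun K _ ρ => ?_
        simp [CCKB.addFacts, CQ.ground, Fact.map, Fact.HoldsIn, eq_comm, comp_def]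

/-- The truth of a `Must`/`May` query is first-order definable. -/
theorem mustMay {k : ℕ} (ψ : MustMay k) : Def (Good T S) fun K ρ => ψ.Holds K ρ := by
  induction ψ with
  | not ψ ih => exact ih.not
  | and ψ₁ ψ₂ ih₁ ih₂ => exact ih₁.and ih₂
  | or ψ₁ ψ₂ ih₁ ih₂ => exact ih₁.or ih₂
  | must φ => exact must φ
  | may φ => exact may φ

theorem mem_ans {k : ℕ} (ψ : MustMay k) : Def (Good T S) fun K ρ => ρ ∈ ψ.ANS K :=
  ((allFinite fun i => (mem_openInd (IsTm.var i)).or (mem_modelInd (IsTm.var i))).and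
    (mustMay ψ)).congr fun K _ ρ => by simp [MustMay.ANS, CCKB.constants]

end Def

end CoreClosed

namespace CoreClosed

open Function

/-! ## Execution of conditional effects -/

namespace CCKB

variable {K : CCKB} {i j : Word} {S : Finset Assertion} {f : Assertion}

theorem mem_block : f ∈ K.block i ↔ (i, f) ∈ K.mbox := by
  simp [block]

theorem mem_ind_core {a : Word} : a ∈ ind K.core ↔ ∃ f, (∃ i, (i, f) ∈ K.mbox) ∧ a ∈ f.ind := by
  simp only [ind, Finset.mem_biUnion, mem_core_iff]

theorem mem_insertBlock : (j, f) ∈ (K.insertBlock i S).mbox ↔ (j, f) ∈ K.mbox ∨ j = i ∧ f ∈ S := by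
  simp only [insertBlock, Finset.mem_union, Finset.mem_image, Prod.mk.injEq]
  grind

theorem mem_removeBlock :
    (j, f) ∈ (K.removeBlock i S).mbox ↔ (j, f) ∈ K.mbox ∧ ¬ (j = i ∧ f ∈ S) := by
  simp only [removeBlock, Finset.mem_sdiff, Finset.mem_image, Prod.mk.injEq]
  grind

theorem mem_modelInd_insertBlock {a : Word} : a ∈ (K.insertBlock i S).modelInd ↔
    a ∈ K.modelInd ∨ a ∈ ind S ∧ a ∉ K.openInd := by
  simp [insertBlock]

theorem mem_modelInd_removeBlock {a : Word} : a ∈ (K.removeBlock i S).modelInd ↔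
    a ∈ K.modelInd ∧ (a ∈ ind S → a ∈ ind (K.removeBlock i S).core) := by
  simp only [removeBlock, core, Finset.mem_sdiff, not_and, not_not]

theorem block_insertBlock_eq_empty :
    (K.insertBlock i S).block j = ∅ ↔ K.block j = ∅ ∧ (S = ∅ ∨ i ≠ j) := by
  simp only [Finset.eq_empty_iff_forall_notMem, mem_block, mem_insertBlock, not_or, not_and,
    forall_and]
  grind

end CCKB

namespace BasicEffect

variable {V τ : Type}

/-- The node whose block is affected by the effect. -/
def root (ρ : V → Word) : BasicEffect V → Word
  | .add x _ => x.eval id ρ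
  | .remove x _ => x.eval id ρ
  | .create x _ => x.eval id ρ
  | .delete x => x.eval id ρ

/-- The assertions that are put into the block or removed from it. -/
def content (ρ : V → Word) (K : CCKB) : BasicEffect V → Finset Assertion
  | .add _ S => ground ρ S
  | .remove _ S => ground ρ S
  | .create _ S => ground ρ S
  | .delete x => K.block (x.eval id ρ)

/-- The effect is an addition. -/
def Inserts : BasicEffect V → Prop
  | .add _ _ => True
  | .remove _ _ => False
  | .create _ _ => True
  | .delete _ => False

/-- The second grounding of the effect can still be executed after the first one. -/
def Compat (ρ ρ' : V → Word) : BasicEffect V → Prop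
  | .create x S => S = ∅ ∨ x.eval id ρ ≠ x.eval id ρ'
  | _ => True

variable {β : BasicEffect V} {ρ ρ' : V → Word} {K K' : CCKB} {f : Assertion}

theorem update_of_inserts (h : β.Inserts) :
    β.update ρ K = K.insertBlock (β.root ρ) (β.content ρ K) := by
  cases β <;> first | rfl | exact h.elim

theorem update_of_not_inserts (h : ¬ β.Inserts) :
    β.update ρ K = K.removeBlock (β.root ρ) (β.content ρ K) := by
  cases β <;> first | rfl | exact (h trivial).elim

theorem content_of_inserts (h : β.Inserts) : β.content ρ K = β.content ρ K' := by
  cases β <;> first | rfl | exact h.elim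

theorem content_mono (h : K'.mbox ⊆ K.mbox) : β.content ρ K' ⊆ β.content ρ K := by
  cases β
  case delete x => exact fun f hf => CCKB.mem_block.2 (h (CCKB.mem_block.1 hf))
  all_goals exact Finset.Subset.refl _

theorem mem_content_or (hf : f ∈ β.content ρ K) :
    f ∈ β.content ρ K' ∨ (β.root ρ, f) ∈ K.mbox ∧ (β.root ρ, f) ∉ K'.mbox := by
  cases β
  case delete x =>
    by_cases h : (x.eval id ρ, f) ∈ K'.mbox
    · exact .inl (CCKB.mem_block.2 h)
    · exact .inr ⟨CCKB.mem_block.1 hf, h⟩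
  all_goals exact .inl hf

theorem update_openInd : (β.update ρ K).openInd = K.openInd := by
  cases β <;> rfl

theorem update_abox : (β.update ρ K).abox = K.abox := by
  cases β <;> rfl

/-- Open individuals never change, so earlier executions can only affect the freshness condition of
`⊙`. It is lost exactly when the same block has received something. -/
theorem applicable_update :
    β.Applicable ρ' (β.update ρ K) ↔ β.Applicable ρ' K ∧ β.Compat ρ ρ' := by
  cases β
  case create x S =>
    have : ground ρ S = ∅ ↔ S = ∅ := Finset.image_eq_empty
    simp only [Applicable, update, CCKB.block_insertBlock_eq_empty, this, Compat, and_assoc]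
    exact Iff.rfl
  all_goals exact (and_iff_left trivial).symm

theorem Compat.symm (h : β.Compat ρ ρ') : β.Compat ρ' ρ := by
  cases β <;> first | exact trivial | exact Or.imp_right Ne.symm h

theorem inserts_isCore (h : β.Inserts) (hβ : β.Applicable ρ K) (hf : f ∈ β.content ρ K) :
    f.IsCore (↑K.openInd)ᶜ := by
  cases β
  case add => exact hβ.2 f hf
  case create => exact hβ.2.1 f hf
  all_goals exact h.elim

/-- The result of the execution of a basic effect for a list of groundings. -/
theorem foldlM_apply (env : τ → V → Word) (l : List τ) :
    l.foldlM (fun K t => β.apply (env t) K) K = some K' ↔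
      (∀ t ∈ l, β.Applicable (env t) K) ∧ l.Pairwise (fun s t => β.Compat (env s) (env t)) ∧
        l.foldl (fun K t => β.update (env t) K) K = K' := by
  induction l generalizing K with
  | nil => simp
  | cons t l ih =>
    rw [List.foldlM_cons, apply]
    by_cases h : β.Applicable (env t) K
    · simp only [h, if_true, Option.bind_eq_bind, Option.bind_some, ih, applicable_update,
        List.mem_cons, forall_eq_or_imp, List.pairwise_cons, List.foldl_cons, true_and]
      constructor
      · rintro ⟨h₁, h₂, h₃⟩
        exact ⟨fun s hs => (h₁ s hs).1, ⟨fun s hs => (h₁ s hs).2, h₂⟩, h₃⟩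
      · rintro ⟨h₁, ⟨h₂, h₃⟩, h₄⟩
        exact ⟨fun s hs => ⟨h₁ s hs, h₂ s hs⟩, h₃, h₄⟩
    · simp [h]

/-- The knowledge base after the execution of a basic effect for a list of groundings. -/
def updateAll (β : BasicEffect V) (env : τ → V → Word) (l : List τ) (K : CCKB) : CCKB :=
  l.foldl (fun K t => β.update (env t) K) K

variable {env : τ → V → Word} {l : List τ}

theorem updateAll_openInd : (β.updateAll env l K).openInd = K.openInd := by
  induction l generalizing K with
  | nil => rfl
  | cons t l ih => exact ih.trans update_openInd

theorem updateAll_abox : (β.updateAll env l K).abox = K.abox := by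
  induction l generalizing K with
  | nil => rfl
  | cons t l ih => exact ih.trans update_abox

theorem updateAll_tbox : (β.updateAll env l K).tbox = K.tbox := by
  induction l generalizing K with
  | nil => rfl
  | cons t l ih => exact ih.trans (by cases β <;> rfl)

theorem updateAll_sbox : (β.updateAll env l K).sbox = K.sbox := by
  induction l generalizing K with
  | nil => rfl
  | cons t l ih => exact ih.trans (by cases β <;> rfl)

theorem mem_mbox_updateAll_of_inserts (h : β.Inserts) {i : Word} :
    (i, f) ∈ (β.updateAll env l K).mbox ↔
      (i, f) ∈ K.mbox ∨ ∃ t ∈ l, i = β.root (env t) ∧ f ∈ β.content (env t) K := by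
  induction l generalizing K with
  | nil => simp [updateAll]
  | cons t l ih =>
    refine ih.trans ?_
    simp only [update_of_inserts h, CCKB.mem_insertBlock, List.mem_cons, exists_eq_or_imp,
      content_of_inserts h (K := K.insertBlock _ _) (K' := K), or_assoc]

theorem mem_modelInd_updateAll_of_inserts (h : β.Inserts) {a : Word} :
    a ∈ (β.updateAll env l K).modelInd ↔
      a ∈ K.modelInd ∨ ∃ t ∈ l, a ∈ ind (β.content (env t) K) ∧ a ∉ K.openInd := by
  induction l generalizing K with
  | nil => simp [updateAll]
  | cons t l ih =>
    refine ih.trans ?_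
    have ho : (K.insertBlock (β.root (env t)) (β.content (env t) K)).openInd = K.openInd := rfl
    simp only [ho, update_of_inserts h, CCKB.mem_modelInd_insertBlock, List.mem_cons,
      exists_eq_or_imp, content_of_inserts h (K := K.insertBlock _ _) (K' := K), or_assoc]

theorem update_mbox_subset (h : ¬ β.Inserts) : (β.update ρ K).mbox ⊆ K.mbox := by
  rintro ⟨i, f⟩ hf
  rw [update_of_not_inserts h, CCKB.mem_removeBlock] at hf
  exact hf.1

theorem mem_mbox_updateAll_of_not_inserts (h : ¬ β.Inserts) {i : Word} :
    (i, f) ∈ (β.updateAll env l K).mbox ↔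
      (i, f) ∈ K.mbox ∧ ∀ t ∈ l, ¬ (i = β.root (env t) ∧ f ∈ β.content (env t) K) := by
  induction l generalizing K with
  | nil => simp [updateAll]
  | cons t l ih =>
    refine ih.trans ?_
    simp only [List.mem_cons, forall_eq_or_imp]
    have hm : (i, f) ∈ (β.update (env t) K).mbox ↔
        (i, f) ∈ K.mbox ∧ ¬ (i = β.root (env t) ∧ f ∈ β.content (env t) K) := by
      rw [update_of_not_inserts h, CCKB.mem_removeBlock]
    rw [← and_assoc, ← hm]
    -- The content of a deletion shrinks as blocks are emptied, but not with respect to an assertion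
    -- that is still present.
    refine and_congr_right fun hi => forall₂_congr fun s _ => not_congr (and_congr_right ?_)
    rintro rfl
    refine ⟨fun hf => content_mono (update_mbox_subset h) hf, fun hf => ?_⟩
    exact (mem_content_or hf).resolve_right fun h' => h'.2 hi

/-- Each step compares with the core of that moment, yet comparing with the final core gives the
same result: if the last occurrence of `a` disappears later, the step that removes it also removes
`a`. -/
theorem mem_modelInd_updateAll_of_not_inserts (h : ¬ β.Inserts) {a : Word} :
    a ∈ (β.updateAll env l K).modelInd ↔ a ∈ K.modelInd ∧
      ∀ t ∈ l, a ∈ ind (β.content (env t) K) → a ∈ ind (β.updateAll env l K).core := by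
  induction l generalizing K with
  | nil => simp [updateAll]
  | cons t l ih =>
    refine (ih (K := β.update (env t) K)).trans ?_
    change _ ↔ _ ∧ ∀ s ∈ t :: l, _ → a ∈ ind (β.updateAll env l (β.update (env t) K)).core
    set K₁ := β.update (env t) K with hK₁
    set K' := β.updateAll env l K₁ with hK'
    have hsub : K₁.mbox ⊆ K.mbox := update_mbox_subset h
    have hm : a ∈ K₁.modelInd ↔
        a ∈ K.modelInd ∧ (a ∈ ind (β.content (env t) K) → a ∈ ind K₁.core) := by
      rw [hK₁, update_of_not_inserts h, CCKB.mem_modelInd_removeBlock]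
    have hcore : a ∈ ind K'.core → a ∈ ind K₁.core := by
      simp only [CCKB.mem_ind_core]
      rintro ⟨f, ⟨i, hi⟩, ha⟩
      exact ⟨f, ⟨i, ((mem_mbox_updateAll_of_not_inserts h).1 hi).1⟩, ha⟩
    simp only [List.mem_cons, forall_eq_or_imp, hm]
    constructor
    · rintro ⟨⟨h₁, h₂⟩, h₃⟩
      -- An assertion that keeps `a` alive after the first step either survives to the end or
      -- belongs to the content of a later step, to which `h₃` applies.
      have key : a ∈ ind (β.content (env t) K) → a ∈ ind K'.core := by
        intro ha
        obtain ⟨f, ⟨i, hi⟩, haf⟩ := CCKB.mem_ind_core.1 (h₂ ha)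
        by_cases hi' : (i, f) ∈ K'.mbox
        · exact CCKB.mem_ind_core.2 ⟨f, ⟨i, hi'⟩, haf⟩
        · rw [mem_mbox_updateAll_of_not_inserts h] at hi'
          push Not at hi'
          obtain ⟨s, hs, -, hf⟩ := hi' hi
          exact h₃ s hs (Finset.mem_biUnion.2 ⟨f, hf, haf⟩)
      refine ⟨h₁, key, fun s hs ha => ?_⟩
      obtain ⟨f, hf, haf⟩ := Finset.mem_biUnion.1 ha
      rcases mem_content_or (K' := K₁) hf with hf | ⟨hf, hf'⟩
      · exact h₃ s hs (Finset.mem_biUnion.2 ⟨f, hf, haf⟩)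
      · rw [hK₁, update_of_not_inserts h, CCKB.mem_removeBlock, not_and, not_not] at hf'
        exact key (Finset.mem_biUnion.2 ⟨f, (hf' hf).2, haf⟩)
    · rintro ⟨h₁, h₂, h₃⟩
      refine ⟨⟨h₁, fun ha => hcore (h₂ ha)⟩, fun s hs ha => h₃ s hs ?_⟩
      obtain ⟨f, hf, haf⟩ := Finset.mem_biUnion.1 ha
      exact Finset.mem_biUnion.2 ⟨f, content_mono hsub hf, haf⟩

end BasicEffect

theorem Assertion.IsCore.mono {N N' : Set Word} {f : Assertion} (hf : f.IsCore N)
    (h : ∀ a ∈ f.ind, a ∈ N → a ∈ N') : f.IsCore N' := by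
  cases f with
  | concept A a => exact ⟨hf.1, h _ (by simp [ind]) hf.2⟩
  | role R a b => exact ⟨hf.1, hf.2.imp (h _ (by simp [ind])) (h _ (by simp [ind]))⟩

/-- Individuals of inserted assertions that are not open become model individuals, and an individual
still occurring in the core is never dropped. So core assertions remain core assertions. -/
theorem Good.updateAll {T S : Finset Constraint} {K : CCKB} (hK : Good T S K) {V τ : Type}
    {β : BasicEffect V} {env : τ → V → Word} {l : List τ}
    (hl : ∀ t ∈ l, β.Applicable (env t) K) : Good T S (β.updateAll env l K) := by
  refine ⟨BasicEffect.updateAll_tbox.trans hK.tbox, BasicEffect.updateAll_sbox.trans hK.sbox,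
    fun f hf => ?_⟩
  obtain ⟨i, hi⟩ := CCKB.mem_core_iff.1 hf
  by_cases h : β.Inserts
  · rcases (BasicEffect.mem_mbox_updateAll_of_inserts h).1 hi with hi | ⟨t, ht, -, hft⟩
    · refine (hK.core f (CCKB.mem_core_iff.2 ⟨i, hi⟩)).mono fun a _ ha => ?_
      exact (BasicEffect.mem_modelInd_updateAll_of_inserts h).2 (.inl ha)
    · refine (BasicEffect.inserts_isCore h (hl t ht) hft).mono fun a haf ha => ?_
      exact (BasicEffect.mem_modelInd_updateAll_of_inserts h).2
        (.inr ⟨t, ht, Finset.mem_biUnion.2 ⟨f, hft, haf⟩, ha⟩)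
  · have hi' := ((BasicEffect.mem_mbox_updateAll_of_not_inserts h).1 hi).1
    refine (hK.core f (CCKB.mem_core_iff.2 ⟨i, hi'⟩)).mono fun a haf ha => ?_
    exact (BasicEffect.mem_modelInd_updateAll_of_not_inserts h).2
      ⟨ha, fun _ _ _ => Finset.mem_biUnion.2 ⟨f, hf, haf⟩⟩

end CoreClosed

namespace CoreClosed

open Function

/-! ## Definability of the result of an action -/

namespace Def

section

variable {𝒢 : CCKB → Prop} {U V : Type}

theorem mem_mbox {i : (V → Word) → Word} {f : (V → Word) → Assertion} (hi : IsTm i)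
    (hf : IsAtom f) : Def 𝒢 fun K ρ => (i ρ, f ρ) ∈ K.mbox := by
  rcases hf with ⟨m, A, t, hA, ht, h⟩ | ⟨m, A, t, t', hA, ht, ht', h⟩
  · exact (concept_mem_mbox m hi hA ht).congr fun _ _ ρ => by rw [h]
  · exact (role_mem_mbox m hi hA ht ht').congr fun _ _ ρ => by rw [h]

theorem mem_ind {a : (V → Word) → Word} {f : (V → Word) → Assertion} (ha : IsTm a)
    (hf : IsAtom f) : Def 𝒢 fun _ ρ => a ρ ∈ (f ρ).ind := by
  rcases hf with ⟨m, A, t, hA, ht, h⟩ | ⟨m, A, t, t', hA, ht, ht', h⟩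
  · exact (eq ha ht).congr fun _ _ ρ => by simp [h, Assertion.ind]
  · exact ((eq ha ht).or (eq ha ht')).congr fun _ _ ρ => by simp [h, Assertion.ind]

theorem isCore {f : (V → Word) → Assertion} (hf : IsAtom f) :
    Def 𝒢 fun K ρ => (f ρ).IsCore (↑K.openInd)ᶜ := by
  rcases hf with ⟨m, A, t, hA, ht, h⟩ | ⟨m, A, t, t', hA, ht, ht', h⟩
  · exact ((const (m = .core)).and (mem_openInd ht).not).congr fun _ _ ρ => by
      simp [h, Assertion.IsCore]
  · exact ((const (m = .core)).and ((mem_openInd ht).not.or (mem_openInd ht').not)).congr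
      fun _ _ ρ => by simp [h, Assertion.IsCore]

/-- An assertion consists of a kind, a mode and at most three words, so quantifying over assertions
is a finite disjunction of quantifiers over triples of words. -/
theorem exAtom {P : CCKB → (V → Word) → Assertion → Prop}
    (h : ∀ f : (V ⊕ Fin 3 → Word) → Assertion, IsAtom f →
      Def 𝒢 fun K ρ => P K (ρ ∘ Sum.inl) (f ρ)) : Def 𝒢 fun K ρ => ∃ f, P K ρ f := by
  have : Finite Mode := Finite.of_injective (fun m => decide (m = .core)) (by
    rintro (_ | _) (_ | _) <;> simp)
  refine ((exFinite (ι := Mode) fun m => exTuple (m := 3) (P := fun K ρ y =>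
    P K ρ (.concept ⟨m, y 0⟩ (y 1))) (h _ (IsAtom.concept m (IsTm.var (Sum.inr 0))
      (IsTm.var (Sum.inr 1))))).or (exFinite (ι := Mode) fun m => exTuple (m := 3) (P := fun K ρ y =>
    P K ρ (.role ⟨m, y 0⟩ (y 1) (y 2))) (h _ (IsAtom.role m (IsTm.var (Sum.inr 0))
      (IsTm.var (Sum.inr 1)) (IsTm.var (Sum.inr 2)))))).congr fun K _ ρ => ?_
  constructor
  · rintro (⟨m, y, hy⟩ | ⟨m, y, hy⟩)
    · exact ⟨_, hy⟩
    · exact ⟨_, hy⟩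
  · rintro ⟨⟨⟨m, A⟩, t⟩ | ⟨⟨m, R⟩, t, t'⟩, hf⟩
    · exact .inl ⟨m, ![A, t, []], hf⟩
    · exact .inr ⟨m, ![R, t, t'], hf⟩

theorem mem_ind_core {a : (V → Word) → Word} (ha : IsTm a) :
    Def 𝒢 fun K ρ => a ρ ∈ ind K.core :=
  (exAtom (P := fun K ρ f => (∃ i, (i, f) ∈ K.mbox) ∧ a ρ ∈ f.ind) fun f hf =>
    (ex (P := fun K ρ i => (i, f ρ) ∈ K.mbox) (mem_mbox (IsTm.var _) (hf.comp _))).and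
      (mem_ind (ha.comp _) hf)).congr fun _ _ _ => CCKB.mem_ind_core.symm

section

variable {W : Type} {g : W → (V → Word) → Word}

theorem isTm_root (β : BasicEffect W) (hg : ∀ w, IsTm (g w)) :
    IsTm fun ρ => β.root fun w => g w ρ := by
  cases β <;> exact IsTm.tm hg

theorem mem_content (β : BasicEffect W) {f : (V → Word) → Assertion} (hg : ∀ w, IsTm (g w))
    (hf : IsAtom f) : Def 𝒢 fun K ρ => f ρ ∈ β.content (fun w => g w ρ) K := by
  have h : ∀ S : Finset (Atom (Tm W)), Def 𝒢 fun _ ρ =>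
      f ρ ∈ BasicEffect.ground (fun w => g w ρ) S := fun S =>
    (exMemFinset (l := S) fun f' _ => eq_atom (IsAtom.map f' hg) hf).congr fun _ _ _ => by
      simp only [BasicEffect.ground, Finset.mem_image]
  cases β with
  | delete x => exact (mem_mbox (IsTm.tm hg) hf).congr fun _ _ _ => CCKB.mem_block.symm
  | _ => exact h _

theorem applicable (β : BasicEffect W) (hg : ∀ w, IsTm (g w)) :
    Def 𝒢 fun K ρ => β.Applicable (fun w => g w ρ) K := by
  have hcore : ∀ S : Finset (Atom (Tm W)), Def 𝒢 fun K ρ =>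
      ∀ f ∈ BasicEffect.ground (fun w => g w ρ) S, f.IsCore (↑K.openInd)ᶜ := fun S =>
    (allMemFinset (l := S) fun f _ => isCore (IsAtom.map f hg)).congr fun _ _ _ => by
      simp only [BasicEffect.ground, Finset.forall_mem_image]
  have hroot : ∀ x : Tm W, Def 𝒢 fun K ρ => x.eval id (fun w => g w ρ) ∉ K.openInd :=
    fun x => (mem_openInd (IsTm.tm hg)).not
  cases β with
  | add x S => exact (hroot x).and (hcore S)
  | remove x S => exact (hroot x).and (hcore S)
  | create x S =>
    refine (hroot x).and ((hcore S).and ((exAtom (P := fun K ρ f =>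
      (x.eval id fun w => g w ρ, f) ∈ K.mbox) fun f hf =>
        mem_mbox ((IsTm.tm hg).comp _) hf).not.congr fun K _ ρ => ?_))
    simp only [Finset.eq_empty_iff_forall_notMem, CCKB.mem_block, not_exists]
  | delete x => exact hroot x

theorem compat (β : BasicEffect W) {g' : W → (V → Word) → Word} (hg : ∀ w, IsTm (g w))
    (hg' : ∀ w, IsTm (g' w)) :
    Def 𝒢 fun _ ρ => β.Compat (fun w => g w ρ) fun w => g' w ρ := by
  cases β with
  | create x S => exact (const (S = ∅)).or (eq (IsTm.tm hg) (IsTm.tm hg')).not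
  | _ => exact const True

end

end

section

variable {T S : Finset Constraint} {U W : Type} {m : ℕ}

/-- Definability of the weakest precondition of the execution of a basic effect for a definable
list of groundings. -/
theorem wp_foldlM (β : BasicEffect W) {env : (U → Word) → (Fin m → Word) → W → Word}
    (henv : ∀ w, IsTm fun ρ : U ⊕ Fin m → Word => env (ρ ∘ Sum.inl) (ρ ∘ Sum.inr) w)
    {L : CCKB → (U → Word) → List (Fin m → Word)} (hL : ∀ K ρ, (L K ρ).Nodup)
    (hdef : Def (Good T S) fun K (ρ : U ⊕ Fin m → Word) => ρ ∘ Sum.inr ∈ L K (ρ ∘ Sum.inl))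
    {P : CCKB → (U → Word) → Prop} (hP : Def (Good T S) P) :
    Def (Good T S) fun K ρ =>
      ∃ K', (L K ρ).foldlM (fun K t => β.apply (env ρ t) K) K = some K' ∧ P K' ρ := by
  have hmem : ∀ {V : Type} (e : U → V) (y : Fin m → V),
      Def (Good T S) fun K (ρ : V → Word) => ρ ∘ y ∈ L K (ρ ∘ e) := fun e y =>
    hdef.comp (Sum.elim e y)
  -- The list of groundings varies with the knowledge base, so membership in it is treated as a
  -- definable relation on tuples; within its scope a grounding consists of terms.
  have hex : ∀ {V : Type} (e : U → V) {Q : CCKB → (V → Word) → (W → Word) → Prop},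
      (∀ g : W → (V ⊕ Fin m → Word) → Word, (∀ w, IsTm (g w)) →
        Def (Good T S) fun K ρ => Q K (ρ ∘ Sum.inl) fun w => g w ρ) →
      Def (Good T S) fun K (ρ : V → Word) => ∃ t ∈ L K (ρ ∘ e), Q K ρ (env (ρ ∘ e) t) := by
    intro V e Q hQ
    exact exTuple (P := fun K ρ t => t ∈ L K (ρ ∘ e) ∧ Q K ρ (env (ρ ∘ e) t))
      ((hmem (Sum.inl ∘ e) Sum.inr).and
        (hQ _ fun w => (henv w).comp (Sum.elim (Sum.inl ∘ e) Sum.inr)))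
  have hall : ∀ {V : Type} (e : U → V) {Q : CCKB → (V → Word) → (W → Word) → Prop},
      (∀ g : W → (V ⊕ Fin m → Word) → Word, (∀ w, IsTm (g w)) →
        Def (Good T S) fun K ρ => Q K (ρ ∘ Sum.inl) fun w => g w ρ) →
      Def (Good T S) fun K (ρ : V → Word) => ∀ t ∈ L K (ρ ∘ e), Q K ρ (env (ρ ∘ e) t) := by
    intro V e Q hQ
    exact (hex e (Q := fun K ρ σ => ¬ Q K ρ σ) fun g hg => (hQ g hg).not).not.congr
      fun K _ ρ => by simp
  have hmbox : ∀ {V : Type} (e : U → V) {i : (V → Word) → Word} {f : (V → Word) → Assertion},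
      IsTm i → IsAtom f → Def (Good T S) fun K ρ =>
        (i ρ, f ρ) ∈ (β.updateAll (env (ρ ∘ e)) (L K (ρ ∘ e)) K).mbox := by
    intro V e i f hi hf
    have hQ := hex e (Q := fun K ρ σ => i ρ = β.root σ ∧ f ρ ∈ β.content σ K) fun g hg =>
      (eq (hi.comp _) (isTm_root β hg)).and (mem_content β hg (hf.comp _))
    by_cases h : β.Inserts
    · exact ((mem_mbox hi hf).or hQ).congr fun _ _ _ =>
        (BasicEffect.mem_mbox_updateAll_of_inserts h).symm
    · exact ((mem_mbox hi hf).and hQ.not).congr fun _ _ _ => by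
        rw [BasicEffect.mem_mbox_updateAll_of_not_inserts h]
        simp
  have hind : ∀ {V : Type} {g : W → (V → Word) → Word} {a : (V → Word) → Word},
      (∀ w, IsTm (g w)) → IsTm a →
        Def (Good T S) fun K ρ => a ρ ∈ ind (β.content (fun w => g w ρ) K) := by
    intro V g a hg ha
    exact (exAtom (P := fun K ρ f => f ∈ β.content (fun w => g w ρ) K ∧ a ρ ∈ f.ind) fun f hf =>
      (mem_content β (fun w => (hg w).comp _) hf).and (mem_ind (ha.comp _) hf)).congr
        fun _ _ _ => by simp only [ind, Finset.mem_biUnion]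
  have hmodel : ∀ {V : Type} (e : U → V) {a : (V → Word) → Word}, IsTm a →
      Def (Good T S) fun K ρ =>
        a ρ ∈ (β.updateAll (env (ρ ∘ e)) (L K (ρ ∘ e)) K).modelInd := by
    intro V e a ha
    by_cases h : β.Inserts
    · exact ((mem_modelInd ha).or (hex e (Q := fun K ρ σ =>
        a ρ ∈ ind (β.content σ K) ∧ a ρ ∉ K.openInd) fun g hg =>
          (hind hg (ha.comp _)).and (mem_openInd (ha.comp _)).not)).congr fun _ _ _ =>
            (BasicEffect.mem_modelInd_updateAll_of_inserts h).symm
    · have hcore : Def (Good T S) fun K (ρ : V → Word) =>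
          a ρ ∈ ind (β.updateAll (env (ρ ∘ e)) (L K (ρ ∘ e)) K).core :=
        (exAtom (P := fun K ρ f => (∃ i, (i, f) ∈
            (β.updateAll (env (ρ ∘ e)) (L K (ρ ∘ e)) K).mbox) ∧ a ρ ∈ f.ind) fun f hf =>
          (ex (P := fun K ρ i => (i, f ρ) ∈ (β.updateAll (env (ρ ∘ Sum.inl ∘ e))
              (L K (ρ ∘ Sum.inl ∘ e)) K).mbox)
            (hmbox (some ∘ Sum.inl ∘ e) (IsTm.var _) (hf.comp _))).and
              (mem_ind (ha.comp _) hf)).congr fun _ _ _ => CCKB.mem_ind_core.symm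
      exact ((mem_modelInd ha).and ((hex e (Q := fun K ρ σ => a ρ ∈ ind (β.content σ K))
        fun g hg => hind hg (ha.comp _)).imp hcore)).congr fun _ _ _ => by
          rw [BasicEffect.mem_modelInd_updateAll_of_not_inserts h]
          simp
  have hsome : ∀ K ρ K', (L K ρ).foldlM (fun K t => β.apply (env ρ t) K) K = some K' ↔
      ((∀ t ∈ L K ρ, β.Applicable (env ρ t) K) ∧
        ∀ s ∈ L K ρ, ∀ t ∈ L K ρ, s ≠ t → β.Compat (env ρ s) (env ρ t)) ∧
      β.updateAll (env ρ) (L K ρ) K = K' := by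
    intro K ρ K'
    rw [BasicEffect.foldlM_apply, ← and_assoc]
    refine and_congr_left fun _ => and_congr_right fun _ => ?_
    refine ⟨fun h s hs t ht hst => ?_, fun h => ?_⟩
    -- Symmetry of compatibility and the absence of repetitions turn the ordered pairwise condition
    -- into one on the set of groundings, which is definable.
    · have : Std.Symm fun s t => β.Compat (env ρ s) (env ρ t) :=
        ⟨fun s t hst => BasicEffect.Compat.symm hst⟩
      exact h.forall hs ht hst
    · exact (hL K ρ).pairwise_of_forall_ne fun s hs t ht => h s hs t ht
  refine wp (R := fun K ρ f => f.HoldsIn (β.updateAll (env ρ) (L K ρ) K)) ?_ ?_ ?_ ?_ hP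
  · have happ := hall id (Q := fun K _ σ => β.Applicable σ K) fun g hg => applicable β hg
    have hcompat : Def (Good T S) fun K ρ =>
        ∀ s, s ∈ L K ρ → ∀ t, t ∈ L K ρ → s ≠ t → β.Compat (env ρ s) (env ρ t) := by
      refine allTuple (P := fun K ρ s => s ∈ L K ρ → ∀ t, t ∈ L K ρ → s ≠ t →
        β.Compat (env ρ s) (env ρ t)) ((hmem Sum.inl Sum.inr).imp (allTuple
          (P := fun K ρ t => t ∈ L K (ρ ∘ Sum.inl) → ρ ∘ Sum.inr ≠ t →
            β.Compat (env (ρ ∘ Sum.inl) (ρ ∘ Sum.inr)) (env (ρ ∘ Sum.inl) t))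
          ((hmem (Sum.inl ∘ Sum.inl) Sum.inr).imp (Def.imp (Def.not ?_) (compat β ?_ ?_)))))
      · exact (allFinite fun i : Fin m => eq (IsTm.var (Sum.inl (Sum.inr i)))
          (IsTm.var (Sum.inr i))).congr
          fun _ _ _ => funext_iff.symm
      · exact fun w => (henv w).comp Sum.inl
      · exact fun w => (henv w).comp (Sum.elim (Sum.inl ∘ Sum.inl) Sum.inr)
    exact (happ.and hcompat).congr fun K _ ρ => by
      simp only [hsome, exists_and_left, exists_eq', and_true]
      exact Iff.rfl
  · intro K ρ K' hK h
    rw [hsome] at h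
    rw [← h.2]
    exact hK.updateAll h.1.1
  · intro K ρ K' f _ h
    rw [hsome] at h
    rw [← h.2]
  · intro V e f
    cases f with
    | openInd t =>
      exact (mem_openInd (IsTm.evalTm t)).congr fun _ _ _ => by
        simp only [Fact.map, Fact.HoldsIn, BasicEffect.updateAll_openInd]
    | modelInd t => exact hmodel e (IsTm.evalTm t)
    | aboxConcept m A t =>
      exact (concept_mem_abox m (IsTm.evalTm A) (IsTm.evalTm t)).congr fun _ _ _ => by
        simp only [Fact.map, Fact.HoldsIn, BasicEffect.updateAll_abox]
    | aboxRole m A t t' =>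
      exact (role_mem_abox m (IsTm.evalTm A) (IsTm.evalTm t) (IsTm.evalTm t')).congr
        fun _ _ _ => by simp only [Fact.map, Fact.HoldsIn, BasicEffect.updateAll_abox]
    | mboxConcept i m A t =>
      exact hmbox e (IsTm.evalTm i) (IsAtom.concept m (IsTm.evalTm A) (IsTm.evalTm t))
    | mboxRole i m A t t' =>
      exact hmbox e (IsTm.evalTm i)
        (IsAtom.role m (IsTm.evalTm A) (IsTm.evalTm t) (IsTm.evalTm t'))

theorem actQuery_isCore {V : Type} {g : W → (V → Word) → Word} (hg : ∀ w, IsTm (g w))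
    (φ : ActQuery W) :
    Def (Good T S) fun K ρ => φ.IsCore (fun w => g w ρ) (↑K.openInd)ᶜ := by
  induction φ with
  | atom f => exact isCore (IsAtom.map f hg)
  | and φ₁ φ₂ ih₁ ih₂ => exact ih₁.and ih₂
  | or φ₁ φ₂ ih₁ ih₂ => exact ih₁.and ih₂
  | not φ ih => exact ih

theorem actQuery_holds {V : Type} {g : W → (V → Word) → Word} (hg : ∀ w, IsTm (g w))
    (φ : ActQuery W) : Def (Good T S) fun K ρ => φ.Holds (fun w => g w ρ) K.core := by
  induction φ with
  | atom f =>
    exact (ex (P := fun K ρ i => (i, f.map (Tm.eval id fun w => g w ρ)) ∈ K.mbox)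
      (mem_mbox (IsTm.var _) ((IsAtom.map f hg).comp _))).congr fun _ _ _ =>
        CCKB.mem_core_iff.symm
  | and φ₁ φ₂ ih₁ ih₂ => exact ih₁.and ih₂
  | or φ₁ φ₂ ih₁ ih₂ => exact ih₁.or ih₂
  | not φ ih => exact ih.not

theorem mem_actQuery_ans {n : ℕ} (φ : ActQuery (Fin n ⊕ Fin m)) (e : Fin n → U) :
    Def (Good T S) fun K (ρ : U ⊕ Fin m → Word) =>
      ρ ∘ Sum.inr ∈ (φ.ANS (ρ ∘ Sum.inl ∘ e) K).toList := by
  have hg : ∀ w : Fin n ⊕ Fin m, IsTm fun ρ : U ⊕ Fin m → Word =>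
      (Sum.elim (ρ ∘ Sum.inl ∘ e) (ρ ∘ Sum.inr) : Fin n ⊕ Fin m → Word) w := by
    rintro (i | i)
    · exact IsTm.var _
    · exact IsTm.var _
  exact ((allFinite fun i : Fin m => (mem_modelInd (IsTm.var (Sum.inr i))).or
    (mem_ind_core (IsTm.var (Sum.inr i)))).and ((actQuery_isCore hg φ).and
      (actQuery_holds hg φ))).congr fun K _ ρ => by simp [ActQuery.ANS]

/-- Definability of the weakest precondition of an action. -/
theorem wp_action {n : ℕ} (γ : Action n) (e : Fin n → U) {P : CCKB → (U → Word) → Prop}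
    (hP : Def (Good T S) P) :
    Def (Good T S) fun K ρ => ∃ K', γ.apply (ρ ∘ e) K = some K' ∧ P K' ρ := by
  induction γ with
  | nil => exact hP.congr fun K _ ρ => by simp [Action.apply]
  | basic β γ ih =>
    -- An unconditional effect is a conditional one with the empty tuple as its only answer.
    refine (wp_foldlM β (m := 0) (env := fun ρ _ => ρ ∘ e) (L := fun _ _ => [Fin.elim0])
      (fun w => IsTm.var _) (fun _ _ => List.nodup_singleton _)
        ((const True).congr fun K _ ρ => ?_) ih).congr fun K _ ρ => ?_
    · simp [Subsingleton.elim (ρ ∘ Sum.inr : Fin 0 → Word) Fin.elim0]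
    · simp only [List.foldlM_cons, List.foldlM_nil, Action.apply, Option.bind_eq_some_iff]
      simp
      grind
  | cond m φ β γ ih =>
    refine (wp_foldlM β (env := fun ρ t => Sum.elim (ρ ∘ e) t)
      (L := fun K ρ => (φ.ANS (ρ ∘ e) K).toList) ?_ (fun _ _ => Finset.nodup_toList _)
        (mem_actQuery_ans φ e) ih).congr fun K _ ρ => ?_
    · rintro (i | i)
      · exact IsTm.var _
      · exact IsTm.var _
    · simp only [Action.apply, Option.bind_eq_some_iff]
      grind

/-- Equality of answer sets compares the old and the new knowledge base, whereas the predicate under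
`wp_action` speaks of the new one only. Splitting on whether `c` is an old answer moves the old
knowledge base outside: no execution may lose an answer or gain one. -/
theorem preserves {n k : ℕ} (γ : Action n) (q : MustMay k) :
    Def (Good T S) fun K (_ : Empty → Word) => Preserves γ q K := by
  have hans : Def (Good T S) fun K (ρ : (Empty ⊕ Fin n) ⊕ Fin k → Word) =>
      ρ ∘ Sum.inr ∈ q.ANS K := (mem_ans q).comp Sum.inr
  have h := allTuple (m := n) (P := fun K (_ : Empty → Word) θ => ∀ c : Fin k → Word,
    (c ∈ q.ANS K → ¬ ∃ K', γ.apply θ K = some K' ∧ c ∉ q.ANS K') ∧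
      (c ∉ q.ANS K → ¬ ∃ K', γ.apply θ K = some K' ∧ c ∈ q.ANS K'))
    (allTuple (P := fun K (ρ : Empty ⊕ Fin n → Word) (c : Fin k → Word) =>
      (c ∈ q.ANS K → ¬ ∃ K', γ.apply (ρ ∘ Sum.inr) K = some K' ∧ c ∉ q.ANS K') ∧
        (c ∉ q.ANS K → ¬ ∃ K', γ.apply (ρ ∘ Sum.inr) K = some K' ∧ c ∈ q.ANS K'))
      ((hans.imp (wp_action γ (Sum.inl ∘ Sum.inr) hans.not).not).and
        (hans.not.imp (wp_action γ (Sum.inl ∘ Sum.inr) hans).not)))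
  refine h.congr fun K _ _ => forall_congr' fun θ => ?_
  constructor
  · intro h K' hK'
    ext c
    by_contra hc
    have := h c
    grind
  · intro h c
    constructor
    · rintro hc ⟨K', hK', hc'⟩
      exact hc' (h K' hK' ▸ hc)
    · rintro hc ⟨K', hK', hc'⟩
      exact hc (h K' hK' ▸ hc')

end

end Def

end CoreClosed

theorem mainTheorem1 (T S : Finset CoreClosed.Constraint)
    (hT : ∀ c ∈ T, c.IsTerm) (hS : ∀ c ∈ S, c.IsSpec)
    {n k : ℕ} (γ : CoreClosed.Action n) (q : CoreClosed.MustMay k) :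
    CoreClosed.DecidableInPolyTime (fun D : CoreClosed.Input T S => D.1.encode)
      (fun D => CoreClosed.Preserves γ q (D.1.kb T S)) := by
  obtain ⟨φ, hφ⟩ := CoreClosed.Def.preserves (T := T) (S := S) γ q
  obtain ⟨f, hf, h⟩ := φ.decidableInPolyTime T S
  exact ⟨f, fun D => (hf D).trans (hφ _ ⟨rfl, rfl, D.2.mbox⟩ _), h⟩
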